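/- Let $p$ be a prime and let $(K,v)$ be a $p$-adically closed valued field: $K\supseteq\mathbb{Q}$, $v\colon K\to\Gamma\cup\{\infty\}$ is a surjective valuation extending the $p$-adic valuation of $\mathbb{Q}$, with residue field $\mathbb{F}_p$, $v(p)$ is the least positive element of $\Gamma$, $(K,v)$ is Henselian, and $\Gamma$ is a model of Presburger arithmetic. "Definable" means first-order definable in the ring language with the additional relation $v(x)\le v(y)$, and $P_k^*$ denotes the set of nonzero $k$-th powers of $K$. The cells in $K^n$ are defined recursively: (1) a single point of $K^n$ is a cell; (2) if $\gamma_1,\gamma_2\in\Gamma\cup\{-\infty,\infty\}$, $d\in K$, $k\in\mathbb{N}$, $\lambda\in K^\times$ and each of $\Box_1,\Box_2$ is $<$, $\le$ or no condition, then $\{x\in K:\gamma_1\,\Box_1\,v(x-d)\,\Box_2\,\gamma_2 \text{ and } P_k^*(\lambda(x-d))\}$ is a cell; (3) the graph of a definable continuous function from a cell to $K$ is a cell; (4) if $B\subseteq K^n$ is a cell, $f,g,h\colon B\to K$ are definable and continuous, $k\in\mathbb{N}$, $\lambda\in K^\times$ and $\Box_1,\Box_2$ are as above, then \[ C=\{(\bar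 x,y)\in B\times K: v(f(\bar x))\,\Box_1\,v(y-g(\bar x))\,\Box_2\,v(h(\bar x))\text{ and }P_k^*(\lambda(y-g(\bar x)))\} \] is a cell. Let $C$ be a cell as in (4) (with $n\ge 0$), where $f$ and $g$ are definable with parameters from a set $D\subseteq K$ and $h$ is definable with parameters from a set $E\subseteq K$. Let $(\bar a,b)\in C$, where $b$ is transcendental over $\mathbb{Q}(\bar a,\lambda,D)$, and let $c\in K$ be transcendental over $\mathbb{Q}(\bar a)$. Then there is $c'\in K$ with $(\bar a,c')\in C$ such that $c$ and $c'$ are interalgebraic over $\bar a$ and the parameters $D\cup E$, i.e. $c'$ is algebraic over $\mathbb{Q}(\bar a,D,E,c)$ and $c$ is algebraic over $\mathbb{Q}(\bar a,D,E,c')$. -/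

import Mathlib

namespace PAdicCells

open FirstOrder

variable {K Γ : Type*} [Field K] [AddCommGroup Γ] [LinearOrder Γ] [IsOrderedAddMonoid Γ]

/-! ### `p`-adically closed valued fields

A valued field is a field `K` with `v : AddValuation K (WithTop Γ)`, `Γ` an ordered abelian group
written additively; surjectivity of `v` is part of the definitions below. -/

/-- The valuation ring `{x | 0 ≤ v x}`. -/
def valuationRing (v : AddValuation K (WithTop Γ)) : ValuationSubring K where
  carrier := {x | 0 ≤ v x}
  mul_mem' {x y} hx hy := by
    simp only [Set.mem_ofPred_eq, AddValuation.map_mul] at *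
    exact add_nonneg hx hy
  one_mem' := by simp
  add_mem' {x y} hx hy := le_trans (le_min hx hy) (v.map_add x y)
  zero_mem' := by simp
  neg_mem' {x} hx := by simpa using hx
  mem_or_inv_mem' x := by
    by_cases hx : x = 0
    · left; simp [hx]
    · by_contra! h
      have h1 : v x < 0 := by simpa using h.1
      have h2 : v x⁻¹ < 0 := by simpa using h.2
      have h3 : v x + v x⁻¹ = 0 := by
        rw [← v.map_mul, mul_inv_cancel₀ hx, v.map_one]
      have h4 : v x + v x⁻¹ < 0 :=
        lt_of_le_of_lt (by simpa using add_le_add_left h1.le (v x⁻¹)) h2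
      exact absurd h3 h4.ne

/-- `(K, v)` is formally `p`-adic. -/
structure IsFormallyPAdic (p : ℕ) [Fact p.Prime] [CharZero K]
    (v : AddValuation K (WithTop Γ)) : Prop where
  surjective : Function.Surjective v
  /-- `v` restricts to the `p`-adic valuation on `ℚ`, whose value group `ℤ` is embedded in `Γ` by
  sending `1` to some `u > 0` (necessarily `u = v p`). -/
  extends_padic : ∃ u : Γ, 0 < u ∧
    ∀ q : ℚ, q ≠ 0 → v (q : K) = ((padicValRat p q • u : Γ) : WithTop Γ)
  residueField : Nonempty (IsLocalRing.ResidueField (valuationRing v) ≃+* ZMod p)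
  least_pos : ∀ γ : Γ, 0 < γ → v (p : K) ≤ (γ : WithTop Γ)

/-- `(K, v)` is `p`-adically closed: formally `p`-adic, Henselian, and the value group, with `v p` as
its least positive element, is a model of Presburger arithmetic. -/
structure IsPAdicallyClosed (p : ℕ) [Fact p.Prime] [CharZero K]
    (v : AddValuation K (WithTop Γ)) : Prop extends IsFormallyPAdic p v where
  henselian : HenselianLocalRing (valuationRing v)
  presburger : ∀ u : Γ, v (p : K) = (u : WithTop Γ) →
    ∀ (n : ℕ), 1 ≤ n → ∀ x : Γ, ∃ y : Γ, ∃ r : ℕ, r < n ∧ x = n • y + r • u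

/-! ### Definability in the language of rings with the divisibility predicate -/

/-- The only relation symbol: binary divisibility. -/
inductive DivRel : ℕ → Type
  | div : DivRel 2

/-- The language of rings together with a binary relation symbol `x ∣ y`. -/
def Ldiv : Language := ⟨ringFunc, DivRel⟩

/-- `K` as a structure for `Ldiv`: the ring operations, and `x ∣ y` means `v x ≤ v y`. -/
@[reducible] def valuedFieldStructure (v : AddValuation K (WithTop Γ)) : Ldiv.Structure K where
  funMap := fun {_} f => match f with
    | ringFunc.add => fun x => x 0 + x 1
    | ringFunc.mul => fun x => x 0 * x 1
    | ringFunc.neg => fun x => - x 0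
    | ringFunc.zero => fun _ => 0
    | ringFunc.one => fun _ => 1
  RelMap := fun {_} r => match r with
    | DivRel.div => fun x => v (x 0) ≤ v (x 1)

/-- The graph, in `K ^ (n + 1)`, of the restriction of `f` to `B ⊆ K ^ n`. -/
def graphOn {n : ℕ} (B : Set (Fin n → K)) (f : (Fin n → K) → K) : Set (Fin (n + 1) → K) :=
  {z | Fin.init z ∈ B ∧ z (Fin.last n) = f (Fin.init z)}

/-- The function `f : B → K` is definable in `(K, v)` with parameters from `A`. -/
def DefinableOn (v : AddValuation K (WithTop Γ)) (A : Set K) {n : ℕ} (B : Set (Fin n → K))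
    (f : (Fin n → K) → K) : Prop :=
  letI := valuedFieldStructure v
  A.Definable Ldiv (graphOn B f)

/-- The function `f : B → K` is continuous for the valuation topology. -/
def ContOn (v : AddValuation K (WithTop Γ)) {n : ℕ} (B : Set (Fin n → K))
    (f : (Fin n → K) → K) : Prop :=
  ∀ x ∈ B, ∀ ε : Γ, ∃ δ : Γ, ∀ y ∈ B,
    (∀ i, (δ : WithTop Γ) < v (y i - x i)) → (ε : WithTop Γ) < v (f y - f x)

/-! ### Cells -/

/-- The conditions allowed for the boxes in a cell: `<`, `≤`, or no condition. -/
inductive Box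
  | lt
  | le
  | none

/-- The condition expressed by a box. -/
def Box.Holds {α : Type*} [LT α] [LE α] : Box → α → α → Prop
  | .lt, a, b => a < b
  | .le, a, b => a ≤ b
  | .none, _, _ => True

/-- `P_k^*`: the nonzero `k`-th powers. -/
def IsNonzeroPow (k : ℕ) (x : K) : Prop :=
  x ≠ 0 ∧ ∃ z : K, x = z ^ k

/-- The set of `(x, y) ∈ B × K` with `v (f x) □₁ v (y - g x) □₂ v (h x)` and
`P_k^* (lam * (y - g x))`. -/
def cellOver (v : AddValuation K (WithTop Γ)) {n : ℕ} (B : Set (Fin n → K))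
    (f g h : (Fin n → K) → K) (lam : K) (k : ℕ) (box₁ box₂ : Box) : Set (Fin (n + 1) → K) :=
  {z | Fin.init z ∈ B ∧
    box₁.Holds (v (f (Fin.init z))) (v (z (Fin.last n) - g (Fin.init z))) ∧
    box₂.Holds (v (z (Fin.last n) - g (Fin.init z))) (v (h (Fin.init z))) ∧
    IsNonzeroPow k (lam * (z (Fin.last n) - g (Fin.init z)))}

/-- The cells in `K ^ n`, defined recursively. In `one`, the bounds range over `Γ ∪ {-∞, ∞}`.
Definable means definable with arbitrary parameters from `K`. -/
inductive IsCell (v : AddValuation K (WithTop Γ)) : {n : ℕ} → Set (Fin n → K) → Prop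
  | point {n : ℕ} (a : Fin n → K) : IsCell v {a}
  | one (γ₁ γ₂ : WithBot (WithTop Γ)) (c : K) (k : ℕ) (lam : K) (hlam : lam ≠ 0)
      (box₁ box₂ : Box) :
      IsCell v {x : Fin 1 → K |
        box₁.Holds γ₁ ((v (x 0 - c) : WithTop Γ) : WithBot (WithTop Γ)) ∧
        box₂.Holds ((v (x 0 - c) : WithTop Γ) : WithBot (WithTop Γ)) γ₂ ∧
        IsNonzeroPow k (lam * (x 0 - c))}
  | graph {n : ℕ} (B : Set (Fin n → K)) (hB : IsCell v B) (f : (Fin n → K) → K)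
      (hf : DefinableOn v Set.univ B f) (hfc : ContOn v B f) :
      IsCell v (graphOn B f)
  | over {n : ℕ} (B : Set (Fin n → K)) (hB : IsCell v B) (f g h : (Fin n → K) → K)
      (hf : DefinableOn v Set.univ B f) (hfc : ContOn v B f)
      (hg : DefinableOn v Set.univ B g) (hgc : ContOn v B g)
      (hh : DefinableOn v Set.univ B h) (hhc : ContOn v B h)
      (lam : K) (hlam : lam ≠ 0) (k : ℕ) (box₁ box₂ : Box) :
      IsCell v (cellOver v B f g h lam k box₁ box₂)

/-! ### Algebraic independence -/

/-- `x` is algebraic over the field generated by `S`. -/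
def AlgebraicOver [CharZero K] (S : Set K) (x : K) : Prop :=
  IsAlgebraic (IntermediateField.adjoin ℚ S) x

/-- `x` is algebraically independent from `S`. -/
def IndependentFrom [CharZero K] (S : Set K) (x : K) : Prop :=
  Transcendental (IntermediateField.adjoin ℚ S) x

/-- `x` and `y` are interalgebraic over `S`. -/
def Interalgebraic [CharZero K] (S : Set K) (x y : K) : Prop :=
  AlgebraicOver (S ∪ {x}) y ∧ AlgebraicOver (S ∪ {y}) x

end PAdicCells

set_option linter.unusedSectionVars false

/-! ### Axioms of `p`-adically closed fields and their first consequences -/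

namespace PAdicCells

/-! Put `e = b - g a`. It is enough to find `t ≠ 0`, algebraic over `a`, `D` and `E`, in the class
of `e` modulo `k`-th powers and subject to the same two bounds. One of `c`, `c⁻¹` is integral;
calling it `c₁`, the element `1 + p * c₁` is a unit, so `c' = g a + t * (1 + p * c₁) ^ k` stays in
the fibre of the cell, and it is visibly interalgebraic with `c` provided `k > 0`. Transcendence of
`b` excludes `k = 0`. To find `t`, start at the bound `f a` (or `h a`) and multiply by a rational
number: Presburger arithmetic and Hensel's lemma give every class modulo `k`-th powers a natural
number as representative (`exists_algebraic_mem_cell`).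

This needs `f a`, `g a`, `h a` to be algebraic over `a` and the parameters
(`algebraicOver_of_definableOn`). The relative algebraic closure of the field generated by these is
again `p`-adically closed, hence an elementary substructure by model completeness
(`IsPClosed.holds_map_iff`), hence closed under definable functions.

For model completeness of `F ⊆ K` it suffices, by induction on formulas and Łoś's theorem, that each
`b ∈ K` outside `F` lies in a `p`-adically closed subfield `L` of `K` that embeds over `F` into an
ultrapower of `F` (`embedsInUltrapower_of_notMem_range`). Either all values of `b - d`, `d ∈ F`,
come from `F`, and `b` is approximated by elements of `F`; or some `b - d` has a new value, and
elements of `F` in the same cut imitate it. Both yield a value-comparing map from a ring into the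
ultrapower. It extends to `L` because `L` is an immediate algebraic extension of the field generated
by that ring (`IsPClosed.nonempty_algHom_of_immediate`), a form of the universal property of the
henselization, proved by Galois theory.

Values `O.valuation` are multiplicative: small means close to `0`, and the order is opposite to that
of the additive `v`. -/

/-- The axioms of `p`-adically closed fields, phrased for the valuation ring `O` in a form which is
inherited by relatively algebraically closed subfields and by ultrapowers. -/
structure IsPClosed (p : ℕ) {K : Type*} [Field K] (O : ValuationSubring K) : Prop where
  val_p : O.valuation (p : K) < 1
  residue : ∀ x ∈ O, ∃ j < p, ∃ y ∈ O, x = (j : K) + p * y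
  hensel : ∀ (n : ℕ) (a : Fin n → K), (∀ i, a i ∈ O) → ∃ x y : K, y ∈ O ∧ x = 1 + p * y ∧
    x ^ (n + 1) - x ^ n + ∑ i, p * a i * x ^ (i : ℕ) = 0
  exists_pow : ∀ n : ℕ, 0 < n → ∃ Q : ℕ, ∀ x : K, x ≠ 0 →
    ∃ q : ℕ, 0 < q ∧ q ≤ Q ∧ ∃ y : K, x = q * y ^ n

section Basic

variable {p : ℕ} [hp : Fact p.Prime] {K : Type*} [Field K] [CharZero K] {O : ValuationSubring K}

theorem val_natCast_le_one (O : ValuationSubring K) (n : ℕ) : O.valuation (n : K) ≤ 1 :=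
  (O.valuation_le_one_iff _).2 (natCast_mem O n)

theorem val_natCast_eq_one_of_coprime (hv : O.valuation (p : K) < 1) {n : ℕ} (hn : n.Coprime p) :
    O.valuation (n : K) = 1 := by
  refine le_antisymm (val_natCast_le_one O n) (not_lt.1 fun h => ?_)
  have h1 : ((n.gcd p : ℕ) : ℤ) = n * n.gcdA p + p * n.gcdB p := Nat.gcd_eq_gcd_ab n p
  rw [hn] at h1
  have h2 : (1 : K) = n * (n.gcdA p : ℤ) + p * (n.gcdB p : ℤ) := by exact_mod_cast h1
  have hz : ∀ z : ℤ, O.valuation (z : K) ≤ 1 := fun z =>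
    (O.valuation_le_one_iff _).2 (intCast_mem O z)
  have h3 : O.valuation (1 : K) < 1 := by
    rw [h2]
    refine lt_of_le_of_lt (O.valuation.map_add _ _) (max_lt ?_ ?_)
    · rw [map_mul]; exact mul_lt_one_of_lt_of_le h (hz _)
    · rw [map_mul]; exact mul_lt_one_of_lt_of_le hv (hz _)
  simp at h3

theorem val_natCast_eq_pow (hv : O.valuation (p : K) < 1) {n : ℕ} (hn : n ≠ 0) :
    ∃ s : ℕ, O.valuation (n : K) = O.valuation (p : K) ^ s := by
  obtain ⟨s, m, hm, rfl⟩ := Nat.exists_eq_pow_mul_and_not_dvd hn p hp.out.ne_one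
  refine ⟨s, ?_⟩
  have : m.Coprime p := ((Nat.Prime.coprime_iff_not_dvd hp.out).2 hm).symm
  rw [Nat.cast_mul, map_mul, val_natCast_eq_one_of_coprime hv this, mul_one, Nat.cast_pow, map_pow]

theorem natCast_p_ne_zero (p : ℕ) [hp : Fact p.Prime] (K : Type*) [Field K] [CharZero K] :
    (p : K) ≠ 0 :=
  Nat.cast_ne_zero.2 hp.out.ne_zero

/-- Iterating the residue axiom produces the first `N` digits of the `p`-adic expansion. -/
theorem exists_nat_approx_of_residue
    (hres : ∀ x ∈ O, ∃ j < p, ∃ y ∈ O, x = (j : K) + p * y) (N : ℕ) :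
    ∀ x ∈ O, ∃ j < p ^ N, ∃ y ∈ O, x = (j : K) + p ^ N * y := by
  induction N with
  | zero => exact fun x hx => ⟨0, by simp, x, hx, by simp⟩
  | succ N ih =>
    intro x hx
    obtain ⟨j, hj, y, hy, rfl⟩ := ih x hx
    obtain ⟨i, hi, z, hz, rfl⟩ := hres y hy
    refine ⟨j + p ^ N * i, ?_, z, hz, by push_cast; ring⟩
    calc j + p ^ N * i < p ^ N * (i + 1) := by rw [mul_add, mul_one]; omega
      _ ≤ p ^ (N + 1) := by rw [pow_succ]; exact Nat.mul_le_mul_left _ hi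

/-- Henselianity in normal form provides roots of elements close to `1`. -/
theorem exists_root_of_hensel (hv : O.valuation (p : K) < 1)
    (hens : ∀ (n : ℕ) (a : Fin n → K), (∀ i, a i ∈ O) → ∃ x y : K, y ∈ O ∧ x = 1 + p * y ∧
      x ^ (n + 1) - x ^ n + ∑ i, p * a i * x ^ (i : ℕ) = 0)
    {k' : ℕ} (s : ℕ) (hk : k'.Coprime p) {y : K} (hy : y ∈ O) :
    ∃ z : K, 1 + p ^ (2 * s + 1) * y = z ^ (p ^ s * k') := by
  have hp0 := natCast_p_ne_zero p K
  have hk'v := val_natCast_eq_one_of_coprime (O := O) hv hk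
  have hk'0 : (k' : K) ≠ 0 := by
    intro h; rw [h] at hk'v; simp at hk'v
  have hinv : (k' : K)⁻¹ ∈ O := by
    rw [← O.valuation_le_one_iff, map_inv₀, hk'v, inv_one]
  have hpos : 0 < p ^ s * k' := by
    refine Nat.pos_of_ne_zero fun h => ?_
    rcases mul_eq_zero.1 h with h | h
    · exact pow_ne_zero _ hp.out.ne_zero h
    · exact hk'0 (by simp [h])
  obtain ⟨n, hn⟩ : ∃ n, p ^ s * k' = n + 1 := ⟨p ^ s * k' - 1, by omega⟩
  have hnK : (p : K) ^ s * k' = ((n + 1 : ℕ) : K) := by rw [← hn]; push_cast; ring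
  set y₁ : K := y * (k' : K)⁻¹ with hy₁
  have hy₁O : y₁ ∈ O := O.mul_mem _ _ hy hinv
  -- Let `N = p ^ s * k' = n + 1`. Substituting `z = 1 + w / x` in `z ^ N = 1 + N * w` and dividing
  -- by `N * w` leads to the normal form. The exponent `s + 1` leaves a factor `p` in every lower
  -- coefficient after the division by `p ^ s`.
  set w : K := p ^ (s + 1) * y₁ with hw
  have hnw : ((n + 1 : ℕ) : K) * w = p ^ (2 * s + 1) * y := by
    rw [← hnK, hw, hy₁]; field_simp; ring
  obtain ⟨x, t, ht, hx, hroot⟩ := hens n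
    (fun i => -((n + 1).choose i * (p : K) ^ ((s + 1) * (n - 1 - i)) * y₁ ^ (n - i) * (k' : K)⁻¹))
    (fun i => O.neg_mem _ (O.mul_mem _ _ (O.mul_mem _ _ (O.mul_mem _ _ (natCast_mem O _)
      (pow_mem (natCast_mem O _) _)) (pow_mem hy₁O _)) hinv))
  have hx0 : x ≠ 0 := by
    intro h
    have h1 : (p : K) * t = -1 := by rw [h] at hx; linear_combination -hx
    have h2 : O.valuation ((p : K) * t) < 1 := by
      rw [map_mul]; exact mul_lt_one_of_lt_of_le hv ((O.valuation_le_one_iff _).2 ht)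
    rw [h1, Valuation.map_neg, map_one] at h2
    exact lt_irrefl _ h2
  refine ⟨(x + w) / x, ?_⟩
  rw [hn, div_pow, eq_div_iff (pow_ne_zero _ hx0), add_pow, Finset.sum_range_succ,
    Finset.sum_range_succ]
  have key : ∑ m ∈ Finset.range n, x ^ m * w ^ (n + 1 - m) * ((n + 1).choose m : K) =
      - (((n + 1 : ℕ) : K) * w * ∑ i : Fin n, p * (-((n + 1).choose i *
        (p : K) ^ ((s + 1) * (n - 1 - i)) * y₁ ^ (n - i) * (k' : K)⁻¹)) * x ^ (i : ℕ)) := by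
    rw [Finset.mul_sum, ← Finset.sum_neg_distrib, ← Fin.sum_univ_eq_sum_range
      (fun m => x ^ m * w ^ (n + 1 - m) * ((n + 1).choose m : K))]
    refine Finset.sum_congr rfl fun i _ => ?_
    obtain ⟨e, he⟩ : ∃ e, n = i + e + 1 := ⟨n - i - 1, by omega⟩
    have e1 : n + 1 - (i : ℕ) = e + 2 := by omega
    have e2 : n - 1 - (i : ℕ) = e := by omega
    have e3 : n - (i : ℕ) = e + 1 := by omega
    rw [e1, e2, e3, ← hnK, hw]
    field_simp
    ring
  rw [key]
  have e1 : n + 1 - n = 1 := by omega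
  simp only [e1, Nat.sub_self, pow_zero, pow_one, Nat.choose_self, Nat.choose_succ_self_right]
  linear_combination (((n + 1 : ℕ) : K) * w) * hroot - x ^ (n + 1) * hnw

namespace IsPClosed

variable (h : IsPClosed p O)
include h

/-- The residue digit of a non-unit is `0`, since a natural number strictly between `0` and `p` is a
unit. So `p` has the largest value below `1`. -/
theorem val_le_p {x : K} (hx : O.valuation x < 1) : O.valuation x ≤ O.valuation (p : K) := by
  obtain ⟨j, hj, y, hy, rfl⟩ := h.residue x ((O.valuation_le_one_iff _).1 hx.le)
  have hy' := (O.valuation_le_one_iff _).2 hy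
  have hpy : O.valuation ((p : K) * y) ≤ O.valuation (p : K) := by
    rw [map_mul]; exact mul_le_of_le_one_right' hy'
  rcases Nat.eq_zero_or_pos j with rfl | hj0
  · simpa using hpy
  · exfalso
    have hc : j.Coprime p := ((Nat.Prime.coprime_iff_not_dvd hp.out).2
      (Nat.not_dvd_of_pos_of_lt hj0 hj)).symm
    have h1 := val_natCast_eq_one_of_coprime h.val_p hc
    have h2 : O.valuation ((j : K) + p * y) = O.valuation (j : K) :=
      Valuation.map_add_eq_of_lt_left _ (by rw [h1]; exact hpy.trans_lt h.val_p)
    rw [h2, h1] at hx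
    exact lt_irrefl _ hx

theorem val_p_pos : 0 < O.valuation (p : K) :=
  (Valuation.pos_iff _).2 (natCast_p_ne_zero p K)

theorem exists_nat_approx (N : ℕ) (x : K) (hx : x ∈ O) :
    ∃ j : ℕ, ∃ y ∈ O, x = (j : K) + p ^ N * y := by
  obtain ⟨j, -, h⟩ := exists_nat_approx_of_residue h.residue N x hx
  exact ⟨j, h⟩

theorem exists_root (k' s : ℕ) (hk : k'.Coprime p) {y : K} (hy : y ∈ O) :
    ∃ z : K, 1 + p ^ (2 * s + 1) * y = z ^ (p ^ s * k') :=
  exists_root_of_hensel h.val_p h.hensel s hk hy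

/-- Descent on `j`: unless `z` is a unit it can be divided by `p`. Thus the value group has no
torsion modulo the powers of the value of `p`. -/
theorem val_eq_pow_of_pow {n : ℕ} (hn : 0 < n) (j : ℕ) : ∀ z : K,
    O.valuation z ^ n = O.valuation (p : K) ^ j → ∃ i : ℕ, O.valuation z = O.valuation (p : K) ^ i := by
  have hp0 := natCast_p_ne_zero p K
  induction j using Nat.strong_induction_on with
  | _ j ih =>
    intro z hz
    have hz1 : O.valuation z ≤ 1 := by
      rw [← pow_le_one_iff hn.ne', hz]; exact pow_le_one' h.val_p.le _
    rcases hz1.lt_or_eq with hlt | heq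
    · have hle := h.val_le_p hlt
      have hjn : n ≤ j := by
        by_contra hcon
        have h1 : O.valuation (p : K) ^ j ≤ O.valuation (p : K) ^ n :=
          hz ▸ pow_le_pow_left' hle n
        exact absurd h1 (not_le.2 (pow_lt_pow_right_of_lt_one₀ h.val_p_pos h.val_p (by omega)))
      obtain ⟨i, hi⟩ := ih (j - n) (by omega) (z / p) (by
        rw [map_div₀, div_pow, hz, div_eq_iff (pow_ne_zero _ h.val_p_pos.ne'), ← pow_add]
        congr 1; omega)
      refine ⟨i + 1, ?_⟩
      rw [map_div₀, div_eq_iff h.val_p_pos.ne'] at hi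
      rw [hi, pow_succ]
    · exact ⟨0, by simpa using heq⟩

/-- An element of `K` whose `n`-th power has the value of an element of `F` has itself the value of
an element of `F`. -/
theorem exists_val_eq_of_pow {F : Type*} [Field F] [CharZero F] [Algebra F K]
    {OF : ValuationSubring F} (hF : IsPClosed p OF) {n : ℕ} (hn : 0 < n) {x : K} {a : F}
    (hx : O.valuation x ^ n = O.valuation (algebraMap F K a)) :
    ∃ b : F, O.valuation x = O.valuation (algebraMap F K b) := by
  rcases eq_or_ne a 0 with rfl | ha
  · exact ⟨0, by simpa [hn.ne'] using hx⟩
  obtain ⟨Q, hQ⟩ := hF.exists_pow n hn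
  obtain ⟨q, hq, -, y, rfl⟩ := hQ a ha
  have hy : y ≠ 0 := by rintro rfl; simp [hn.ne'] at ha
  have hy' : O.valuation (algebraMap F K y) ≠ 0 := by simpa using hy
  obtain ⟨s, hs⟩ := val_natCast_eq_pow h.val_p hq.ne'
  obtain ⟨i, hi⟩ := h.val_eq_pow_of_pow hn s (x / algebraMap F K y) (by
    rw [map_div₀, div_pow, hx, map_mul, map_mul, map_natCast, map_pow, map_pow, hs,
      mul_div_cancel_right₀ _ (pow_ne_zero _ hy')])
  refine ⟨p ^ i * y, ?_⟩
  rw [map_div₀, div_eq_iff hy'] at hi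
  rw [hi]; simp

/-- An existential definition of the valuation ring by the ring operations. The exponent `p + 1` is
prime to `p`, so Hensel's lemma applies when `x` is integral. Otherwise `p * x ^ (p + 1)` dominates
`1`, and its value is no `(p + 1)`-th power, the value of `p` being closest to `1`. -/
theorem mem_iff_exists_pow (x : K) : x ∈ O ↔ ∃ z : K, 1 + p * x ^ (p + 1) = z ^ (p + 1) := by
  have hp1 := hp.out.one_lt
  constructor
  · intro hx
    have := h.exists_root (p + 1) 0 (by simp) (pow_mem hx (p + 1))
    simpa using this
  · rintro ⟨z, hz⟩
    by_contra hx
    have hx1 : 1 < O.valuation x := not_le.1 fun h' => hx ((O.valuation_le_one_iff _).1 h')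
    have hx0 : x ≠ 0 := by rintro rfl; exact hx O.zero_mem
    have hinv : O.valuation (p : K)⁻¹ ≤ O.valuation x := by
      have h1 : O.valuation x⁻¹ < 1 := by rw [map_inv₀]; exact inv_lt_one_of_one_lt₀ hx1
      have h2 := h.val_le_p h1
      rw [map_inv₀] at h2 ⊢
      exact inv_le_of_inv_le₀ (by exact zero_lt_one.trans hx1) h2
    have hbig : 1 < O.valuation ((p : K) * x ^ (p + 1)) := by
      rw [map_mul, map_pow, pow_succ', ← mul_assoc]
      have h3 : 1 ≤ O.valuation (p : K) * O.valuation x := by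
        rw [map_inv₀] at hinv
        rwa [inv_le_iff_one_le_mul₀' h.val_p_pos] at hinv
      exact lt_mul_of_one_le_of_lt h3 (one_lt_pow' hx1 (by omega))
    have hval : O.valuation ((p : K) * x ^ (p + 1)) = O.valuation z ^ (p + 1) := by
      rw [← map_pow, ← hz]
      exact (Valuation.map_add_eq_of_lt_right _ (by rwa [map_one])).symm
    have hw : O.valuation (z / x) ^ (p + 1) = O.valuation (p : K) := by
      rw [map_div₀, div_pow, ← hval, map_mul, map_pow,
        mul_div_cancel_right₀ _ (pow_ne_zero _ (by simpa using hx0))]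
    have hw1 : O.valuation (z / x) < 1 := by
      refine not_le.1 fun h' => ?_
      have := one_le_pow_of_one_le' h' (p + 1)
      rw [hw] at this
      exact absurd this (not_le.2 h.val_p)
    have h4 := pow_le_pow_left' (h.val_le_p hw1) (p + 1)
    rw [hw] at h4
    have h5 := pow_lt_pow_right_of_lt_one₀ h.val_p_pos h.val_p (show 1 < p + 1 by omega)
    rw [pow_one] at h5
    exact absurd h4 (not_le.2 h5)

/-- Field homomorphisms between `p`-adically closed fields preserve the valuation ring. -/
theorem map_mem_iff {N : Type*} [Field N] [CharZero N] {ON : ValuationSubring N}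
    (hN : IsPClosed p ON) (φ : K →+* N) (x : K) : φ x ∈ ON ↔ x ∈ O := by
  have hmem : ∀ x ∈ O, φ x ∈ ON := fun x hx => by
    obtain ⟨z, hz⟩ := (h.mem_iff_exists_pow x).1 hx
    refine (hN.mem_iff_exists_pow _).2 ⟨φ z, ?_⟩
    rw [← map_pow φ z, ← hz]; simp
  refine ⟨fun hx => ?_, hmem x⟩
  by_contra hxO
  have hx1 : 1 < O.valuation x := not_le.1 fun h' => hxO ((O.valuation_le_one_iff _).1 h')
  have h1 : O.valuation x⁻¹ < 1 := by rw [map_inv₀]; exact inv_lt_one_of_one_lt₀ hx1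
  -- Divisibility of `x⁻¹` by `p` is preserved by `φ`, so `φ x⁻¹` is a non-unit and `φ x` cannot be
  -- integral.
  have h2 : x⁻¹ / p ∈ O := by
    rw [← O.valuation_le_one_iff, map_div₀]; exact div_le_one_of_le₀ (h.val_le_p h1) zero_le
  have h3 := (ON.valuation_le_one_iff _).2 (hmem _ h2)
  have hx0 : φ x ≠ 0 := by
    rw [Ne, map_eq_zero]; rintro rfl; exact hxO O.zero_mem
  rw [map_div₀ φ, map_inv₀ φ, map_natCast, map_div₀,
    div_le_one₀ hN.val_p_pos, map_inv₀] at h3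
  have h4 := (ON.valuation_le_one_iff _).2 hx
  have h5 : ON.valuation (φ x) * (ON.valuation (φ x))⁻¹ < 1 :=
    mul_lt_one_of_nonneg_of_lt_one_right h4 zero_le (h3.trans_lt hN.val_p)
  rw [mul_inv_cancel₀ (by simpa using hx0)] at h5
  exact lt_irrefl _ h5

end IsPClosed

end Basic

end PAdicCells

/-! ### Valuations on algebraic extensions: extension, Galois invariance, averages -/

namespace PAdicCells

open Polynomial

section Extension

/-- An embedding of fields compatible with valuation rings compares values in the same way. -/
theorem val_map_le_iff {K N : Type*} [Field K] [Field N] {O : ValuationSubring K}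
    {ON : ValuationSubring N} {φ : K →+* N} (hφ : ∀ x, φ x ∈ ON ↔ x ∈ O) (x y : K) :
    ON.valuation (φ x) ≤ ON.valuation (φ y) ↔ O.valuation x ≤ O.valuation y := by
  rcases eq_or_ne y 0 with rfl | hy
  · simp
  · have h1 : 0 < ON.valuation (φ y) := (Valuation.pos_iff _).2 (by simpa using hy)
    have h2 : 0 < O.valuation y := (Valuation.pos_iff _).2 hy
    rw [← div_le_one₀ h1, ← div_le_one₀ h2, ← map_div₀, ← map_div₀, ← map_div₀,
      ON.valuation_le_one_iff, O.valuation_le_one_iff, hφ]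

theorem val_map_lt_iff {K N : Type*} [Field K] [Field N] {O : ValuationSubring K}
    {ON : ValuationSubring N} {φ : K →+* N} (hφ : ∀ x, φ x ∈ ON ↔ x ∈ O) (x y : K) :
    ON.valuation (φ x) < ON.valuation (φ y) ↔ O.valuation x < O.valuation y := by
  rw [← not_le, ← not_le, val_map_le_iff hφ]

theorem val_map_eq_iff {K N : Type*} [Field K] [Field N] {O : ValuationSubring K}
    {ON : ValuationSubring N} {φ : K →+* N} (hφ : ∀ x, φ x ∈ ON ↔ x ∈ O) (x y : K) :
    ON.valuation (φ x) = ON.valuation (φ y) ↔ O.valuation x = O.valuation y := by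
  rw [le_antisymm_iff, le_antisymm_iff, val_map_le_iff hφ, val_map_le_iff hφ]

/-- Every valuation ring extends along a field homomorphism. -/
theorem exists_valuationSubring_over {K Ω : Type*} [Field K] [Field Ω] (O : ValuationSubring K)
    (f : K →+* Ω) : ∃ W : ValuationSubring Ω, ∀ x, f x ∈ W ↔ x ∈ O := by
  obtain ⟨W, hW, hloc⟩ := IsLocalRing.exists_factor_valuationRing (f.comp O.subtype)
  refine ⟨W, fun x => ⟨fun hx => ?_, fun hx => hW ⟨x, hx⟩⟩⟩
  by_contra hxO
  have hx0 : x ≠ 0 := by rintro rfl; exact hxO O.zero_mem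
  have hinv : x⁻¹ ∈ O := (O.mem_or_inv_mem x).resolve_left hxO
  -- If `f x` lay in `W`, then `x⁻¹` would become a unit there; the map from `O` to `W` being local,
  -- it would already be a unit of `O`.
  have hu : IsUnit (((f.comp O.subtype).codRestrict W.toSubring hW) ⟨x⁻¹, hinv⟩) := by
    refine IsUnit.of_mul_eq_one (⟨f x, hx⟩ : W.toSubring) (Subtype.ext ?_)
    change f x⁻¹ * f x = 1
    rw [← map_mul, inv_mul_cancel₀ hx0, map_one]
  have := hloc.map_nonunit _ hu
  obtain ⟨u, hu'⟩ := this.exists_right_inv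
  have h1 : x⁻¹ * (u : K) = 1 := congrArg Subtype.val hu'
  have h2 : (u : K) = x := by field_simp at h1; exact h1
  exact hxO (h2 ▸ u.2)

/-- Below the leading term the coefficients are elementary symmetric functions of the roots. The
bound makes the minimal polynomial of a dominating element reduce to `X ^ d * (X - 1)` after
rescaling. -/
theorem coeff_prod_X_sub_C_val_lt {Ω Γ₀ : Type*} [Field Ω] [LinearOrderedCommGroupWithZero Γ₀]
    (v : Valuation Ω Γ₀) {ρ : Γ₀} (hρ : 0 < ρ) (m : Multiset Ω) (hm : ∀ r ∈ m, v r < ρ) :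
    ∀ i < m.card, v ((m.map fun r => X - C r).prod.coeff i) < ρ ^ (m.card - i) := by
  induction m using Multiset.induction_on with
  | empty => simp
  | cons r m ih =>
    have ih' := ih fun x hx => hm x (Multiset.mem_cons_of_mem hx)
    have hr := hm r (Multiset.mem_cons_self r m)
    set Q := (m.map fun r => X - C r).prod with hQ
    have hmonic : Q.Monic := monic_multiset_prod_of_monic _ _ fun a _ => monic_X_sub_C a
    have hdeg : Q.natDegree = m.card := by
      rw [hQ, natDegree_multiset_prod_X_sub_C_eq_card]
    have hle : ∀ i, i ≤ m.card → v (Q.coeff i) ≤ ρ ^ (m.card - i) := by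
      intro i hi
      rcases hi.lt_or_eq with h | rfl
      · exact (ih' i h).le
      · rw [← hdeg, hmonic.coeff_natDegree]; simp
    intro i hi
    rw [Multiset.card_cons] at hi ⊢
    rw [Multiset.map_cons, Multiset.prod_cons, ← hQ, sub_mul, coeff_sub, coeff_C_mul]
    have h2 : v (r * Q.coeff i) < ρ ^ (m.card + 1 - i) := by
      rw [map_mul, show m.card + 1 - i = (m.card - i) + 1 by omega, pow_succ']
      have h3 := hle i (by omega)
      exact (mul_le_mul_right h3 (v r)).trans_lt (mul_lt_mul_of_pos_right hr (pow_pos hρ _))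
    refine lt_of_le_of_lt (v.map_sub _ _) (max_lt ?_ h2)
    cases i with
    | zero => simp; exact pow_pos hρ _
    | succ i =>
      rw [coeff_X_mul, show m.card + 1 - (i + 1) = m.card - i by omega]
      exact ih' i (by omega)

end Extension

section Invariance

variable {p : ℕ} [hp : Fact p.Prime] {K : Type*} [Field K] [CharZero K] {O : ValuationSubring K}
  {Ω : Type*} [Field Ω] [Algebra K Ω] [IsGalois K Ω] {W : ValuationSubring Ω}

/-- Over a Henselian field, an element strictly dominating its other conjugates is rational. -/
theorem IsPClosed.mem_range_of_dominates (h : IsPClosed p O)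
    (hW : ∀ x : K, algebraMap K Ω x ∈ W ↔ x ∈ O) {γ : Ω} (hsplit : ((minpoly K γ).map
      (algebraMap K Ω)).Splits) (hγ : ∀ g : Ω ≃ₐ[K] Ω, g γ ≠ γ → W.valuation (g γ) < W.valuation γ) :
    γ ∈ Set.range (algebraMap K Ω) := by
  classical
  rcases eq_or_ne γ 0 with rfl | hγ0
  · exact ⟨0, by simp⟩
  have hint : IsIntegral K γ := Algebra.IsIntegral.isIntegral γ
  have hvγ : 0 < W.valuation γ := (Valuation.pos_iff _).2 hγ0
  set P := minpoly K γ with hP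
  have hPm : P.Monic := minpoly.monic hint
  set PΩ := P.map (algebraMap K Ω) with hPΩ
  have hPΩm : PΩ.Monic := hPm.map _
  have hroot : γ ∈ PΩ.roots := by
    rw [mem_roots hPΩm.ne_zero, IsRoot, hPΩ, eval_map_algebraMap, minpoly.aeval]
  have hsep : PΩ.Separable := Polynomial.Separable.map (IsGalois.separable K γ)
  have hnodup : PΩ.roots.Nodup := nodup_roots hsep
  obtain ⟨m, hm⟩ := Multiset.exists_cons_of_mem hroot
  have hγm : γ ∉ m := by rw [hm] at hnodup; exact (Multiset.nodup_cons.1 hnodup).1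
  have hconj : ∀ r ∈ PΩ.roots, ∃ g : Ω ≃ₐ[K] Ω, g γ = r := fun r hr => by
    refine minpoly.exists_algEquiv_of_root' hint.isAlgebraic ?_
    rw [mem_roots hPΩm.ne_zero, IsRoot, hPΩ, eval_map_algebraMap] at hr
    exact hr
  have hlt : ∀ r ∈ m, W.valuation r < W.valuation γ := fun r hr => by
    obtain ⟨g, rfl⟩ := hconj r (hm ▸ Multiset.mem_cons_of_mem hr)
    exact hγ g fun h' => hγm (h' ▸ hr)
  set Q := (m.map fun r => X - C r).prod with hQ
  have hfac : PΩ = (X - C γ) * Q := by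
    have := hsplit.eq_prod_roots_of_monic hPΩm
    rw [this, hm, Multiset.map_cons, Multiset.prod_cons]
  have hQm : Q.Monic := monic_multiset_prod_of_monic _ _ fun a _ => monic_X_sub_C a
  set d := m.card with hd
  have hQd : Q.natDegree = d := by rw [hQ, natDegree_multiset_prod_X_sub_C_eq_card]
  have hbound := coeff_prod_X_sub_C_val_lt W.valuation hvγ m hlt
  have hPd : P.natDegree = d + 1 := by
    rw [← natDegree_map (algebraMap K Ω), ← hPΩ, hfac, (monic_X_sub_C γ).natDegree_mul hQm,
      natDegree_X_sub_C, hQd, add_comm]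
  have hcoeff : ∀ i, algebraMap K Ω (P.coeff i) = (X * Q).coeff i - γ * Q.coeff i := fun i => by
    rw [← coeff_map, ← hPΩ, hfac, sub_mul, coeff_sub, coeff_C_mul]
  -- The sum of all conjugates: `γ` strictly dominates the others, so this rational element has the
  -- value of `γ` and can serve to rescale the variable.
  set c := -P.coeff d with hc
  have hcv : W.valuation (algebraMap K Ω c) = W.valuation γ := by
    have h1 : Q.coeff d = 1 := by rw [← hQd]; exact hQm.coeff_natDegree
    rw [hc, map_neg, Valuation.map_neg, hcoeff, h1, mul_one]
    refine Valuation.map_sub_eq_of_lt_right _ ?_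
    rcases Nat.eq_zero_or_pos d with h0 | h0
    · rw [h0]; simpa using hvγ
    · obtain ⟨e, he⟩ : ∃ e, d = e + 1 := ⟨d - 1, by omega⟩
      rw [he, coeff_X_mul]
      have := hbound e (by omega)
      rwa [← hd, he, show e + 1 - e = 1 by omega, pow_one] at this
  have hc0 : c ≠ 0 := by
    intro h0; rw [h0, map_zero, map_zero] at hcv; exact hvγ.ne hcv
  have hcoefflt : ∀ i < d, W.valuation (algebraMap K Ω (P.coeff i)) < W.valuation γ ^ (d + 1 - i) := by
    intro i hi
    rw [hcoeff]
    refine lt_of_le_of_lt (Valuation.map_sub _ _ _) (max_lt ?_ ?_)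
    · cases i with
      | zero => simp; exact pow_pos hvγ _
      | succ i =>
        rw [coeff_X_mul, show d + 1 - (i + 1) = d - i by omega]
        exact hbound i (by omega)
    · rw [map_mul, show d + 1 - i = (d - i) + 1 by omega, pow_succ']
      exact mul_lt_mul_of_pos_left (hbound i hi) hvγ
  have hp0 := natCast_p_ne_zero p K
  -- The rescaled lower coefficients have value below `1`, hence are divisible by `p`, as the normal
  -- form requires.
  obtain ⟨x, -, -, -, hx⟩ := h.hensel d (fun i => P.coeff i / c ^ (d + 1 - (i : ℕ)) / p)
    (fun i => by
      have h1 : W.valuation (algebraMap K Ω (P.coeff i / c ^ (d + 1 - (i : ℕ)))) <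
          W.valuation (algebraMap K Ω 1) := by
        rw [map_one, map_one, map_div₀, map_div₀, map_pow, map_pow, hcv, div_lt_one₀ (pow_pos hvγ _)]
        exact hcoefflt i i.2
      rw [val_map_lt_iff hW, map_one] at h1
      rw [← O.valuation_le_one_iff, map_div₀]
      exact div_le_one_of_le₀ (h.val_le_p h1) zero_le)
  have hev : P.eval (c * x) = 0 := by
    rw [eval_eq_sum_range, hPd, Finset.sum_range_succ, Finset.sum_range_succ,
      show P.coeff (d + 1) = 1 by rw [← hPd]; exact hPm.coeff_natDegree,
      show P.coeff d = -c by rw [hc, neg_neg], ← Fin.sum_univ_eq_sum_range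
        (fun i => P.coeff i * (c * x) ^ i)]
    have h2 : ∑ i : Fin d, P.coeff i * (c * x) ^ (i : ℕ) = c ^ (d + 1) * ∑ i : Fin d,
        p * (P.coeff i / c ^ (d + 1 - (i : ℕ)) / p) * x ^ (i : ℕ) := by
      rw [Finset.mul_sum]
      refine Finset.sum_congr rfl fun i _ => ?_
      have h3 : c ^ (d + 1) = c ^ (d + 1 - (i : ℕ)) * c ^ (i : ℕ) := by
        rw [← pow_add]; congr 1; omega
      rw [h3, mul_pow]
      field_simp
    rw [h2]
    linear_combination c ^ (d + 1) * hx
  -- The root found is some conjugate `g γ`. Being rational it is fixed by `g`, so it equals `γ`;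
  -- there is no need to know which root Hensel's lemma produced.
  obtain ⟨g, hg⟩ := hconj (algebraMap K Ω (c * x)) (by
    rw [mem_roots hPΩm.ne_zero, IsRoot, hPΩ, eval_map_algebraMap, aeval_algebraMap_apply,
      coe_aeval_eq_eval, hev, map_zero])
  refine ⟨c * x, ?_⟩
  apply g.injective
  rw [hg, AlgEquiv.commutes]

/-- Over a Henselian field the valuation of an algebraic extension is Galois invariant. -/
theorem IsPClosed.val_algEquiv [IsAlgClosed Ω] (h : IsPClosed p O)
    (hW : ∀ x : K, algebraMap K Ω x ∈ W ↔ x ∈ O) (τ : Ω ≃ₐ[K] Ω) (x : Ω) :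
    W.valuation (τ x) = W.valuation x := by
  classical
  suffices H : ∀ (τ : Ω ≃ₐ[K] Ω) (x : Ω), W.valuation (τ x) ≤ W.valuation x by
    refine le_antisymm (H τ x) ?_
    simpa using H τ.symm (τ x)
  intro τ x
  by_contra hcon
  rw [not_le] at hcon
  have hint : IsIntegral K x := Algebra.IsIntegral.isIntegral x
  have hPne : minpoly K x ≠ 0 := minpoly.ne_zero hint
  set s : Finset Ω := ((minpoly K x).aroots Ω).toFinset with hs
  have hmem : ∀ y, y ∈ s ↔ ∃ g : Ω ≃ₐ[K] Ω, g x = y := fun y => by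
    rw [hs, Multiset.mem_toFinset, mem_aroots]
    constructor
    · rintro ⟨-, hy⟩
      exact minpoly.exists_algEquiv_of_root' hint.isAlgebraic hy
    · rintro ⟨g, rfl⟩
      refine ⟨hPne, ?_⟩
      rw [← AlgEquiv.coe_toAlgHom, aeval_algHom_apply, minpoly.aeval, map_zero]
  have hxs : x ∈ s := (hmem x).2 ⟨1, rfl⟩
  obtain ⟨y₀, hy₀, hmax⟩ := s.exists_max_image W.valuation ⟨x, hxs⟩
  set ρ := W.valuation y₀ with hρ
  have hτs : W.valuation (τ x) ≤ ρ := hmax _ ((hmem _).2 ⟨τ, rfl⟩)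
  have hρ0 : 0 < ρ := lt_of_le_of_lt zero_le (hcon.trans_le hτs)
  -- The product of the conjugates of maximal value. An automorphism either permutes `S`, and fixes
  -- the product, or moves a factor out of `S` and strictly lowers the value. So the product
  -- dominates its other conjugates and is rational.
  set S := s.filter fun y => W.valuation y = ρ with hS
  set γ := ∏ y ∈ S, y with hγ
  have hstable : ∀ (g : Ω ≃ₐ[K] Ω), ∀ y ∈ s, g y ∈ s := by
    intro g y hy
    obtain ⟨g', rfl⟩ := (hmem y).1 hy
    exact (hmem _).2 ⟨g * g', rfl⟩
  have hγv : W.valuation γ = ρ ^ S.card := by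
    rw [hγ, map_prod, Finset.prod_congr rfl fun y hy => (Finset.mem_filter.1 hy).2,
      Finset.prod_const]
  have hdom : ∀ g : Ω ≃ₐ[K] Ω, ¬ W.valuation (g γ) < W.valuation γ → ∀ y ∈ S, g y ∈ S := by
    intro g hg y hy
    by_contra hgy
    apply hg
    rw [hγv, hγ, map_prod, map_prod, ← Finset.prod_const]
    have hle : ∀ z ∈ S, W.valuation (g z) ≤ ρ := fun z hz =>
      hmax _ (hstable g z (Finset.mem_filter.1 hz).1)
    have hlt : W.valuation (g y) < ρ := lt_of_le_of_ne (hle y hy) fun h' =>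
      hgy (Finset.mem_filter.2 ⟨hstable g y (Finset.mem_filter.1 hy).1, h'⟩)
    rw [← Finset.mul_prod_erase S _ hy, ← Finset.mul_prod_erase S (fun _ => ρ) hy,
      Finset.prod_const]
    refine lt_of_le_of_lt (mul_le_mul_right (Finset.prod_le_pow_card _ _ _ fun z hz =>
      hle z (Finset.mem_of_mem_erase hz)) _) ?_
    exact mul_lt_mul_of_pos_right hlt (pow_pos hρ0 _)
  have hrat : γ ∈ Set.range (algebraMap K Ω) := by
    refine h.mem_range_of_dominates hW (IsAlgClosed.splits _) fun g hg => ?_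
    by_contra hnlt
    have hmaps := hdom g hnlt
    apply hg
    rw [hγ, map_prod]
    refine Finset.prod_bij (fun y _ => g y) hmaps (fun _ _ _ _ e => g.injective e) ?_ fun _ _ => rfl
    exact fun b hb => by
      obtain ⟨a, ha, e⟩ := Finset.surj_on_of_inj_on_of_card_le (fun y _ => g y) hmaps
        (fun _ _ _ _ e => g.injective e) le_rfl b hb
      exact ⟨a, ha, e.symm⟩
  obtain ⟨c, hc⟩ := hrat
  -- As the product is fixed, `g⁻¹` preserves `S`; it sends `y₀` to `x`, so `x` too has maximal
  -- value.
  obtain ⟨g, hg⟩ := (hmem y₀).1 hy₀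
  have hgγ : g⁻¹ γ = γ := by rw [← hc, AlgEquiv.commutes]
  have hy₀S : y₀ ∈ S := Finset.mem_filter.2 ⟨hy₀, rfl⟩
  have hxS := hdom g⁻¹ (by rw [hgγ]; exact lt_irrefl _) y₀ hy₀S
  rw [← hg, ← AlgEquiv.mul_apply, inv_mul_cancel, AlgEquiv.one_apply] at hxS
  exact absurd (Finset.mem_filter.1 hxS).2 (hcon.trans_le hτs).ne

end Invariance

section Average

variable {M Ω : Type*} [Field M] [CharZero M] [Field Ω] [Algebra M Ω] {W : ValuationSubring Ω}

/-- The average of the orbit of an algebraic element under a group `H` of automorphisms preserving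
the valuation is an approximation by an `H`-fixed element which is optimal up to the value of a
natural number. -/
theorem exists_fixed_approx (H : Subgroup (Ω ≃ₐ[M] Ω))
    (hH : ∀ g ∈ H, ∀ x, W.valuation (g x) = W.valuation x) {α : Ω} (hα : IsAlgebraic M α) :
    ∃ (m : ℕ) (d : Ω), 0 < m ∧ IsAlgebraic M d ∧ (∀ g ∈ H, g d = d) ∧ ∀ e : Ω, (∀ g ∈ H, g e = e) →
      W.valuation (m : Ω) * W.valuation (e - d) ≤ W.valuation (e - α) := by
  classical
  have : CharZero Ω := charZero_of_injective_algebraMap (algebraMap M Ω).injective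
  have hfin : {y | ∃ g ∈ H, g α = y}.Finite := by
    refine Set.Finite.subset ((minpoly M α).rootSet_finite Ω) ?_
    rintro _ ⟨g, -, rfl⟩
    rw [mem_rootSet]
    refine ⟨minpoly.ne_zero hα.isIntegral, ?_⟩
    rw [← AlgEquiv.coe_toAlgHom, aeval_algHom_apply, minpoly.aeval, map_zero]
  set s := hfin.toFinset with hs
  have hmem : ∀ y, y ∈ s ↔ ∃ g ∈ H, g α = y := fun y => by rw [hs, Set.Finite.mem_toFinset]; rfl
  have hαs : α ∈ s := (hmem α).2 ⟨1, H.one_mem, rfl⟩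
  have hcard : 0 < s.card := Finset.card_pos.2 ⟨α, hαs⟩
  have hc0 : (s.card : Ω) ≠ 0 := Nat.cast_ne_zero.2 hcard.ne'
  refine ⟨s.card, (s.card : Ω)⁻¹ * ∑ y ∈ s, y, hcard, ?_, fun g hg => ?_, fun e he => ?_⟩
  · refine IsAlgebraic.mul ?_ (IsIntegral.sum _ fun y hy => ?_).isAlgebraic
    · have := isAlgebraic_algebraMap (R := M) (A := Ω) (s.card : M)⁻¹
      simpa using this
    · obtain ⟨g, -, rfl⟩ := (hmem y).1 hy
      exact (hα.algHom g.toAlgHom).isIntegral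
  · rw [map_mul, map_inv₀, map_natCast, map_sum]
    congr 1
    have hmaps : ∀ y ∈ s, g y ∈ s := fun y hy => by
      obtain ⟨g', hg', rfl⟩ := (hmem y).1 hy
      exact (hmem _).2 ⟨g * g', H.mul_mem hg hg', rfl⟩
    refine Finset.sum_bij (fun y _ => g y) hmaps (fun _ _ _ _ e => g.injective e) ?_ fun _ _ => rfl
    exact fun b hb => by
      obtain ⟨a, ha, e⟩ := Finset.surj_on_of_inj_on_of_card_le (fun y _ => g y) hmaps
        (fun _ _ _ _ e => g.injective e) le_rfl b hb
      exact ⟨a, ha, e.symm⟩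
  · rw [← map_mul]
    -- Each summand `e - y` is the image of `e - α` under an element of `H`, hence has the same
    -- value.
    have : (s.card : Ω) * (e - (s.card : Ω)⁻¹ * ∑ y ∈ s, y) = ∑ y ∈ s, (e - y) := by
      rw [Finset.sum_sub_distrib, Finset.sum_const, nsmul_eq_mul]
      field_simp
    rw [this]
    refine Valuation.map_sum_le _ fun y hy => ?_
    obtain ⟨g, hg, rfl⟩ := (hmem y).1 hy
    rw [← hH g hg (e - α), map_sub g, he g hg]

end Average

end PAdicCells

/-! ### Conjugacy of the extensions of a valuation ring to a Galois extension -/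

namespace PAdicCells

open Polynomial

section Conjugacy

variable {M Ω : Type*} [Field M] [Field Ω] [Algebra M Ω] {A : ValuationSubring M}

theorem mem_of_mem_integralClosure {V : ValuationSubring Ω}
    (hV : ∀ x : M, algebraMap M Ω x ∈ V ↔ x ∈ A) {b : Ω} (hb : b ∈ integralClosure A Ω) : b ∈ V := by
  obtain ⟨P, hP, hPb⟩ := (hb : IsIntegral A b)
  let ι : A →+* V := ((algebraMap M Ω).comp A.subtype).codRestrict V fun x => (hV x).2 x.2
  have h1 : IsIntegral V b := ⟨P.map ι, hP.map ι, by rw [eval₂_map]; exact hPb⟩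
  obtain ⟨y, rfl⟩ := IsIntegrallyClosed.isIntegral_iff.1 h1
  exact y.2

/-- A valuation ring of an algebraic extension is determined by the maximal ideal it induces on the
integral closure. -/
theorem le_of_maximalIdeal_integralClosure_le [Algebra.IsAlgebraic M Ω] {W V : ValuationSubring Ω}
    (hW : ∀ x : M, algebraMap M Ω x ∈ W ↔ x ∈ A) (hV : ∀ x : M, algebraMap M Ω x ∈ V ↔ x ∈ A)
    (h : ∀ b ∈ integralClosure A Ω, V.valuation b < 1 → W.valuation b < 1) : W ≤ V := by
  classical
  intro x hx
  rcases eq_or_ne x 0 with rfl | hx0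
  · exact V.zero_mem
  obtain ⟨P, hP0, hPx⟩ := Algebra.IsAlgebraic.isAlgebraic (R := M) x
  obtain ⟨j, hj, hjmax⟩ := P.support.exists_max_image (fun i => A.valuation (P.coeff i))
    (support_nonempty.2 hP0)
  -- The equation of `x` is divided by its last coefficient of maximal value. Then all coefficients
  -- are integral, the `k`-th is `1`, and the later ones are non-units.
  set T := P.support.filter fun i => A.valuation (P.coeff i) = A.valuation (P.coeff j) with hT
  obtain ⟨k, hkT, hkmax⟩ := T.exists_max_image id ⟨j, Finset.mem_filter.2 ⟨hj, rfl⟩⟩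
  have hkv : A.valuation (P.coeff k) = A.valuation (P.coeff j) := (Finset.mem_filter.1 hkT).2
  have hk0 : P.coeff k ≠ 0 := mem_support_iff.1 (Finset.mem_filter.1 hkT).1
  have hkpos : 0 < A.valuation (P.coeff k) := (Valuation.pos_iff _).2 hk0
  have hle : ∀ i, A.valuation (P.coeff i) ≤ A.valuation (P.coeff k) := fun i => by
    by_cases hi : i ∈ P.support
    · rw [hkv]; exact hjmax i hi
    · rw [notMem_support_iff.1 hi]; simp
  have hlt : ∀ i, k < i → A.valuation (P.coeff i) < A.valuation (P.coeff k) := fun i hi => by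
    refine lt_of_le_of_ne (hle i) fun he => ?_
    have hi0 : P.coeff i ≠ 0 := fun h0 => by rw [h0, map_zero] at he; exact hkpos.ne he
    have := hkmax i (Finset.mem_filter.2 ⟨mem_support_iff.2 hi0, he.trans hkv⟩)
    exact absurd this (not_le.2 hi)
  set a : ℕ → M := fun i => P.coeff i / P.coeff k with ha
  have haA : ∀ i, a i ∈ A := fun i => by
    rw [← A.valuation_le_one_iff, ha, map_div₀]; exact div_le_one_of_le₀ (hle i) zero_le
  have halt : ∀ i, k < i → A.valuation (a i) < 1 := fun i hi => by
    rw [ha, map_div₀, div_lt_one₀ hkpos]; exact hlt i hi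
  have hak : a k = 1 := div_self hk0
  obtain ⟨e, he⟩ : ∃ e, P.natDegree = k + e :=
    ⟨P.natDegree - k, by have := le_natDegree_of_ne_zero hk0; omega⟩
  have hsum : ∑ i ∈ Finset.range (k + (e + 1)), algebraMap M Ω (a i) * x ^ i = 0 := by
    have h1 := hPx
    rw [aeval_eq_sum_range, he, show k + e + 1 = k + (e + 1) by ring] at h1
    have h2 : ∀ i, algebraMap M Ω (a i) * x ^ i =
        (algebraMap M Ω (P.coeff k))⁻¹ * (P.coeff i • x ^ i) := fun i => by
      rw [ha, map_div₀, Algebra.smul_def]; ring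
    simp_rw [h2]
    rw [← Finset.mul_sum, h1, mul_zero]
  -- The equation is split at `k` and divided by `x ^ (k - 1)`, so that `x = -z / y`. Both `y` and
  -- `z` lie in every valuation ring above `A`: depending on whether it contains `x` or `x⁻¹`, one
  -- of them is clearly there and the relation gives the other. Hence they are integral over `A`.
  set y : Ω := ∑ i ∈ Finset.range (e + 1), algebraMap M Ω (a (k + i)) * x ^ i with hy
  set z : Ω := ∑ i ∈ Finset.range k, algebraMap M Ω (a i) * x⁻¹ ^ (k - 1 - i) with hz
  have hxyz : x * y + z = 0 := by
    rw [Finset.sum_range_add] at hsum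
    have h1 : x ^ k * y + x ^ k * x⁻¹ * z = 0 := by
      rw [← hsum, hy, hz, Finset.mul_sum, Finset.mul_sum, add_comm]
      congr 1
      · refine Finset.sum_congr rfl fun i hi => ?_
        have hik := Finset.mem_range.1 hi
        obtain ⟨t, ht⟩ : ∃ t, k = i + t + 1 := ⟨k - 1 - i, by omega⟩
        rw [show k - 1 - i = t by omega, ht, inv_pow]
        field_simp
        ring
      · refine Finset.sum_congr rfl fun i _ => ?_
        rw [pow_add]; ring
    have h2 : x ^ k * x⁻¹ * (x * y + z) = 0 := by
      rw [← h1]; field_simp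
    exact (mul_eq_zero.1 h2).resolve_left (mul_ne_zero (pow_ne_zero _ hx0) (inv_ne_zero hx0))
  have hall : ∀ U : ValuationSubring Ω, (∀ c ∈ A, algebraMap M Ω c ∈ U) → y ∈ U ∧ z ∈ U := by
    intro U hU
    rcases U.mem_or_inv_mem x with hxU | hxU
    · have h1 : y ∈ U := sum_mem fun i _ => U.mul_mem _ _ (hU _ (haA _)) (pow_mem hxU _)
      exact ⟨h1, by
        rw [show z = -(x * y) by linear_combination hxyz]
        exact U.neg_mem _ (U.mul_mem _ _ hxU h1)⟩
    · have h1 : z ∈ U := sum_mem fun i _ => U.mul_mem _ _ (hU _ (haA _)) (pow_mem hxU _)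
      exact ⟨by
        rw [show y = -(x⁻¹ * z) by field_simp; linear_combination hxyz]
        exact U.neg_mem _ (U.mul_mem _ _ hxU h1), h1⟩
  have hB : ∀ b : Ω, (∀ U : ValuationSubring Ω, (∀ c ∈ A, algebraMap M Ω c ∈ U) → b ∈ U) →
      b ∈ integralClosure A Ω := by
    intro b hb
    by_contra hcon
    obtain ⟨U, hU, hbU⟩ := Subring.exists_le_valuationSubring_of_isIntegrallyClosedIn
      (R := (integralClosure A Ω).toSubring) (x := b) hcon
    exact hbU (hb U fun c hc => hU ((integralClosure A Ω).algebraMap_mem ⟨c, hc⟩))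
  have hyB := hB y fun U hU => (hall U hU).1
  -- With `x ∈ W` the terms of positive degree of `y` are non-units, so `y` is a unit of `W`. The
  -- hypothesis on integral elements makes it a unit of `V`, which forces `x = -z / y` into `V`.
  have hyW : W.valuation y = 1 := by
    rw [hy, Finset.sum_range_succ']
    have h1 : ∀ i : ℕ, W.valuation (algebraMap M Ω (a (k + (i + 1))) * x ^ (i + 1)) < 1 := by
      intro i
      rw [map_mul]
      refine mul_lt_one_of_lt_of_le ?_ ((W.valuation_le_one_iff _).2 (pow_mem hx _))
      have := (val_map_lt_iff hW (a (k + (i + 1))) 1).2 (by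
        rw [map_one]; exact halt _ (by omega))
      simpa using this
    have h2 : W.valuation (∑ i ∈ Finset.range e,
        algebraMap M Ω (a (k + (i + 1))) * x ^ (i + 1)) < 1 :=
      Valuation.map_sum_lt _ one_ne_zero fun i _ => h1 i
    have h3 : algebraMap M Ω (a (k + 0)) * x ^ 0 = 1 := by simp [hak]
    rw [h3, Valuation.map_add_eq_of_lt_right _ (by rwa [map_one]), map_one]
  have hyV : 1 ≤ V.valuation y := by
    by_contra hcon
    exact absurd (h y hyB (not_le.1 hcon)) (by rw [hyW]; exact lt_irrefl _)
  have hzV : V.valuation z ≤ 1 := (V.valuation_le_one_iff _).2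
    (hall V fun c hc => (hV c).2 hc).2
  have h3 : V.valuation x * V.valuation y ≤ 1 := by
    rw [← map_mul, show x * y = -z by linear_combination hxyz, Valuation.map_neg]; exact hzV
  rw [← V.valuation_le_one_iff]
  exact (le_mul_of_one_le_right' hyV).trans h3

/-- The extensions of a valuation ring to a Galois extension are conjugate. -/
theorem exists_algEquiv_mem_iff [IsGalois M Ω] {W V : ValuationSubring Ω}
    (hW : ∀ x : M, algebraMap M Ω x ∈ W ↔ x ∈ A) (hV : ∀ x : M, algebraMap M Ω x ∈ V ↔ x ∈ A) :
    ∃ τ : Ω ≃ₐ[M] Ω, ∀ x, τ x ∈ V ↔ x ∈ W := by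
  let B := integralClosure A Ω
  have hint : ∀ {U : ValuationSubring Ω}, (∀ x : M, algebraMap M Ω x ∈ U ↔ x ∈ A) → ∀ b : B,
      (b : Ω) ∈ U := fun hU b => mem_of_mem_integralClosure hU b.2
  let P : Ideal B := (IsLocalRing.maximalIdeal W).comap
    (B.val.toRingHom.codRestrict W (hint hW))
  let Q : Ideal B := (IsLocalRing.maximalIdeal V).comap
    (B.val.toRingHom.codRestrict V (hint hV))
  have hPmem : ∀ b : B, b ∈ P ↔ W.valuation (b : Ω) < 1 := fun b => by
    rw [Ideal.mem_comap, W.valuation_lt_one_iff]; rfl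
  have hQmem : ∀ b : B, b ∈ Q ↔ V.valuation (b : Ω) < 1 := fun b => by
    rw [Ideal.mem_comap, V.valuation_lt_one_iff]; rfl
  have hP : P.IsPrime := Ideal.comap_isPrime _ _
  have hQ : Q.IsPrime := Ideal.comap_isPrime _ _
  have hPQ : P.under A = Q.under A := by
    ext c
    refine (hPmem (algebraMap A B c)).trans (Iff.trans ?_ (hQmem (algebraMap A B c)).symm)
    have h1 := val_map_lt_iff hW c 1
    have h2 := val_map_lt_iff hV c 1
    simp only [map_one] at h1 h2
    exact h1.trans h2.symm
  have hinv : Algebra.IsInvariant A B (Ω ≃ₐ[M] Ω) := ⟨fun b hb => by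
    obtain ⟨c, hc⟩ := (InfiniteGalois.mem_range_algebraMap_iff_fixed (k := M) (b : Ω)).2
      fun g => congrArg Subtype.val (hb g)
    have hcA : c ∈ A := by
      rw [← hW, hc]; exact hint hW b
    exact ⟨⟨c, hcA⟩, Subtype.ext hc⟩⟩
  -- For the discrete topology, continuity of the action amounts to openness of the stabilizers of
  -- integral elements. Then the profinite Galois group is transitive on the primes of `B` above a
  -- given prime of `A`.
  let : TopologicalSpace B := ⊥
  have : DiscreteTopology B := ⟨rfl⟩
  have : ContinuousSMul (Ω ≃ₐ[M] Ω) B := by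
    refine ⟨continuous_prod_of_discrete_right.2 fun b => continuous_discrete_rng.2 fun b' => ?_⟩
    rw [isOpen_iff_forall_mem_open]
    intro g hg
    have hopen := stabilizer_isOpen_of_isIntegral (K := M) (b : Ω)
    refine ⟨(fun g' => g⁻¹ * g') ⁻¹' (MulAction.stabilizer (Ω ≃ₐ[M] Ω) (b : Ω)), ?_,
      hopen.preimage (continuous_const_mul _), by simp⟩
    intro g' hg'
    have h1 : (g⁻¹ * g') • (b : Ω) = b := hg'
    have h2 : g • b = b' := hg
    change g' • b = b'
    rw [← h2]
    refine Subtype.ext ?_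
    change g' • (b : Ω) = g • (b : Ω)
    rw [mul_smul, inv_smul_eq_iff] at h1
    exact h1
  obtain ⟨g, hg⟩ := Algebra.IsInvariant.exists_smul_of_under_eq_of_profinite
    (G := Ω ≃ₐ[M] Ω) P Q hPQ
  refine ⟨g, ?_⟩
  let V' : ValuationSubring Ω := V.comap (g : Ω →+* Ω)
  have hV'mem : ∀ x, x ∈ V' ↔ g x ∈ V := fun x => Iff.rfl
  have hV' : ∀ x : M, algebraMap M Ω x ∈ V' ↔ x ∈ A := fun x => by
    rw [hV'mem, AlgEquiv.commutes, hV]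
  have hval : ∀ b : Ω, V'.valuation b < 1 ↔ V.valuation (g b) < 1 := fun b => by
    have := val_map_lt_iff (O := V') (ON := V) (φ := (g : Ω →+* Ω)) (fun x => (hV'mem x).symm) b 1
    simp only [map_one] at this
    exact this.symm
  have hcmp : ∀ b ∈ integralClosure A Ω, V'.valuation b < 1 ↔ W.valuation b < 1 := by
    intro b hb
    rw [hval, ← hPmem ⟨b, hb⟩, ← Ideal.smul_mem_pointwise_smul_iff (a := g), ← hg, hQmem]
    rfl
  have heq : W = V' := le_antisymm
    (le_of_maximalIdeal_integralClosure_le hW hV' fun b hb => (hcmp b hb).1)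
    (le_of_maximalIdeal_integralClosure_le hV' hW fun b hb => (hcmp b hb).2)
  intro x
  rw [heq, hV'mem]

end Conjugacy

end PAdicCells

/-! ### Relatively algebraically closed subfields and immediate algebraic extensions -/

namespace PAdicCells

open Polynomial

section Subfield

variable {p : ℕ} [hp : Fact p.Prime] {K : Type*} [Field K] [CharZero K] {O : ValuationSubring K}

/-- Relatively algebraically closed subfields of `p`-adically closed fields are `p`-adically
closed. -/
theorem IsPClosed.comap_of_isAlgebraic_imp {F : Type*} [Field F] [CharZero F] [Algebra F K]
    (h : IsPClosed p O) (hF : ∀ x : K, IsAlgebraic F x → x ∈ Set.range (algebraMap F K)) :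
    IsPClosed p (O.comap (algebraMap F K)) := by
  have hφ : ∀ x : F, algebraMap F K x ∈ O ↔ x ∈ O.comap (algebraMap F K) := fun x => Iff.rfl
  have hinj := (algebraMap F K).injective
  have hp0 := natCast_p_ne_zero p K
  -- Every witness the axioms provide in `K` is algebraic over the data in `F`, hence already in
  -- `F`.
  refine ⟨?_, ?_, ?_, ?_⟩
  · have := val_map_lt_iff hφ (p : F) 1
    rw [map_one, map_one, map_one, map_natCast] at this
    exact this.1 h.val_p
  · intro x hx
    obtain ⟨j, hj, y, hy, hxy⟩ := h.residue _ hx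
    have hy' : algebraMap F K ((x - j) / p) = y := by
      rw [map_div₀, map_sub, map_natCast, map_natCast, hxy]; field_simp; ring
    refine ⟨j, hj, (x - j) / p, ?_, hinj ?_⟩
    · rw [← hφ, hy']; exact hy
    · rw [map_add, map_mul, hy', map_natCast, map_natCast, hxy]
  · intro n a ha
    obtain ⟨x, y, hy, hxy, hx⟩ := h.hensel n (fun i => algebraMap F K (a i)) ha
    obtain ⟨x', rfl⟩ := hF x (by
      let q : F[X] := -X ^ n + ∑ i : Fin n, C (p * a i) * X ^ (i : ℕ)
      have hq : q.degree < ((n + 1 : ℕ) : WithBot ℕ) := by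
        refine lt_of_le_of_lt (b := (n : WithBot ℕ)) ?_ (by exact_mod_cast Nat.lt_succ_self n)
        refine (degree_add_le _ _).trans (max_le ?_ ?_)
        · rw [degree_neg]; exact degree_X_pow_le n
        · refine (degree_sum_le _ _).trans (Finset.sup_le fun i _ => ?_)
          refine (degree_C_mul_X_pow_le _ _).trans ?_
          exact_mod_cast i.2.le
      refine ⟨X ^ (n + 1) + q, (monic_X_pow_add hq).ne_zero, ?_⟩
      rw [← hx]
      simp [q, sub_eq_add_neg, add_assoc])
    have hy' : algebraMap F K ((x' - 1) / p) = y := by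
      rw [map_div₀, map_sub, map_one, map_natCast, hxy]; field_simp; ring
    refine ⟨x', (x' - 1) / p, ?_, hinj ?_, hinj ?_⟩
    · rw [← hφ, hy']; exact hy
    · rw [map_add, map_mul, hy', map_natCast, map_one, hxy]
    · simpa using hx
  · intro n hn
    obtain ⟨Q, hQ⟩ := h.exists_pow n hn
    refine ⟨Q, fun x hx => ?_⟩
    obtain ⟨q, hq, hqQ, y, hxy⟩ := hQ (algebraMap F K x) (by simpa using hx)
    have hq0 : (q : K) ≠ 0 := Nat.cast_ne_zero.2 hq.ne'
    obtain ⟨y', rfl⟩ := hF y (by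
      refine IsAlgebraic.of_pow (r := y) hn ?_
      have : y ^ n = algebraMap F K (x / q) := by
        rw [map_div₀, map_natCast, hxy]; field_simp
      rw [this]
      exact isAlgebraic_algebraMap _)
    exact ⟨q, hq, hqQ, y', hinj (by simpa using hxy)⟩

end Subfield

section Immediate

variable {p : ℕ} [hp : Fact p.Prime] {K N : Type*} [Field K] [CharZero K] [Field N] [CharZero N]
  {O : ValuationSubring K} {ON : ValuationSubring N}

/-- Immediate algebraic extensions embed into `p`-adically closed extensions of the base. -/
theorem IsPClosed.nonempty_algHom_of_immediate (h : IsPClosed p O) (hN : IsPClosed p ON)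
    (M : Type*) [Field M] [Algebra M K] [Algebra M N] [Algebra.IsAlgebraic M K]
    (hM : ∀ m : M, algebraMap M K m ∈ O ↔ algebraMap M N m ∈ ON)
    (himm : ∀ x : K, ∃ e : M, O.valuation x = O.valuation (algebraMap M K e)) :
    Nonempty (K →ₐ[M] N) := by
  have : CharZero M := by
    refine charZero_of_inj_zero fun n hn => ?_
    have := congrArg (algebraMap M K) hn
    simpa using this
  let Ω := AlgebraicClosure K
  let Ω' := AlgebraicClosure N
  have : CharZero Ω := charZero_of_injective_algebraMap (algebraMap K Ω).injective
  have : Algebra.IsAlgebraic M Ω := Algebra.IsAlgebraic.trans M K Ω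
  have : IsAlgClosure M Ω := ⟨inferInstance, inferInstance⟩
  have : Normal M Ω := IsAlgClosure.normal M Ω
  have : IsGalois M Ω := ⟨⟩
  have : IsGalois K Ω := ⟨⟩
  have : IsGalois N Ω' := ⟨⟩
  obtain ⟨W, hW⟩ := exists_valuationSubring_over O (algebraMap K Ω)
  obtain ⟨W', hW'⟩ := exists_valuationSubring_over ON (algebraMap N Ω')
  let φ₀ : Ω →ₐ[M] Ω' := IsAlgClosed.lift
  -- Any embedding of algebraic closures can be corrected by an automorphism so as to respect the
  -- chosen valuations, by conjugacy.
  obtain ⟨φ, hφ⟩ : ∃ φ : Ω →ₐ[M] Ω', ∀ x, φ x ∈ W' ↔ x ∈ W := by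
    let A : ValuationSubring M := O.comap (algebraMap M K)
    let V : ValuationSubring Ω := W'.comap (φ₀ : Ω →+* Ω')
    have hWA : ∀ x : M, algebraMap M Ω x ∈ W ↔ x ∈ A := fun x => by
      rw [IsScalarTower.algebraMap_apply M K Ω, hW]; rfl
    have hVA : ∀ x : M, algebraMap M Ω x ∈ V ↔ x ∈ A := fun x => by
      change φ₀ (algebraMap M Ω x) ∈ W' ↔ algebraMap M K x ∈ O
      rw [AlgHom.commutes, IsScalarTower.algebraMap_apply M N Ω', hW', hM]
    obtain ⟨τ, hτ⟩ := exists_algEquiv_mem_iff hWA hVA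
    exact ⟨φ₀.comp τ.toAlgHom, hτ⟩
  -- The decomposition group of `W` over `M`. The claim `hfix` says that `K` lies in its fixed
  -- field.
  let H : Subgroup (Ω ≃ₐ[M] Ω) :=
    { carrier := {g | ∀ x, W.valuation (g x) = W.valuation x}
      mul_mem' := fun {a b} ha hb x => by
        rw [AlgEquiv.mul_apply]; exact (ha _).trans (hb _)
      one_mem' := fun x => rfl
      inv_mem' := fun {a} ha x => by
        have := ha (a⁻¹ x)
        rw [← AlgEquiv.mul_apply, mul_inv_cancel] at this
        exact this.symm }
  have hfix : ∀ θ : K, ∀ g ∈ H, g (algebraMap K Ω θ) = algebraMap K Ω θ := by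
    intro θ
    obtain ⟨m, d, hm, -, hd, happ⟩ := exists_fixed_approx (W := W) H (fun g hg => hg)
      (Algebra.IsAlgebraic.isAlgebraic (R := M) (algebraMap K Ω θ))
    -- The averaged element `d` is fixed by `H`, which contains all automorphisms over `K` since
    -- these preserve the valuation; so `d ∈ K`.
    obtain ⟨d, rfl⟩ := (InfiniteGalois.mem_range_algebraMap_iff_fixed (k := K) d).2 fun g =>
      hd (g.restrictScalars M) fun x => h.val_algEquiv hW g x
    suffices hθ : θ = d by rw [hθ]; exact hd
    by_contra hne
    have hx0 : θ - d ≠ 0 := sub_ne_zero.2 hne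
    obtain ⟨e, he⟩ := himm (θ - d)
    have hev : O.valuation (algebraMap M K e) ≠ 0 := by
      rw [← he]; simpa using hx0
    obtain ⟨s, hs⟩ := val_natCast_eq_pow h.val_p hm.ne'
    -- If `θ ≠ d`, immediacy and the residue digits give `j * e` in `M` approximating `θ - d` with
    -- relative error below the value of `m`. Then `d + j * e` is an `H`-fixed element closer to `θ`
    -- than the optimality of `d` permits.
    obtain ⟨j, y, hy, hjy⟩ := h.exists_nat_approx (s + 1) ((θ - d) / algebraMap M K e) (by
      rw [← O.valuation_le_one_iff, map_div₀, he, div_self hev])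
    have hclose : O.valuation (θ - d - algebraMap M K (j * e)) <
        O.valuation (m : K) * O.valuation (θ - d) := by
      have h1 : θ - d - algebraMap M K (j * e) = p ^ (s + 1) * y * algebraMap M K e := by
        have he0 : algebraMap M K e ≠ 0 := by
          intro h0; rw [h0, map_zero] at hev; exact hev rfl
        rw [div_eq_iff he0] at hjy
        rw [hjy, map_mul, map_natCast]; ring
      rw [h1, map_mul, map_mul, map_pow, hs, ← he]
      refine mul_lt_mul_of_pos_right ?_ ((Valuation.pos_iff _).2 hx0)
      refine (mul_le_of_le_one_right' ((O.valuation_le_one_iff _).2 hy)).trans_lt ?_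
      exact pow_lt_pow_right_of_lt_one₀ h.val_p_pos h.val_p (Nat.lt_succ_self s)
    have hle : O.valuation (m : K) * O.valuation (algebraMap M K (j * e)) ≤
        O.valuation (θ - d - algebraMap M K (j * e)) := by
      have h1 := happ (algebraMap K Ω (d + algebraMap M K (j * e))) fun g hg => by
        rw [map_add, map_add g, hd g hg, ← IsScalarTower.algebraMap_apply, AlgEquiv.commutes]
      rw [← map_natCast (algebraMap K Ω), ← map_sub, ← map_sub, ← map_mul, ← map_mul,
        val_map_le_iff hW, map_mul] at h1
      rw [show d + algebraMap M K (j * e) - d = algebraMap M K (j * e) by ring,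
        Valuation.map_sub_swap, show θ - (d + algebraMap M K (j * e)) =
          θ - d - algebraMap M K (j * e) by ring] at h1
      exact h1
    have hm0 : 0 < O.valuation (m : K) := by rw [hs]; exact pow_pos h.val_p_pos _
    have h2 : O.valuation (algebraMap M K (j * e)) < O.valuation (θ - d) :=
      lt_of_mul_lt_mul_left (hle.trans_lt hclose) zero_le
    have h3 : O.valuation (θ - d - algebraMap M K (j * e)) = O.valuation (θ - d) :=
      Valuation.map_sub_eq_of_lt_left _ h2
    rw [h3] at hclose
    exact absurd hclose (not_lt.2 (mul_le_of_le_one_left' (val_natCast_le_one O m)))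
  have hrange : ∀ θ : K, φ (algebraMap K Ω θ) ∈ Set.range (algebraMap N Ω') := by
    intro θ
    rw [InfiniteGalois.mem_range_algebraMap_iff_fixed]
    intro ρ
    let : Algebra Ω Ω' := φ.toRingHom.toAlgebra
    have : IsScalarTower M Ω Ω' := IsScalarTower.of_algebraMap_eq fun x => (φ.commutes x).symm
    let τ : Ω ≃ₐ[M] Ω := (ρ.restrictScalars M).restrictNormal Ω
    have hτ : ∀ x, φ (τ x) = ρ (φ x) := fun x =>
      AlgEquiv.restrictNormal_commutes (ρ.restrictScalars M) Ω x
    have hτH : τ ∈ H := fun x => by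
      rw [← val_map_eq_iff (φ := (φ : Ω →+* Ω')) hφ]
      change W'.valuation (φ (τ x)) = W'.valuation (φ x)
      rw [hτ, hN.val_algEquiv hW']
    rw [← hτ, hfix θ τ hτH]
  choose ψ hψ using hrange
  have hinj := (algebraMap N Ω').injective
  exact ⟨{ toFun := ψ
           map_one' := hinj (by rw [hψ]; simp)
           map_mul' := fun x y => hinj (by rw [map_mul, hψ, hψ, hψ]; simp)
           map_zero' := hinj (by rw [hψ]; simp)
           map_add' := fun x y => hinj (by rw [map_add, hψ, hψ, hψ]; simp)
           commutes' := fun m => hinj (by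
             rw [hψ, ← IsScalarTower.algebraMap_apply, ← IsScalarTower.algebraMap_apply,
               AlgHom.commutes]) }⟩

/-- A variant of `IsPClosed.nonempty_algHom_of_immediate` where the base field is generated by the
image of a ring. -/
theorem IsPClosed.exists_ringHom_of_immediate (h : IsPClosed p O) (hN : IsPClosed p ON)
    {R : Type*} [CommRing R] (f : R →+* K) (g : R →+* N)
    (hfg : ∀ P Q, O.valuation (f P) ≤ O.valuation (f Q) ↔ ON.valuation (g P) ≤ ON.valuation (g Q))
    (halg : ∀ x : K, IsAlgebraic f.range x)
    (himm : ∀ x : K, ∃ P Q, f Q ≠ 0 ∧ O.valuation x = O.valuation (f P / f Q)) :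
    ∃ φ : K →+* N, φ.comp f = g := by
  have hzero : ∀ P, f P = 0 ↔ g P = 0 := fun P => by
    have := hfg P 0
    simpa using this
  let A := f.range
  let M := FractionRing A
  let gA : A →+* N := f.rangeRestrict.liftOfSurjective f.rangeRestrict_surjective ⟨g, fun P hP => by
    rw [RingHom.mem_ker] at hP ⊢
    exact (hzero P).1 (congrArg Subtype.val hP)⟩
  have hgA : ∀ P, gA (f.rangeRestrict P) = g P := fun P =>
    RingHom.liftOfRightInverse_comp_apply _ _ _ _ P
  have hinjA : Function.Injective A.subtype := Subtype.val_injective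
  have hinjg : Function.Injective gA := by
    rw [injective_iff_map_eq_zero]
    intro a ha
    obtain ⟨P, rfl⟩ := f.rangeRestrict_surjective a
    rw [hgA, ← hzero] at ha
    exact Subtype.ext ha
  let iK : M →+* K := IsFractionRing.lift hinjA
  let iN : M →+* N := IsFractionRing.lift hinjg
  have hiK : ∀ a : A, iK (algebraMap A M a) = a := fun a => IsFractionRing.lift_algebraMap hinjA a
  have hiN : ∀ a : A, iN (algebraMap A M a) = gA a := fun a => IsFractionRing.lift_algebraMap hinjg a
  let : Algebra M K := iK.toAlgebra
  let : Algebra M N := iN.toAlgebra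
  have : IsScalarTower A M K := IsScalarTower.of_algebraMap_eq fun a => (hiK a).symm
  have : Algebra.IsAlgebraic M K := ⟨fun x => (halg x).extendScalars (IsFractionRing.injective A M)⟩
  obtain ⟨φ⟩ := h.nonempty_algHom_of_immediate hN M (fun m => by
      obtain ⟨a, b, hb, rfl⟩ := IsFractionRing.div_surjective (A := A) m
      obtain ⟨P, rfl⟩ := f.rangeRestrict_surjective a
      obtain ⟨Q, rfl⟩ := f.rangeRestrict_surjective b
      change iK _ ∈ O ↔ iN _ ∈ ON
      have hQ : f Q ≠ 0 := fun h0 => nonZeroDivisors.ne_zero hb (Subtype.ext h0)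
      have hgQ : g Q ≠ 0 := fun h0 => hQ ((hzero Q).2 h0)
      rw [map_div₀, map_div₀, hiK, hiK, hiN, hiN, hgA, hgA, RingHom.coe_rangeRestrict,
        RingHom.coe_rangeRestrict, ← O.valuation_le_one_iff, ← ON.valuation_le_one_iff, map_div₀,
        map_div₀, div_le_one₀ ((Valuation.pos_iff _).2 hQ),
        div_le_one₀ ((Valuation.pos_iff _).2 hgQ), hfg])
    (fun x => by
      obtain ⟨P, Q, hQ, hx⟩ := himm x
      refine ⟨algebraMap A M (f.rangeRestrict P) / algebraMap A M (f.rangeRestrict Q), ?_⟩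
      rw [hx]
      change _ = O.valuation (iK _)
      rw [map_div₀ iK, hiK, hiK]; rfl)
  refine ⟨φ, RingHom.ext fun P => ?_⟩
  have h1 := φ.commutes (algebraMap A M (f.rangeRestrict P))
  change φ (iK _) = iN _ at h1
  rw [hiK, hiN, hgA] at h1
  exact h1

end Immediate

section Torsion

theorem isAlgebraic_range_iff {R K : Type*} [CommRing R] [Field K] (f : R →+* K) (x : K) :
    IsAlgebraic f.range x ↔ ∃ P : R[X], P.map f ≠ 0 ∧ P.eval₂ f x = 0 := by
  have hcomp : (f.range.subtype).comp f.rangeRestrict = f := RingHom.ext fun _ => rfl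
  constructor
  · rintro ⟨P, hP0, hP⟩
    obtain ⟨Q, rfl⟩ := map_surjective f.rangeRestrict f.rangeRestrict_surjective P
    have hinj : Function.Injective f.range.subtype := Subtype.val_injective
    refine ⟨Q, fun h0 => hP0 ?_, ?_⟩
    · rw [← hcomp, ← map_map] at h0
      exact (Polynomial.map_eq_zero_iff hinj).1 h0
    · rw [aeval_def, eval₂_map] at hP
      exact hP
  · rintro ⟨P, hP0, hP⟩
    refine ⟨P.map f.rangeRestrict, fun h0 => hP0 ?_, ?_⟩
    · rw [← hcomp, ← map_map, h0, Polynomial.map_zero]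
    · rw [aeval_def, eval₂_map]
      exact hP

theorem isAlgebraic_range_comp_iff {R L K : Type*} [CommRing R] [Field L] [Field K] (f : R →+* L)
    (k : L →+* K) (x : L) : IsAlgebraic (k.comp f).range (k x) ↔ IsAlgebraic f.range x := by
  rw [isAlgebraic_range_iff, isAlgebraic_range_iff]
  refine exists_congr fun P => ?_
  rw [← map_map, ← hom_eval₂, Polynomial.map_ne_zero_iff k.injective, map_eq_zero]

/-- The value of an algebraic element has a power in the value group of the base. -/
theorem exists_pow_val_eq {A K : Type*} [CommRing A] [Field K] [Algebra A K]
    (hinj : Function.Injective (algebraMap A K)) (O : ValuationSubring K)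
    {x : K} (hx : IsAlgebraic A x) : ∃ n : ℕ, 0 < n ∧ ∃ a c : A, algebraMap A K c ≠ 0 ∧
      O.valuation x ^ n = O.valuation (algebraMap A K a / algebraMap A K c) := by
  classical
  have : Nontrivial A := hx.nontrivial
  rcases eq_or_ne x 0 with rfl | hx0
  · exact ⟨1, one_pos, 0, 1, by simp, by simp⟩
  obtain ⟨P, hP0, hP⟩ := hx
  have hvx : O.valuation x ≠ 0 := by simpa using hx0
  let t : ℕ → K := fun i => algebraMap A K (P.coeff i) * x ^ i
  obtain ⟨i, hi, hmax⟩ := P.support.exists_max_image (fun i => O.valuation (t i))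
    (support_nonempty.2 hP0)
  have hne : ∀ i ∈ P.support, algebraMap A K (P.coeff i) ≠ 0 := fun i hi h0 =>
    mem_support_iff.1 hi (hinj (by rw [h0, map_zero]))
  have hti : t i ≠ 0 := mul_ne_zero (hne i hi) (pow_ne_zero _ hx0)
  -- In a vanishing sum the largest value is attained at least twice; comparing two such monomials
  -- isolates a power of the value of `x`.
  obtain ⟨j, hj, hji, hv⟩ : ∃ j ∈ P.support, j ≠ i ∧ O.valuation (t j) = O.valuation (t i) := by
    by_contra hcon
    push Not at hcon
    have hsum : t i + ∑ j ∈ P.support.erase i, t j = 0 := by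
      rw [Finset.add_sum_erase _ _ hi, ← hP, aeval_def, eval₂_eq_sum, Polynomial.sum_def]
    have hlt : O.valuation (∑ j ∈ P.support.erase i, t j) < O.valuation (t i) := by
      refine Valuation.map_sum_lt _ (by simpa using hti) fun j hj => ?_
      obtain ⟨hji, hj⟩ := Finset.mem_erase.1 hj
      exact lt_of_le_of_ne (hmax j hj) (hcon j hj hji)
    have h1 : O.valuation (t i) = O.valuation (∑ j ∈ P.support.erase i, t j) := by
      rw [eq_neg_of_add_eq_zero_left hsum, Valuation.map_neg]
    exact hlt.ne h1.symm
  have key : ∀ i j : ℕ, i < j → algebraMap A K (P.coeff j) ≠ 0 →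
      O.valuation (t j) = O.valuation (t i) → ∃ n : ℕ, 0 < n ∧ ∃ a c : A, algebraMap A K c ≠ 0 ∧
      O.valuation x ^ n = O.valuation (algebraMap A K a / algebraMap A K c) := by
    intro i j hij hj0 hv
    refine ⟨j - i, by omega, P.coeff i, P.coeff j, hj0, ?_⟩
    have hvj : O.valuation (algebraMap A K (P.coeff j)) ≠ 0 := by simpa using hj0
    simp only [t, map_mul, map_pow] at hv
    rw [map_div₀, eq_div_iff hvj]
    have h2 : O.valuation x ^ j = O.valuation x ^ (j - i) * O.valuation x ^ i := by
      rw [← pow_add]; congr 1; omega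
    rw [h2] at hv
    refine mul_right_cancel₀ (pow_ne_zero i hvx) ?_
    rw [← hv, mul_comm (_ ^ _) (O.valuation _), mul_assoc]
  rcases lt_or_gt_of_ne hji with hlt | hlt
  · exact key j i hlt (hne i hi) hv.symm
  · exact key i j hlt (hne j hj) hv

/-- Embeddings of `p`-adically closed fields are relatively algebraically closed. -/
theorem IsPClosed.mem_range_of_isAlgebraic {p : ℕ} [hp : Fact p.Prime] {F K : Type*} [Field F]
    [CharZero F] [Field K] [CharZero K] [Algebra F K] {OF : ValuationSubring F}
    {O : ValuationSubring K} (hF : IsPClosed p OF) (h : IsPClosed p O) {x : K}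
    (hx : IsAlgebraic F x) : x ∈ Set.range (algebraMap F K) := by
  let L := algebraicClosure F K
  have hL : IsPClosed p (O.comap (algebraMap L K)) := h.comap_of_isAlgebraic_imp fun y hy =>
    ⟨⟨y, mem_algebraicClosure_iff.2 (hy.restrictScalars F)⟩, rfl⟩
  have hcomap : ∀ y : L, algebraMap L K y ∈ O ↔ y ∈ O.comap (algebraMap L K) := fun y => Iff.rfl
  -- The relative algebraic closure `L` is immediate over `F`, because values whose powers come from
  -- `F` come from `F`. So it retracts onto `F`, and injectivity of the retraction gives `L = F`.
  obtain ⟨φ⟩ := hL.nonempty_algHom_of_immediate hF F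
    (fun m => hF.map_mem_iff hL (algebraMap F L) m) fun y => by
      obtain ⟨n, hn, a, c, -, ha⟩ := exists_pow_val_eq (A := F) (algebraMap F L).injective
        (O.comap (algebraMap L K)) (Algebra.IsAlgebraic.isAlgebraic y)
      rw [← map_div₀ (algebraMap F L)] at ha
      exact hL.exists_val_eq_of_pow hF hn ha
  let y : L := ⟨x, mem_algebraicClosure_iff.2 hx⟩
  have h1 : algebraMap F L (φ y) = y := by
    apply φ.toRingHom.injective
    exact φ.commutes (φ y)
  exact ⟨φ y, congrArg Subtype.val h1⟩

end Torsion

end PAdicCells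

/-! ### First-order semantics and ultrapowers -/

namespace PAdicCells

open Polynomial FirstOrder Filter

section Semantics

/-- `K` as a structure for `Ldiv`, where divisibility is taken from a valuation ring. -/
@[reducible] def divStructure {K : Type*} [Field K] (O : ValuationSubring K) : Ldiv.Structure K where
  funMap := fun {_} f => match f with
    | ringFunc.add => fun x => x 0 + x 1
    | ringFunc.mul => fun x => x 0 * x 1
    | ringFunc.neg => fun x => - x 0
    | ringFunc.zero => fun _ => 0
    | ringFunc.one => fun _ => 1
  RelMap := fun {_} r => match r with
    | DivRel.div => fun x => O.valuation (x 1) ≤ O.valuation (x 0)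

/-- The value of a term. -/
def termVal {K : Type*} [Field K] (O : ValuationSubring K) {α : Type*} (t : Ldiv.Term α)
    (x : α → K) : K :=
  letI := divStructure O
  t.realize x

/-- The truth of a formula. -/
def Holds {K : Type*} [Field K] (O : ValuationSubring K) {α : Type*} {n : ℕ}
    (φ : Ldiv.BoundedFormula α n) (x : α → K) (y : Fin n → K) : Prop :=
  letI := divStructure O
  φ.Realize x y

variable {K N : Type*} [Field K] [Field N] (O : ValuationSubring K) (ON : ValuationSubring N)

theorem holds_falsum {α : Type*} {n : ℕ} (x : α → K) (y : Fin n → K) :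
    Holds O Language.BoundedFormula.falsum x y ↔ False := Iff.rfl

theorem holds_equal {α : Type*} {n : ℕ} (t u : Ldiv.Term (α ⊕ Fin n)) (x : α → K) (y : Fin n → K) :
    Holds O (Language.BoundedFormula.equal t u) x y ↔
      termVal O t (Sum.elim x y) = termVal O u (Sum.elim x y) := Iff.rfl

theorem holds_rel {α : Type*} {n : ℕ} (ts : Fin 2 → Ldiv.Term (α ⊕ Fin n)) (x : α → K)
    (y : Fin n → K) :
    Holds O (Language.BoundedFormula.rel (DivRel.div : Ldiv.Relations 2) ts) x y ↔
      O.valuation (termVal O (ts 1) (Sum.elim x y)) ≤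
        O.valuation (termVal O (ts 0) (Sum.elim x y)) := Iff.rfl

theorem holds_imp {α : Type*} {n : ℕ} (φ ψ : Ldiv.BoundedFormula α n) (x : α → K) (y : Fin n → K) :
    Holds O (φ.imp ψ) x y ↔ (Holds O φ x y → Holds O ψ x y) := Iff.rfl

theorem holds_all {α : Type*} {n : ℕ} (φ : Ldiv.BoundedFormula α (n + 1)) (x : α → K)
    (y : Fin n → K) : Holds O φ.all x y ↔ ∀ b : K, Holds O φ x (Fin.snoc y b) := Iff.rfl

theorem map_termVal (φ : K →+* N) {α : Type*} (t : Ldiv.Term α) (x : α → K) :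
    φ (termVal O t x) = termVal ON t (φ ∘ x) := by
  induction t with
  | var a => rfl
  | func f ts ih =>
    cases f with
    | add => exact (map_add φ _ _).trans (congrArg₂ (· + ·) (ih 0) (ih 1))
    | mul => exact (map_mul φ _ _).trans (congrArg₂ (· * ·) (ih 0) (ih 1))
    | neg => exact (map_neg φ _).trans (congrArg (- ·) (ih 0))
    | zero => exact map_zero φ
    | one => exact map_one φ

end Semantics

section Ultrapower

variable {p : ℕ} [hp : Fact p.Prime] {F : Type*} [Field F] {O : ValuationSubring F}
  {ι : Type*} {U : Ultrafilter ι}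

/-- The valuation ring of an ultrapower. -/
def germRing (U : Ultrafilter ι) (O : ValuationSubring F) :
    ValuationSubring (Germ (U : Filter ι) F) where
  carrier := {x | x.LiftPred (· ∈ O)}
  mul_mem' {a b} := by
    induction a, b using Germ.inductionOn₂ with
    | h a b => exact fun ha hb => (ha.and hb).mono fun s hs => O.mul_mem _ _ hs.1 hs.2
  one_mem' := Eventually.of_forall fun _ => O.one_mem
  add_mem' {a b} := by
    induction a, b using Germ.inductionOn₂ with
    | h a b => exact fun ha hb => (ha.and hb).mono fun s hs => O.add_mem _ _ hs.1 hs.2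
  zero_mem' := Eventually.of_forall fun _ => O.zero_mem
  neg_mem' {a} := by
    induction a using Germ.inductionOn with
    | h a => exact fun ha => ha.mono fun s hs => O.neg_mem _ hs
  mem_or_inv_mem' a := by
    induction a using Germ.inductionOn with
    | h a => exact Ultrafilter.eventually_or.1 (Eventually.of_forall fun s => O.mem_or_inv_mem (a s))

/-- The class of a function in an ultrapower, as a ring homomorphism. -/
noncomputable abbrev germMk (U : Ultrafilter ι) (F : Type*) [Field F] :
    (ι → F) →+* Germ (U : Filter ι) F :=
  Germ.coeRingHom (U : Filter ι)

theorem germMk_surjective : Function.Surjective (germMk U F) := fun x =>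
  Germ.inductionOn x fun a => ⟨a, rfl⟩

theorem germMk_eq_iff (a b : ι → F) : germMk U F a = germMk U F b ↔ ∀ᶠ s in U, a s = b s :=
  Germ.coe_eq

theorem germMk_mem_iff (a : ι → F) : germMk U F a ∈ germRing U O ↔ ∀ᶠ s in U, a s ∈ O := Iff.rfl

theorem germ_val_le_iff (a b : ι → F) :
    (germRing U O).valuation (germMk U F a) ≤ (germRing U O).valuation (germMk U F b) ↔
      ∀ᶠ s in U, O.valuation (a s) ≤ O.valuation (b s) := by
  rw [ValuationSubring.valuation_le_iff]
  constructor
  · rintro ⟨⟨c, hc⟩, h⟩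
    obtain ⟨c, rfl⟩ := germMk_surjective c
    rw [← map_mul, germMk_eq_iff] at h
    filter_upwards [h, (germMk_mem_iff c).1 hc] with s h1 h2
    exact (O.valuation_le_iff _ _).2 ⟨⟨c s, h2⟩, h1⟩
  · intro h
    obtain ⟨c, hc⟩ := (h.mono fun s hs => (O.valuation_le_iff _ _).1 hs).choice
    refine ⟨⟨germMk U F fun s => c s, (germMk_mem_iff _).2 (Eventually.of_forall fun s => (c s).2)⟩, ?_⟩
    rw [← map_mul, germMk_eq_iff]
    exact hc

theorem germ_termVal {α : Type*} (t : Ldiv.Term α) (x : α → ι → F) :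
    termVal (germRing U O) t (fun a => germMk U F (x a)) =
      germMk U F fun s => termVal O t fun a => x a s := by
  induction t with
  | var a => rfl
  | func f ts ih =>
    cases f with
    | add => exact (congrArg₂ (· + ·) (ih 0) (ih 1)).trans (map_add (germMk U F) _ _).symm
    | mul => exact (congrArg₂ (· * ·) (ih 0) (ih 1)).trans (map_mul (germMk U F) _ _).symm
    | neg => exact (congrArg (- ·) (ih 0)).trans (map_neg (germMk U F) _).symm
    | zero => exact (map_zero (germMk U F)).symm
    | one => exact (map_one (germMk U F)).symm

/-- **Łoś's theorem** for ultrapowers of valued fields. -/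
theorem germ_holds_iff {α : Type*} {n : ℕ} (φ : Ldiv.BoundedFormula α n) (x : α → ι → F)
    (y : Fin n → ι → F) :
    Holds (germRing U O) φ (fun a => germMk U F (x a)) (fun i => germMk U F (y i)) ↔
      ∀ᶠ s in U, Holds O φ (fun a => x a s) fun i => y i s := by
  have hsum : ∀ {m : ℕ} (y : Fin m → ι → F), (Sum.elim (fun a => germMk U F (x a))
      fun i => germMk U F (y i)) = fun c => germMk U F (Sum.elim x y c) := fun y =>
    funext fun c => by cases c <;> rfl
  have hsum' : ∀ {m : ℕ} (y : Fin m → ι → F) (s : ι), (Sum.elim (fun a => x a s)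
      fun i => y i s) = fun c => Sum.elim x y c s := fun y s =>
    funext fun c => by cases c <;> rfl
  induction φ with
  | falsum => simp [holds_falsum, U.neBot.ne]
  | equal t u => simp only [holds_equal, hsum, hsum', germ_termVal, germMk_eq_iff]
  | rel r ts =>
    cases r
    simp only [holds_rel, hsum, hsum', germ_termVal, germ_val_le_iff]
  | imp φ ψ ihφ ihψ =>
    simp only [holds_imp, ihφ, ihψ]
    rw [Ultrafilter.eventually_imp]
  | @all m φ ih =>
    have hsnoc : ∀ (b : ι → F), (Fin.snoc (fun i => germMk U F (y i)) (germMk U F b) :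
        Fin (m + 1) → Germ (U : Filter ι) F) = fun i => germMk U F
          ((Fin.snoc y b : Fin (m + 1) → ι → F) i) := fun b =>
      funext fun i => by
        refine Fin.lastCases ?_ (fun i => ?_) i
        · simp only [Fin.snoc_last]
        · simp only [Fin.snoc_castSucc]
    have hsnoc' : ∀ (b : ι → F) (s : ι), (fun i => (Fin.snoc y b : Fin (m + 1) → ι → F) i s) =
        (Fin.snoc (fun i => y i s) (b s) : Fin (m + 1) → F) := fun b s =>
      funext fun i => by
        refine Fin.lastCases ?_ (fun i => ?_) i
        · simp only [Fin.snoc_last]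
        · simp only [Fin.snoc_castSucc]
    simp only [holds_all]
    constructor
    · intro h
      by_contra hcon
      rw [← Ultrafilter.eventually_not] at hcon
      obtain ⟨b, hb⟩ := (hcon.mono fun s hs => not_forall.1 hs).choice
      have h1 := h (germMk U F b)
      rw [hsnoc] at h1
      replace h1 := (ih _).1 h1
      obtain ⟨s, hs1, hs2⟩ := (h1.and hb).exists
      rw [hsnoc'] at hs1
      exact hs2 hs1
    · intro h b
      obtain ⟨b, rfl⟩ := germMk_surjective b
      rw [hsnoc]
      refine (ih _).2 ?_
      filter_upwards [h] with s hs
      rw [hsnoc']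
      exact hs _

/-- The diagonal embedding into an ultrapower. -/
noncomputable def germDiag (U : Ultrafilter ι) (F : Type*) [Field F] :
    F →+* Germ (U : Filter ι) F :=
  (germMk U F).comp (Pi.constRingHom ι F)

theorem germDiag_holds_iff {α : Type*} {n : ℕ} (φ : Ldiv.BoundedFormula α n) (x : α → F)
    (y : Fin n → F) :
    Holds (germRing U O) φ (germDiag U F ∘ x) (germDiag U F ∘ y) ↔ Holds O φ x y :=
  (germ_holds_iff φ (fun a _ => x a) fun i _ => y i).trans eventually_const

instance germ_charZero [CharZero F] : CharZero (Germ (U : Filter ι) F) :=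
  charZero_of_injective_ringHom (germDiag U F).injective

/-- The axioms pass to germs because the natural numbers they produce are bounded: `j < p` and `q ≤
Q` range over finite sets, so the ultrafilter selects one constant value. -/
theorem IsPClosed.germ [CharZero F] (h : IsPClosed p O) : IsPClosed p (germRing U O) := by
  have hnat : ∀ n : ℕ, (n : Germ (U : Filter ι) F) = germMk U F fun _ => (n : F) := fun n =>
    (map_natCast (germMk U F) n).symm
  refine ⟨?_, ?_, ?_, ?_⟩
  · rw [← map_one (germRing U O).valuation, ← map_one (germMk U F), hnat, ← not_le, germ_val_le_iff]
    change ¬ ∀ᶠ _ in (U : Filter ι), O.valuation 1 ≤ O.valuation (p : F)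
    rw [eventually_const, map_one, not_le]
    exact h.val_p
  · intro x hx
    obtain ⟨x, rfl⟩ := germMk_surjective x
    have h1 : ∀ᶠ s in U, ∃ j ∈ Set.Iio p, ∃ y ∈ O, x s = (j : F) + p * y :=
      hx.mono fun s hs => h.residue _ hs
    obtain ⟨j, hj, h2⟩ := (Ultrafilter.eventually_exists_mem_iff (Set.finite_Iio p)).1 h1
    obtain ⟨y, hy⟩ := h2.choice
    refine ⟨j, hj, germMk U F y, hy.mono fun s hs => hs.1, ?_⟩
    rw [hnat, hnat, ← map_mul, ← map_add, germMk_eq_iff]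
    exact hy.mono fun s hs => hs.2
  · intro n a ha
    choose a' ha' using fun i => germMk_surjective (a i)
    obtain rfl : (fun i => germMk U F (a' i)) = a := funext ha'
    have h1 : ∀ᶠ s in U, ∀ i, a' i s ∈ O := eventually_all.2 ha
    obtain ⟨x, hx⟩ := (h1.mono fun s hs => h.hensel n (fun i => a' i s) hs).choice
    obtain ⟨y, hy⟩ := hx.choice
    refine ⟨germMk U F x, germMk U F y, hy.mono fun s hs => hs.1, ?_, ?_⟩
    · rw [hnat, ← map_mul, ← map_one (germMk U F), ← map_add, germMk_eq_iff]
      exact hy.mono fun s hs => hs.2.1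
    · rw [hnat]
      simp only [← map_pow, ← map_mul, ← map_sub, ← map_sum, ← map_add]
      rw [← map_zero (germMk U F), germMk_eq_iff]
      filter_upwards [hy] with s hs
      simpa using hs.2.2
  · intro n hn
    obtain ⟨Q, hQ⟩ := h.exists_pow n hn
    refine ⟨Q, fun x hx => ?_⟩
    obtain ⟨x, rfl⟩ := germMk_surjective x
    have h1 : ∀ᶠ s in U, ∃ q ∈ Set.Icc 1 Q, ∃ y : F, x s = q * y ^ n := by
      rw [← map_zero (germMk U F), Ne, germMk_eq_iff, ← Ultrafilter.eventually_not] at hx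
      exact hx.mono fun s hs => by
        obtain ⟨q, hq, hqQ, y, hy⟩ := hQ _ hs
        exact ⟨q, ⟨hq, hqQ⟩, y, hy⟩
    obtain ⟨q, hq, h2⟩ := (Ultrafilter.eventually_exists_mem_iff (Set.finite_Icc 1 Q)).1 h1
    obtain ⟨y, hy⟩ := h2.choice
    refine ⟨q, hq.1, hq.2, germMk U F y, ?_⟩
    rw [hnat, ← map_pow, ← map_mul, germMk_eq_iff]
    exact hy

/-- Finitely satisfiable comparisons of values are realised in an ultrapower. -/
theorem exists_germ_ringHom {K R : Type*} [Field K] {OK : ValuationSubring K} [CommRing R]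
    (i : F →+* R) (f : R →+* K)
    (hfin : ∀ T : Finset R, ∃ g : R →+* F, g.comp i = RingHom.id F ∧ ∀ P ∈ T, ∀ Q ∈ T,
      OK.valuation (f P) ≤ OK.valuation (f Q) ↔ O.valuation (g P) ≤ O.valuation (g Q)) :
    ∃ (U : Ultrafilter (Finset R)) (g : R →+* Germ (U : Filter (Finset R)) F),
      g.comp i = germDiag U F ∧ ∀ P Q, OK.valuation (f P) ≤ OK.valuation (f Q) ↔
        (germRing U O).valuation (g P) ≤ (germRing U O).valuation (g Q) := by
  classical
  choose g hgi hg using hfin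
  -- Refining the filter of large finite sets ensures that any given pair lies in almost every `T`.
  let U : Ultrafilter (Finset R) := Ultrafilter.of atTop
  have hU : (U : Filter (Finset R)) ≤ atTop := Ultrafilter.of_le _
  refine ⟨U, (germMk U F).comp (RingHom.pi g), ?_, fun P Q => ?_⟩
  · refine RingHom.ext fun a => ?_
    have : (RingHom.pi g) (i a) = fun _ => a := funext fun T => RingHom.congr_fun (hgi T) a
    change germMk U F (RingHom.pi g (i a)) = _
    rw [this]; rfl
  · change _ ↔ (germRing U O).valuation (germMk U F fun T => g T P) ≤
      (germRing U O).valuation (germMk U F fun T => g T Q)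
    rw [germ_val_le_iff]
    have h1 : ∀ᶠ T in (U : Filter (Finset R)), P ∈ T ∧ Q ∈ T := by
      refine hU ?_
      filter_upwards [eventually_ge_atTop {P, Q}] with T hT
      exact ⟨hT (by simp), hT (by simp)⟩
    constructor
    · intro h
      filter_upwards [h1] with T hT
      exact (hg T P hT.1 Q hT.2).1 h
    · intro h
      obtain ⟨T, hT, hT'⟩ := (h1.and h).exists
      exact (hg T P hT.1 Q hT.2).2 hT'

end Ultrapower

end PAdicCells

/-! ### Simple extensions, first case: no new values -/

namespace PAdicCells

open Polynomial Filter

universe u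

section Embedding

variable {p : ℕ} [hp : Fact p.Prime] {F K : Type u} [Field F] [CharZero F] [Field K] [CharZero K]
  [Algebra F K] {OF : ValuationSubring F} {O : ValuationSubring K}

/-- `b` lies in a `p`-adically closed subfield of `K` that embeds over `F` into an ultrapower
of `F`. -/
def EmbedsInUltrapower (p : ℕ) {F K : Type u} [Field F] [Field K] [Algebra F K] (b : K) : Prop :=
  ∃ (L : Type u) (_ : Field L) (_ : CharZero L) (OL : ValuationSubring L) (j : F →+* L)
    (k : L →+* K), IsPClosed p OL ∧ k.comp j = algebraMap F K ∧ b ∈ Set.range k ∧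
    ∃ (ι : Type u) (U : Ultrafilter ι) (φ : L →+* Germ (U : Filter ι) F), φ.comp j = germDiag U F

theorem isAlgebraic_range_self {R K : Type*} [CommRing R] [Field K] (f : R →+* K) (P : R) :
    IsAlgebraic f.range (f P) :=
  isAlgebraic_algebraMap (⟨f P, P, rfl⟩ : f.range)

/-- The elements algebraic over the image of a ring. -/
def algebraicOverRange {R K : Type*} [CommRing R] [Field K] (f : R →+* K) : Subfield K where
  carrier := {x | IsAlgebraic f.range x}
  mul_mem' ha hb := IsAlgebraic.mul ha hb
  one_mem' := by simpa using isAlgebraic_range_self f 1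
  add_mem' ha hb := IsAlgebraic.add ha hb
  zero_mem' := by simpa using isAlgebraic_range_self f 0
  neg_mem' ha := IsAlgebraic.neg ha
  inv_mem' _ ha := IsAlgebraic.inv ha

/-- The common end of both cases. The approximate maps `g` glue to a map from `R` into an
ultrapower. The field `L` is the relative algebraic closure of the image of `f`; by `himm` it is
immediate over the field generated there, so the map extends to it. -/
theorem embedsInUltrapower_of_immediate (hF : IsPClosed p OF) (hK : IsPClosed p O)
    {R : Type u} [CommRing R] (i : F →+* R) (f : R →+* K) (hfi : f.comp i = algebraMap F K)
    (hfin : ∀ T : Finset R, ∃ g : R →+* F, g.comp i = RingHom.id F ∧ ∀ P ∈ T, ∀ Q ∈ T,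
      O.valuation (f P) ≤ O.valuation (f Q) ↔ OF.valuation (g P) ≤ OF.valuation (g Q))
    (himm : ∀ x : K, IsAlgebraic f.range x →
      ∃ P Q, f Q ≠ 0 ∧ O.valuation x = O.valuation (f P / f Q))
    {b : K} (hb : IsAlgebraic f.range b) : EmbedsInUltrapower p (F := F) b := by
  let L := algebraicOverRange f
  have hmem : ∀ x, x ∈ L ↔ IsAlgebraic f.range x := fun x => Iff.rfl
  let fL : R →+* L := f.codRestrict L (isAlgebraic_range_self f)
  let k : L →+* K := L.subtype
  have hcomp : k.comp fL = f := RingHom.ext fun _ => rfl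
  have halg : ∀ x : L, IsAlgebraic fL.range x := fun x => by
    rw [← isAlgebraic_range_comp_iff fL k, hcomp]; exact x.2
  have hL : IsPClosed p (O.comap (algebraMap L K)) := hK.comap_of_isAlgebraic_imp fun x hx => by
    refine ⟨⟨x, (hmem x).2 ?_⟩, rfl⟩
    let : Algebra f.range L := (Subring.inclusion (show f.range ≤ L.toSubring from
      fun y ⟨P, hP⟩ => hP ▸ isAlgebraic_range_self f P)).toAlgebra
    have : IsScalarTower f.range L K := IsScalarTower.of_algebraMap_eq fun _ => rfl
    have : Algebra.IsAlgebraic f.range L := ⟨fun y =>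
      (isAlgebraic_algebraMap_iff (A := K) (algebraMap L K).injective).1 y.2⟩
    exact hx.restrictScalars f.range
  have hval : ∀ x : L, k x ∈ O ↔ x ∈ O.comap (algebraMap L K) := fun x => Iff.rfl
  obtain ⟨U, g, hgi, hg⟩ := exists_germ_ringHom (O := OF) i f hfin
  obtain ⟨φ, hφ⟩ := hL.exists_ringHom_of_immediate (hF.germ (U := U)) fL g
    (fun P Q => (val_map_le_iff hval _ _).symm.trans (hg P Q)) halg fun x => by
      obtain ⟨P, Q, hQ, h1⟩ := himm x ((hmem _).1 x.2)
      refine ⟨P, Q, fun h0 => hQ (congrArg Subtype.val h0), ?_⟩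
      rw [← val_map_eq_iff hval, map_div₀]
      exact h1
  refine ⟨L, inferInstance, inferInstance, O.comap (algebraMap L K), fL.comp i, k, hL, ?_,
    ⟨⟨b, (hmem b).2 hb⟩, rfl⟩, Finset R, U, φ, ?_⟩
  · rw [← RingHom.comp_assoc, hcomp, hfi]
  · rw [← RingHom.comp_assoc, hφ, hgi]

/-! ### Immediate type -/

/-- If `b` has no best approximation in `F`, the values of polynomials at `b` are attained near
`b`. -/
theorem exists_val_eval_eq (hF : IsPClosed p OF) (hK : IsPClosed p O) {b : K}
    (hb : b ∉ Set.range (algebraMap F K))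
    (himm : ∀ d : F, ∃ e : F, O.valuation (b - algebraMap F K d) = O.valuation (algebraMap F K e))
    (Q : F[X]) : ∃ d₀ : F, ∀ d : F,
      O.valuation (b - algebraMap F K d) ≤ O.valuation (b - algebraMap F K d₀) →
      O.valuation (aeval (algebraMap F K d) Q) = O.valuation (aeval b Q) := by
  classical
  let Ω := AlgebraicClosure K
  have : CharZero Ω := charZero_of_injective_algebraMap (algebraMap K Ω).injective
  have : IsGalois K Ω := ⟨⟩
  obtain ⟨W, hW⟩ := exists_valuationSubring_over O (algebraMap K Ω)
  rcases eq_or_ne Q 0 with rfl | hQ0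
  · exact ⟨0, fun d _ => by simp⟩
  -- Since `b - d` has the value of some `e ∈ F`, further residue digits improve the approximation
  -- by any power of `p`.
  have himprove : ∀ (d : F) (s : ℕ), ∃ d' : F, O.valuation (b - algebraMap F K d') <
      O.valuation (p : K) ^ s * O.valuation (b - algebraMap F K d) := by
    intro d s
    obtain ⟨e, he⟩ := himm d
    have hbd : b - algebraMap F K d ≠ 0 := fun h0 => hb ⟨d, (sub_eq_zero.1 h0).symm⟩
    have he0 : algebraMap F K e ≠ 0 := by
      intro h0; rw [h0, map_zero, map_eq_zero] at he; exact hbd he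
    obtain ⟨j, y, hy, hjy⟩ := hK.exists_nat_approx (s + 1) ((b - algebraMap F K d) / algebraMap F K e)
      (by rw [← O.valuation_le_one_iff, map_div₀, he, div_self (by simpa using he0)])
    refine ⟨d + j * e, ?_⟩
    have h1 : b - algebraMap F K (d + j * e) = p ^ (s + 1) * y * algebraMap F K e := by
      rw [div_eq_iff he0] at hjy
      rw [map_add, map_mul, map_natCast]
      linear_combination hjy
    rw [h1, map_mul, map_mul, map_pow, ← he]
    refine mul_lt_mul_of_pos_right ?_ ((Valuation.pos_iff _).2 hbd)
    refine (mul_le_of_le_one_right' ((O.valuation_le_one_iff _).2 hy)).trans_lt ?_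
    exact pow_lt_pow_right_of_lt_one₀ hK.val_p_pos hK.val_p (Nat.lt_succ_self s)
  have hroot : ∀ α : Ω, IsAlgebraic F α → ∃ d : F, W.valuation (algebraMap K Ω
      (b - algebraMap F K d)) < W.valuation (algebraMap K Ω b - α) := by
    intro α hα
    -- Averaging `α` over the automorphisms that fix `K` gives an element of `K` algebraic over `F`,
    -- hence of `F`. It is as close to `b` as `α` up to the value of `m`, and improving it gets
    -- strictly closer.
    let H : Subgroup (Ω ≃ₐ[F] Ω) :=
      { carrier := {g | ∀ x : K, g (algebraMap K Ω x) = algebraMap K Ω x}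
        mul_mem' := fun {g g'} hg hg' x => by rw [AlgEquiv.mul_apply, hg', hg]
        one_mem' := fun x => rfl
        inv_mem' := fun {g} hg x => by
          apply g.injective
          rw [← AlgEquiv.mul_apply, mul_inv_cancel, hg]; rfl }
    obtain ⟨m, d, hm, hdalg, hd, happ⟩ := exists_fixed_approx (W := W) H
      (fun g hg x => hK.val_algEquiv hW (AlgEquiv.ofRingEquiv (f := g.toRingEquiv) hg) x) hα
    obtain ⟨d', rfl⟩ := (InfiniteGalois.mem_range_algebraMap_iff_fixed (k := K) d).2 fun g =>
      hd (g.restrictScalars F) g.commutes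
    obtain ⟨d, rfl⟩ := hF.mem_range_of_isAlgebraic hK
      ((isAlgebraic_algebraMap_iff (algebraMap K Ω).injective).1 hdalg)
    obtain ⟨s, hs⟩ := val_natCast_eq_pow hK.val_p hm.ne'
    obtain ⟨d', hd'⟩ := himprove d s
    refine ⟨d', ?_⟩
    have h1 := happ (algebraMap K Ω b) fun g hg => hg b
    refine lt_of_lt_of_le ?_ h1
    rw [← map_natCast (algebraMap K Ω), ← map_sub (algebraMap K Ω), ← map_mul, ← map_mul,
      val_map_lt_iff hW, map_mul, hs]
    exact hd'
  have hroots : ∀ m : Multiset Ω, (∀ α ∈ m, IsAlgebraic F α) → ∃ d₀ : F, ∀ α ∈ m,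
      W.valuation (algebraMap K Ω (b - algebraMap F K d₀)) < W.valuation (algebraMap K Ω b - α) := by
    intro m
    induction m using Multiset.induction_on with
    | empty => exact fun _ => ⟨0, by simp⟩
    | cons α m ih =>
      intro hm
      obtain ⟨d₁, hd₁⟩ := ih fun β hβ => hm β (Multiset.mem_cons_of_mem hβ)
      obtain ⟨d₂, hd₂⟩ := hroot α (hm α (Multiset.mem_cons_self α m))
      rcases le_total (W.valuation (algebraMap K Ω (b - algebraMap F K d₁)))
        (W.valuation (algebraMap K Ω (b - algebraMap F K d₂))) with hle | hle
      · refine ⟨d₁, fun β hβ => ?_⟩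
        rcases Multiset.mem_cons.1 hβ with rfl | hβ
        · exact hle.trans_lt hd₂
        · exact hd₁ β hβ
      · refine ⟨d₂, fun β hβ => ?_⟩
        rcases Multiset.mem_cons.1 hβ with rfl | hβ
        · exact hd₂
        · exact hle.trans_lt (hd₁ β hβ)
  obtain ⟨d₀, hd₀⟩ := hroots (Q.aroots Ω) fun α hα => ⟨Q, hQ0, (mem_aroots.1 hα).2⟩
  refine ⟨d₀, fun d hd => ?_⟩
  -- Once `d` is closer to `b` than every root `α`, the factors `d - α` and `b - α` have equal
  -- values.
  have hprod : ∀ c : K, algebraMap K Ω (aeval c Q) = algebraMap F Ω Q.leadingCoeff *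
      ((Q.aroots Ω).map fun α => algebraMap K Ω c - α).prod := by
    intro c
    have hs : (Q.map (algebraMap F Ω)).Splits := IsAlgClosed.splits _
    rw [← aeval_algebraMap_apply, ← eval_map_algebraMap, hs.eq_prod_roots, eval_mul, eval_C,
      eval_multiset_prod, Multiset.map_map, leadingCoeff_map]
    simp [aroots]
  rw [← val_map_eq_iff hW, hprod, hprod, map_mul, map_mul, map_multiset_prod, map_multiset_prod,
    Multiset.map_map, Multiset.map_map]
  congr 2
  refine Multiset.map_congr rfl fun α hα => ?_
  have h1 : algebraMap K Ω (algebraMap F K d) - α =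
      (algebraMap K Ω b - α) - algebraMap K Ω (b - algebraMap F K d) := by
    rw [map_sub]; ring
  simp only [Function.comp_apply]
  rw [h1]
  refine Valuation.map_sub_eq_of_lt_left _ (lt_of_le_of_lt ?_ (hd₀ α hα))
  rw [val_map_le_iff hW]
  exact hd

/-- Evaluation at `d` close to `b` reproduces the values of finitely many polynomials at `b`. All
values of elements algebraic over `F[b]` come from `F`, being roots of values from `F`. -/
theorem embedsInUltrapower_of_forall_val_mem (hF : IsPClosed p OF) (hK : IsPClosed p O) {b : K}
    (hb : b ∉ Set.range (algebraMap F K))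
    (himm : ∀ d : F, ∃ e : F, O.valuation (b - algebraMap F K d) = O.valuation (algebraMap F K e)) :
    EmbedsInUltrapower p (F := F) b := by
  have hval : ∀ x : F, algebraMap F K x ∈ O ↔ x ∈ OF := hF.map_mem_iff hK (algebraMap F K)
  have hf : ∀ P : F[X], (aeval b : F[X] →ₐ[F] K).toRingHom P = aeval b P := fun _ => rfl
  refine embedsInUltrapower_of_immediate hF hK (R := F[X]) C (aeval b : F[X] →ₐ[F] K).toRingHom
    (RingHom.ext fun a => by simp) (fun T => ?_) (fun x hx => ?_) (b := b) ?_
  · choose d₀ hd₀ using exists_val_eval_eq hF hK hb himm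
    obtain ⟨d, hd⟩ : ∃ d : F, ∀ Q ∈ T, O.valuation (b - algebraMap F K d) ≤
        O.valuation (b - algebraMap F K (d₀ Q)) := by
      rcases T.eq_empty_or_nonempty with rfl | hT
      · exact ⟨0, by simp⟩
      · obtain ⟨Q, -, hQ⟩ := T.exists_min_image
          (fun Q => O.valuation (b - algebraMap F K (d₀ Q))) hT
        exact ⟨d₀ Q, hQ⟩
    refine ⟨evalRingHom d, RingHom.ext fun a => by simp, fun P hP Q hQ => ?_⟩
    rw [hf, hf, ← hd₀ P d (hd P hP), ← hd₀ Q d (hd Q hQ), ← val_map_le_iff hval,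
      aeval_algebraMap_apply, aeval_algebraMap_apply]
    rfl
  · obtain ⟨n, hn, a, c, hc, hx⟩ := exists_pow_val_eq Subtype.val_injective O hx
    obtain ⟨_, P, rfl⟩ := a
    obtain ⟨_, Q, rfl⟩ := c
    obtain ⟨d₁, hd₁⟩ := exists_val_eval_eq hF hK hb himm P
    obtain ⟨d₂, hd₂⟩ := exists_val_eval_eq hF hK hb himm Q
    have hx' : O.valuation x ^ n = O.valuation (algebraMap F K (P.eval d₁ / Q.eval d₂)) := by
      rw [hx, map_div₀ (algebraMap F K), map_div₀, map_div₀]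
      change O.valuation (aeval b P) / O.valuation (aeval b Q) = _
      rw [← hd₁ d₁ le_rfl, ← hd₂ d₂ le_rfl, aeval_algebraMap_apply, aeval_algebraMap_apply]
      rfl
    obtain ⟨e, he⟩ := hK.exists_val_eq_of_pow hF hn hx'
    exact ⟨C e, 1, by simp, by simp [he]⟩
  · have := isAlgebraic_range_self (aeval b : F[X] →ₐ[F] K).toRingHom X
    simpa using this

end Embedding

end PAdicCells

/-! ### Simple extensions, second case: cuts defined by a new value -/

namespace PAdicCells

open Polynomial Filter

universe u

section NewValue

variable {p : ℕ} [hp : Fact p.Prime] {F K : Type u} [Field F] [CharZero F] [Field K] [CharZero K]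
  [Algebra F K] {OF : ValuationSubring F} {O : ValuationSubring K}

/-- Below a value of `F` the next possible one is its multiple by `p`, which also comes from `F` and
so differs from that of `z`. Hence no power of `p` crosses the cut of `z`, and natural factors are
harmless. -/
theorem IsPClosed.val_lt_mul_pow (hK : IsPClosed p O) {z : K}
    (hz : ∀ a : F, O.valuation z ≠ O.valuation (algebraMap F K a)) {w : F}
    (hlt : O.valuation z < O.valuation (algebraMap F K w)) (i : ℕ) :
    O.valuation z < O.valuation (algebraMap F K (w * p ^ i)) := by
  induction i with
  | zero => simpa using hlt
  | succ i ih =>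
    have hpos : 0 < O.valuation (algebraMap F K (w * p ^ i)) := zero_le.trans_lt ih
    have h1 : O.valuation (z / algebraMap F K (w * p ^ i)) < 1 := by
      rw [map_div₀, div_lt_one₀ hpos]; exact ih
    have h2 := hK.val_le_p h1
    rw [map_div₀, div_le_iff₀ hpos] at h2
    refine lt_of_le_of_ne (h2.trans (le_of_eq ?_)) (hz _)
    rw [← map_mul]; congr 1
    simp only [map_mul, map_pow, map_natCast]; ring

theorem IsPClosed.val_div_p_lt (hK : IsPClosed p O) {z : K}
    (hz : ∀ a : F, O.valuation z ≠ O.valuation (algebraMap F K a)) {w : F}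
    (hlt : O.valuation (algebraMap F K w) < O.valuation z) :
    O.valuation (algebraMap F K (w / p)) < O.valuation z := by
  rcases lt_or_gt_of_ne (hz (w / p)) with h | h
  · have := hK.val_lt_mul_pow hz h 1
    rw [pow_one, div_mul_cancel₀ _ (natCast_p_ne_zero p F)] at this
    exact absurd this (not_lt.2 hlt.le)
  · exact h

/-- Every strict comparison between monomials of different degrees at `z` holds on a neighbourhood
of the cut defined by `z`. -/
theorem exists_threshold (hF : IsPClosed p OF) (hK : IsPClosed p O) {z : K}
    (hz : ∀ a : F, O.valuation z ≠ O.valuation (algebraMap F K a)) {a b : F} {n m : ℕ} (hnm : n ≠ m)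
    (hlt : O.valuation (algebraMap F K a * z ^ n) < O.valuation (algebraMap F K b * z ^ m)) :
    ∃ x : F, x ≠ 0 ∧ ∀ y : F, y ≠ 0 →
      (O.valuation (algebraMap F K x) < O.valuation z →
        O.valuation (algebraMap F K x) ≤ O.valuation (algebraMap F K y)) →
      (O.valuation z < O.valuation (algebraMap F K x) →
        O.valuation (algebraMap F K y) ≤ O.valuation (algebraMap F K x)) →
      O.valuation (algebraMap F K (a * y ^ n)) < O.valuation (algebraMap F K (b * y ^ m)) := by
  have hp0 := natCast_p_ne_zero p F
  have hvp := hK.val_p_pos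
  have hz0 : 0 < O.valuation z := by
    rw [Valuation.pos_iff]; rintro rfl; exact hz 0 (by simp)
  have hb0 : b ≠ 0 := by rintro rfl; simp at hlt
  have hvb : 0 < O.valuation (algebraMap F K b) := (Valuation.pos_iff _).2 (by simpa using hb0)
  rcases eq_or_ne a 0 with rfl | ha0
  · refine ⟨1, one_ne_zero, fun y hy _ _ => ?_⟩
    rw [zero_mul, map_zero, map_zero, Valuation.pos_iff, _root_.map_ne_zero]
    exact mul_ne_zero hb0 (pow_ne_zero _ hy)
  have hva : 0 < O.valuation (algebraMap F K a) := (Valuation.pos_iff _).2 (by simpa using ha0)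
  rcases lt_or_gt_of_ne hnm with hlt' | hlt'
  · obtain ⟨k, rfl⟩ : ∃ k, m = n + k := ⟨m - n, by omega⟩
    have hk : 0 < k := by omega
    have hred : ∀ t : K, t ≠ 0 → (O.valuation (algebraMap F K a * t ^ n) <
        O.valuation (algebraMap F K b * t ^ (n + k)) ↔
        O.valuation (algebraMap F K (a / b)) < O.valuation t ^ k) := by
      intro t ht
      have hvt : 0 < O.valuation t ^ n := pow_pos ((Valuation.pos_iff _).2 ht) _
      rw [map_div₀, map_div₀, div_lt_iff₀ hvb, map_mul, map_mul, map_pow, map_pow, pow_add,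
        ← mul_assoc, mul_right_comm, mul_lt_mul_iff_left₀ hvt, mul_comm (_ ^ k)]
    rw [hred z ((Valuation.pos_iff _).1 hz0)] at hlt
    obtain ⟨Q, hQ⟩ := hF.exists_pow k hk
    -- Up to the natural number `q`, the comparison of `z ^ k` with `a / b` is one of `z` with a
    -- `k`-th root `w`. The shifts of `w` by powers of `p`, here and in the mirror case, absorb `q`
    -- and keep the inequality strict.
    obtain ⟨q, hq, -, w, hw⟩ := hQ (a / b) (div_ne_zero ha0 hb0)
    have hw0 : w ≠ 0 := by
      rintro rfl
      rw [zero_pow hk.ne', mul_zero] at hw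
      exact div_ne_zero ha0 hb0 hw
    have hvw : 0 < O.valuation (algebraMap F K w) := (Valuation.pos_iff _).2 (by simpa using hw0)
    obtain ⟨s, hs⟩ := val_natCast_eq_pow hK.val_p hq.ne'
    have hab : O.valuation (algebraMap F K (a / b)) =
        O.valuation (p : K) ^ s * O.valuation (algebraMap F K w) ^ k := by
      rw [hw, map_mul, map_mul, map_natCast, hs, map_pow, map_pow]
    have hwz : O.valuation (algebraMap F K w) < O.valuation z := by
      rcases lt_or_gt_of_ne (hz w) with h | h
      · exfalso
        have h1 := hK.val_lt_mul_pow hz h s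
        rw [map_mul, map_mul, map_pow, map_natCast, map_pow] at h1
        have h2 := pow_le_pow_left' h1.le k
        rw [mul_pow, ← pow_mul] at h2
        have h3 : O.valuation (p : K) ^ (s * k) ≤ O.valuation (p : K) ^ s :=
          pow_le_pow_of_le_one zero_le hK.val_p.le (Nat.le_mul_of_pos_right s hk)
        rw [hab, mul_comm] at hlt
        exact absurd (hlt.trans_le h2) (not_lt.2 (mul_le_mul_right h3 _))
      · exact h
    refine ⟨w / p, div_ne_zero hw0 hp0, fun y hy h1 _ => ?_⟩
    have h2 := pow_le_pow_left' (h1 (hK.val_div_p_lt hz hwz)) k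
    rw [map_mul (algebraMap F K), map_pow (algebraMap F K), map_mul (algebraMap F K),
      map_pow (algebraMap F K), hred (algebraMap F K y) (by simpa using hy), hab]
    refine lt_of_lt_of_le ?_ h2
    rw [map_div₀, map_div₀, map_natCast (algebraMap F K), div_pow, lt_div_iff₀ (pow_pos hvp _), mul_right_comm,
      ← pow_add]
    refine mul_lt_of_lt_one_left (pow_pos hvw k) ?_
    exact pow_lt_one₀ zero_le hK.val_p (by omega)
  · obtain ⟨k, rfl⟩ : ∃ k, n = m + k := ⟨n - m, by omega⟩
    have hk : 0 < k := by omega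
    have hred : ∀ t : K, t ≠ 0 → (O.valuation (algebraMap F K a * t ^ (m + k)) <
        O.valuation (algebraMap F K b * t ^ m) ↔
        O.valuation t ^ k < O.valuation (algebraMap F K (b / a))) := by
      intro t ht
      have hvt : 0 < O.valuation t ^ m := pow_pos ((Valuation.pos_iff _).2 ht) _
      rw [map_div₀, map_div₀, lt_div_iff₀ hva, map_mul, map_mul, map_pow, map_pow, pow_add,
        ← mul_assoc, mul_right_comm, mul_lt_mul_iff_left₀ hvt, mul_comm (_ ^ k)]
    rw [hred z ((Valuation.pos_iff _).1 hz0)] at hlt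
    obtain ⟨Q, hQ⟩ := hF.exists_pow k hk
    obtain ⟨q, hq, -, w, hw⟩ := hQ (b / a) (div_ne_zero hb0 ha0)
    have hw0 : w ≠ 0 := by
      rintro rfl
      rw [zero_pow hk.ne', mul_zero] at hw
      exact div_ne_zero hb0 ha0 hw
    have hvw : 0 < O.valuation (algebraMap F K w) := (Valuation.pos_iff _).2 (by simpa using hw0)
    obtain ⟨s, hs⟩ := val_natCast_eq_pow hK.val_p hq.ne'
    have hab : O.valuation (algebraMap F K (b / a)) =
        O.valuation (p : K) ^ s * O.valuation (algebraMap F K w) ^ k := by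
      rw [hw, map_mul, map_mul, map_natCast, hs, map_pow, map_pow]
    have hwz : O.valuation z < O.valuation (algebraMap F K w) := by
      refine lt_of_pow_lt_pow_left₀ k zero_le (hlt.trans_le ?_)
      rw [hab]
      exact mul_le_of_le_one_left' (pow_le_one' hK.val_p.le _)
    refine ⟨w * p ^ (s + 1), mul_ne_zero hw0 (pow_ne_zero _ hp0), fun y hy _ h1 => ?_⟩
    have h2 := pow_le_pow_left' (h1 (hK.val_lt_mul_pow hz hwz (s + 1))) k
    rw [map_mul (algebraMap F K), map_pow (algebraMap F K), map_mul (algebraMap F K),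
      map_pow (algebraMap F K), hred (algebraMap F K y) (by simpa using hy), hab]
    refine lt_of_le_of_lt h2 ?_
    rw [map_mul, map_mul, map_pow, map_natCast, map_pow, mul_pow, mul_comm, ← pow_mul]
    refine mul_lt_mul_of_pos_right ?_ (pow_pos hvw k)
    exact pow_lt_pow_right_of_lt_one₀ hvp hK.val_p (by nlinarith)

/-- The cut defined by `z` is approximated by elements of `F`. -/
theorem exists_mem_cut (hF : IsPClosed p OF) (hK : IsPClosed p O) {z : K}
    (hz : ∀ a : F, O.valuation z ≠ O.valuation (algebraMap F K a)) (S : Finset (F × ℕ)) :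
    ∃ y : F, y ≠ 0 ∧ ∀ c ∈ S, ∀ d ∈ S, c.2 ≠ d.2 →
      O.valuation (algebraMap F K c.1 * z ^ c.2) < O.valuation (algebraMap F K d.1 * z ^ d.2) →
      O.valuation (algebraMap F K (c.1 * y ^ c.2)) <
        O.valuation (algebraMap F K (d.1 * y ^ d.2)) := by
  classical
  have hchoice : ∀ c : (F × ℕ) × (F × ℕ), ∃ x : F, x ≠ 0 ∧ (c.1.2 ≠ c.2.2 →
      O.valuation (algebraMap F K c.1.1 * z ^ c.1.2) <
        O.valuation (algebraMap F K c.2.1 * z ^ c.2.2) → ∀ y : F, y ≠ 0 →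
      (O.valuation (algebraMap F K x) < O.valuation z →
        O.valuation (algebraMap F K x) ≤ O.valuation (algebraMap F K y)) →
      (O.valuation z < O.valuation (algebraMap F K x) →
        O.valuation (algebraMap F K y) ≤ O.valuation (algebraMap F K x)) →
      O.valuation (algebraMap F K (c.1.1 * y ^ c.1.2)) <
        O.valuation (algebraMap F K (c.2.1 * y ^ c.2.2))) := by
    intro c
    by_cases h : c.1.2 ≠ c.2.2 ∧ O.valuation (algebraMap F K c.1.1 * z ^ c.1.2) <
        O.valuation (algebraMap F K c.2.1 * z ^ c.2.2)
    · obtain ⟨x, hx, hx'⟩ := exists_threshold hF hK hz h.1 h.2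
      exact ⟨x, hx, fun _ _ => hx'⟩
    · exact ⟨1, one_ne_zero, fun h1 h2 => absurd ⟨h1, h2⟩ h⟩
  choose x hx hxc using hchoice
  let X : Finset F := insert 1 ((S ×ˢ S).image x)
  have hX0 : ∀ t ∈ X, t ≠ 0 := fun t ht => by
    rcases Finset.mem_insert.1 ht with rfl | ht
    · exact one_ne_zero
    · obtain ⟨c, -, rfl⟩ := Finset.mem_image.1 ht
      exact hx c
  obtain ⟨y, hy0, hy⟩ : ∃ y : F, y ≠ 0 ∧ ∀ t ∈ X,
      (O.valuation (algebraMap F K t) < O.valuation z →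
        O.valuation (algebraMap F K t) ≤ O.valuation (algebraMap F K y)) ∧
      (O.valuation z < O.valuation (algebraMap F K t) →
        O.valuation (algebraMap F K y) ≤ O.valuation (algebraMap F K t)) := by
    -- Take for `y` the largest threshold below `z`, or the smallest threshold if none lies below.
    -- The element `1` only keeps `X` nonempty.
    let X₁ := X.filter fun t => O.valuation (algebraMap F K t) < O.valuation z
    rcases X₁.eq_empty_or_nonempty with h | h
    · obtain ⟨y, hyX, hy⟩ := X.exists_min_image (fun t => O.valuation (algebraMap F K t))
        ⟨1, Finset.mem_insert_self _ _⟩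
      refine ⟨y, hX0 y hyX, fun t ht => ⟨fun hlt => ?_, fun _ => hy t ht⟩⟩
      have : t ∈ X₁ := Finset.mem_filter.2 ⟨ht, hlt⟩
      rw [h] at this
      exact absurd this (Finset.notMem_empty t)
    · obtain ⟨y, hyX, hy⟩ := X₁.exists_max_image (fun t => O.valuation (algebraMap F K t)) h
      obtain ⟨hyX, hyz⟩ := Finset.mem_filter.1 hyX
      exact ⟨y, hX0 y hyX, fun t ht => ⟨fun hlt => hy t (Finset.mem_filter.2 ⟨ht, hlt⟩),
        fun hlt => (hyz.trans hlt).le⟩⟩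
  refine ⟨y, hy0, fun c hc d hd hne hlt => ?_⟩
  have hmem : x (c, d) ∈ X :=
    Finset.mem_insert_of_mem (Finset.mem_image_of_mem x (Finset.mk_mem_product hc hd))
  exact hxc (c, d) hne hlt y hy0 (hy _ hmem).1 (hy _ hmem).2

theorem val_aeval_eq_of_dominant {z : K} {P : F[X]} {n : ℕ} (hn : n ∈ P.support)
    (h : ∀ j ∈ P.support, j ≠ n → O.valuation (algebraMap F K (P.coeff j) * z ^ j) <
      O.valuation (algebraMap F K (P.coeff n) * z ^ n)) (hz : z ≠ 0) :
    O.valuation (aeval z P) = O.valuation (algebraMap F K (P.coeff n) * z ^ n) := by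
  have hn0 : algebraMap F K (P.coeff n) * z ^ n ≠ 0 :=
    mul_ne_zero (by simpa using hn) (pow_ne_zero _ hz)
  rw [aeval_def, eval₂_eq_sum, Polynomial.sum_def, ← Finset.add_sum_erase _ _ hn]
  refine Valuation.map_add_eq_of_lt_left _ ?_
  refine Valuation.map_sum_lt _ (by simpa using hn0) fun j hj => ?_
  obtain ⟨hjn, hj⟩ := Finset.mem_erase.1 hj
  exact h j hj hjn

/-- Two monomials of equal value would put a power of the value of `z`, hence that value itself,
among the values of `F`. -/
theorem exists_dominant (hF : IsPClosed p OF) (hK : IsPClosed p O) {z : K}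
    (hz : ∀ a : F, O.valuation z ≠ O.valuation (algebraMap F K a)) {P : F[X]} (hP : P ≠ 0) :
    ∃ n ∈ P.support, ∀ j ∈ P.support, j ≠ n →
      O.valuation (algebraMap F K (P.coeff j) * z ^ j) <
        O.valuation (algebraMap F K (P.coeff n) * z ^ n) := by
  have hz0 : O.valuation z ≠ 0 := by
    intro h; exact hz 0 (by simpa using h)
  obtain ⟨n, hn, hmax⟩ := P.support.exists_max_image
    (fun j => O.valuation (algebraMap F K (P.coeff j) * z ^ j)) (support_nonempty.2 hP)
  have hne : ∀ i j, i < j → i ∈ P.support → j ∈ P.support →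
      O.valuation (algebraMap F K (P.coeff j) * z ^ j) ≠
        O.valuation (algebraMap F K (P.coeff i) * z ^ i) := by
    intro i j hij hi hj h
    have hj0 : O.valuation (algebraMap F K (P.coeff j)) ≠ 0 := by simpa using hj
    obtain ⟨k, rfl⟩ : ∃ k, j = i + k := ⟨j - i, by omega⟩
    have h1 : O.valuation z ^ k = O.valuation (algebraMap F K (P.coeff i / P.coeff (i + k))) := by
      rw [map_div₀, map_div₀, eq_div_iff hj0]
      refine mul_right_cancel₀ (pow_ne_zero i hz0) ?_
      rw [map_mul, map_mul, map_pow, map_pow, pow_add] at h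
      rw [← h, mul_comm (_ ^ k), mul_assoc, mul_comm (_ ^ k)]
    obtain ⟨b, hb⟩ := hK.exists_val_eq_of_pow hF (by omega) h1
    exact hz b hb
  refine ⟨n, hn, fun j hj hjn => lt_of_le_of_ne (hmax j hj) ?_⟩
  rcases lt_or_gt_of_ne hjn with h | h
  · exact (hne j n h hj hn).symm
  · exact hne n j h hn hj

/-- A polynomial at `z` has the value of its dominant monomial. An element `y` in the same cut
preserves both the dominance and the comparisons between dominant monomials. -/
theorem exists_eval_val_le_iff (hF : IsPClosed p OF) (hK : IsPClosed p O) {z : K}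
    (hz : ∀ a : F, O.valuation z ≠ O.valuation (algebraMap F K a)) (T : Finset F[X]) :
    ∃ y : F, ∀ P ∈ T, ∀ Q ∈ T, O.valuation (aeval z P) ≤ O.valuation (aeval z Q) ↔
      OF.valuation (P.eval y) ≤ OF.valuation (Q.eval y) := by
  classical
  have hval : ∀ x : F, algebraMap F K x ∈ O ↔ x ∈ OF := hF.map_mem_iff hK (algebraMap F K)
  have hz0 : z ≠ 0 := by rintro rfl; exact hz 0 (by simp)
  let S : Finset (F × ℕ) := T.biUnion fun P => P.support.image fun j => (P.coeff j, j)
  have hS : ∀ P ∈ T, ∀ j ∈ P.support, (P.coeff j, j) ∈ S := fun P hP j hj =>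
    Finset.mem_biUnion.2 ⟨P, hP, Finset.mem_image_of_mem _ hj⟩
  obtain ⟨y, hy0, hy⟩ := exists_mem_cut hF hK hz S
  have hy0' : algebraMap F K y ≠ 0 := by simpa using hy0
  refine ⟨y, fun P hP Q hQ => ?_⟩
  rw [← val_map_le_iff hval, ← coe_aeval_eq_eval, ← aeval_algebraMap_apply,
    ← aeval_algebraMap_apply]
  have hdom : ∀ P ∈ T, P ≠ 0 → ∃ n ∈ P.support,
      O.valuation (aeval z P) = O.valuation (algebraMap F K (P.coeff n) * z ^ n) ∧
      O.valuation (aeval (algebraMap F K y) P) =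
        O.valuation (algebraMap F K (P.coeff n) * algebraMap F K y ^ n) := by
    intro P hP hP0
    obtain ⟨n, hn, hdom⟩ := exists_dominant hF hK hz hP0
    refine ⟨n, hn, val_aeval_eq_of_dominant hn hdom hz0,
      val_aeval_eq_of_dominant hn (fun j hj hjn => ?_) hy0'⟩
    have := hy _ (hS P hP j hj) _ (hS P hP n hn) hjn (hdom j hj hjn)
    simpa using this
  rcases eq_or_ne P 0 with rfl | hP0
  · simp
  obtain ⟨n, hn, hPz, hPy⟩ := hdom P hP hP0
  have hn0 : P.coeff n ≠ 0 := mem_support_iff.1 hn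
  rcases eq_or_ne Q 0 with rfl | hQ0
  · have h1 : algebraMap F K (P.coeff n) * z ^ n ≠ 0 :=
      mul_ne_zero (by simpa using hn0) (pow_ne_zero _ hz0)
    have h2 : algebraMap F K (P.coeff n) * algebraMap F K y ^ n ≠ 0 :=
      mul_ne_zero (by simpa using hn0) (pow_ne_zero _ hy0')
    rw [hPz, hPy]
    simp only [map_zero, le_zero_iff, map_eq_zero, h1, h2]
  obtain ⟨m, hm, hQz, hQy⟩ := hdom Q hQ hQ0
  rw [hPz, hPy, hQz, hQy]
  rcases eq_or_ne n m with rfl | hnm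
  · have h1 : 0 < O.valuation (z ^ n) := (Valuation.pos_iff _).2 (pow_ne_zero _ hz0)
    have h2 : 0 < O.valuation (algebraMap F K y ^ n) := (Valuation.pos_iff _).2 (pow_ne_zero _ hy0')
    rw [map_mul, map_mul, map_mul, map_mul, mul_le_mul_iff_left₀ h1, mul_le_mul_iff_left₀ h2]
  have hne : O.valuation (algebraMap F K (P.coeff n) * z ^ n) ≠
      O.valuation (algebraMap F K (Q.coeff m) * z ^ m) := by
    intro h
    -- Applied to a binomial, strict dominance shows that monomials of different degrees have
    -- different values.
    obtain ⟨t, ht, hdt⟩ := exists_dominant hF hK hz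
      (P := monomial n (P.coeff n) + monomial m (Q.coeff m)) (by
        intro h0
        have := congrArg (fun R => coeff R n) h0
        simp [coeff_monomial, hnm.symm, hn0] at this)
    have hm0 : Q.coeff m ≠ 0 := mem_support_iff.1 hm
    have hcn : (monomial n (P.coeff n) + monomial m (Q.coeff m)).coeff n = P.coeff n := by
      simp [coeff_monomial, hnm.symm]
    have hcm : (monomial n (P.coeff n) + monomial m (Q.coeff m)).coeff m = Q.coeff m := by
      simp [coeff_monomial, hnm]
    have hns := mem_support_iff.2 (hcn.symm ▸ hn0)
    have hms := mem_support_iff.2 (hcm.symm ▸ hm0)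
    have ht' : t = n ∨ t = m := by
      by_contra hcon
      push Not at hcon
      rw [mem_support_iff] at ht
      apply ht
      simp [coeff_monomial, hcon.1.symm, hcon.2.symm]
    rcases ht' with rfl | rfl
    · have := hdt m hms hnm.symm
      rw [hcn, hcm] at this
      exact this.ne h.symm
    · have := hdt n hns hnm
      rw [hcn, hcm] at this
      exact this.ne h
  rcases lt_or_gt_of_ne hne with h | h
  · have h1 := hy _ (hS P hP n hn) _ (hS Q hQ m hm) hnm h
    simp only [map_mul, map_pow] at h1 h ⊢
    exact ⟨fun _ => h1.le, fun _ => h.le⟩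
  · have h1 := hy _ (hS Q hQ m hm) _ (hS P hP n hn) hnm.symm h
    simp only [map_mul, map_pow] at h1 h ⊢
    exact ⟨fun h' => absurd h' (not_le.2 h), fun h' => absurd h' (not_le.2 h1)⟩

end NewValue

end PAdicCells

/-! ### Root sequences and the embedding for a new value -/

namespace PAdicCells

open Polynomial Filter

universe u

section RootSequence

variable {p : ℕ} [hp : Fact p.Prime] {F K : Type u} [Field F] [CharZero F] [Field K] [CharZero K]
  [Algebra F K] {OF : ValuationSubring F} {O : ValuationSubring K}

/-- Up to natural numbers, any element has a compatible sequence of roots. -/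
theorem IsPClosed.exists_rootSeq (hK : IsPClosed p O) {z₀ : K} (hz₀ : z₀ ≠ 0) :
    ∃ (z : ℕ → K) (q : ℕ → ℕ), z 0 = z₀ ∧ ∀ m, q m ≠ 0 ∧ z m = q m * z (m + 1) ^ (m + 1) := by
  have hstep : ∀ (m : ℕ) (x : {x : K // x ≠ 0}), ∃ (q : ℕ) (y : {x : K // x ≠ 0}),
      q ≠ 0 ∧ x.1 = q * y.1 ^ (m + 1) := by
    intro m x
    obtain ⟨Q, hQ⟩ := hK.exists_pow (m + 1) m.succ_pos
    obtain ⟨q, hq, -, y, hy⟩ := hQ x.1 x.2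
    refine ⟨q, ⟨y, ?_⟩, hq.ne', hy⟩
    rintro rfl
    exact x.2 (by rw [hy, zero_pow m.succ_ne_zero, mul_zero])
  choose q y hq hy using hstep
  let s : ℕ → {x : K // x ≠ 0} := fun m => Nat.rec ⟨z₀, hz₀⟩ y m
  exact ⟨fun m => (s m).1, fun m => q m (s m), rfl, fun m => ⟨hq m (s m), hy m (s m)⟩⟩

/-- Each earlier term is a natural multiple of a power of each later one. The divisibility of the
exponent lets any prescribed root be extracted by going far enough; it fails for `i = m`, where the
exponent is `1`. -/
theorem exists_eq_mul_pow_of_rootSeq {z : ℕ → K} {q : ℕ → ℕ}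
    (hz : ∀ m, q m ≠ 0 ∧ z m = q m * z (m + 1) ^ (m + 1)) {i m : ℕ} (him : i ≤ m) :
    ∃ c e : ℕ, c ≠ 0 ∧ z i = c * z m ^ e ∧ (i < m → m ∣ e) := by
  induction m, him using Nat.le_induction with
  | base => exact ⟨1, 1, one_ne_zero, by simp, fun h => absurd h (lt_irrefl i)⟩
  | succ m _ ih =>
    obtain ⟨c, e, hc, h, -⟩ := ih
    refine ⟨c * q m ^ e, (m + 1) * e, mul_ne_zero hc (pow_ne_zero _ (hz m).1), ?_,
      fun _ => dvd_mul_right _ _⟩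
    rw [h, (hz m).2]; push_cast; ring

theorem val_ne_of_rootSeq {z : ℕ → K} {q : ℕ → ℕ}
    (hz : ∀ m, q m ≠ 0 ∧ z m = q m * z (m + 1) ^ (m + 1))
    (h0 : ∀ a : F, O.valuation (z 0) ≠ O.valuation (algebraMap F K a)) (m : ℕ) (a : F) :
    O.valuation (z m) ≠ O.valuation (algebraMap F K a) := by
  intro h
  obtain ⟨c, e, -, h1, -⟩ := exists_eq_mul_pow_of_rootSeq hz m.zero_le
  exact h0 (c * a ^ e) (by rw [h1]; simp [h])

/-- Finitely many polynomials in the terms of a root sequence are polynomials in one term. -/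
theorem exists_reduce_of_rootSeq {z : ℕ → K} {q : ℕ → ℕ}
    (hz : ∀ m, q m ≠ 0 ∧ z m = q m * z (m + 1) ^ (m + 1)) (T : Finset (MvPolynomial ℕ F)) :
    ∃ (m : ℕ) (σ : MvPolynomial ℕ F →+* F[X]), σ.comp MvPolynomial.C = C ∧
      ∀ P ∈ T, MvPolynomial.aeval z P = aeval (z m) (σ P) := by
  classical
  obtain ⟨m, hm⟩ : ∃ m, ∀ P ∈ T, ∀ i ∈ P.vars, i ≤ m :=
    ⟨(T.biUnion MvPolynomial.vars).sup id, fun P hP i hi =>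
      Finset.le_sup (f := id) (Finset.mem_biUnion.2 ⟨P, hP, hi⟩)⟩
  have hchoice : ∀ i, ∃ R : F[X], i ≤ m → z i = aeval (z m) R := by
    intro i
    by_cases him : i ≤ m
    · obtain ⟨c, e, -, h, -⟩ := exists_eq_mul_pow_of_rootSeq hz him
      exact ⟨(c : F[X]) * X ^ e, fun _ => by simpa using h⟩
    · exact ⟨0, fun h => absurd h him⟩
  choose R hR using hchoice
  refine ⟨m, MvPolynomial.eval₂Hom C R, RingHom.ext fun a => by simp, fun P hP => ?_⟩
  have h1 : aeval (z m) (MvPolynomial.eval₂Hom C R P) =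
      MvPolynomial.eval₂Hom (algebraMap F K) (fun i => aeval (z m) (R i)) P := by
    have : ((aeval (z m) : F[X] →ₐ[F] K) : F[X] →+* K).comp (MvPolynomial.eval₂Hom C R) =
        MvPolynomial.eval₂Hom (algebraMap F K) (fun i => aeval (z m) (R i)) := by
      refine MvPolynomial.ringHom_ext (fun a => by simp) fun i => by simp
    exact congrArg (fun φ => φ P) this
  rw [h1]
  exact MvPolynomial.eval₂Hom_congr' rfl (fun i hi _ => hR i (hm P hP i hi)) rfl

end RootSequence

section NewValue

variable {p : ℕ} [hp : Fact p.Prime] {F K : Type u} [Field F] [CharZero F] [Field K] [CharZero K]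
  [Algebra F K] {OF : ValuationSubring F} {O : ValuationSubring K}

/-- With `z = b - d` alone, its algebraic closure in `K` would acquire new values such as those of
roots of `z`. Adjoining a whole root sequence supplies them in advance; finitely many polynomials
still involve only one term of the sequence. -/
theorem embedsInUltrapower_of_val_notMem (hF : IsPClosed p OF) (hK : IsPClosed p O) {b : K} {d : F}
    (hd : ∀ a : F, O.valuation (b - algebraMap F K d) ≠ O.valuation (algebraMap F K a)) :
    EmbedsInUltrapower p (F := F) b := by
  classical
  obtain ⟨z, q, hz0, hz⟩ := hK.exists_rootSeq (z₀ := b - algebraMap F K d) (fun h =>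
    hd 0 (by rw [h]; simp))
  rw [← hz0] at hd
  have hzm := val_ne_of_rootSeq hz hd
  have hzne : ∀ m, z m ≠ 0 := fun m h => hzm m 0 (by rw [h]; simp)
  have hf : ∀ P, (MvPolynomial.aeval z : MvPolynomial ℕ F →ₐ[F] K).toRingHom P =
    MvPolynomial.aeval z P := fun _ => rfl
  refine embedsInUltrapower_of_immediate hF hK (R := MvPolynomial ℕ F) MvPolynomial.C
    (MvPolynomial.aeval z : MvPolynomial ℕ F →ₐ[F] K).toRingHom
    (RingHom.ext fun a => by simp) (fun T => ?_) (fun x hx => ?_) (b := b) ?_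
  · obtain ⟨m, σ, hσ, hm⟩ := exists_reduce_of_rootSeq hz T
    obtain ⟨y, hy⟩ := exists_eval_val_le_iff hF hK (hzm m) (T.image σ)
    refine ⟨(evalRingHom y).comp σ, ?_, fun P hP Q hQ => ?_⟩
    · rw [RingHom.comp_assoc, hσ]
      exact RingHom.ext fun a => by simp
    · rw [hf, hf, hm P hP, hm Q hQ]
      exact hy _ (Finset.mem_image_of_mem σ hP) _ (Finset.mem_image_of_mem σ hQ)
  · rcases eq_or_ne x 0 with rfl | hx0
    · exact ⟨0, 1, by simp, by simp⟩
    obtain ⟨n, hn, a, c, hc, hx⟩ := exists_pow_val_eq Subtype.val_injective O hx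
    obtain ⟨_, P, rfl⟩ := a
    obtain ⟨_, Q, rfl⟩ := c
    change MvPolynomial.aeval z Q ≠ 0 at hc
    change O.valuation x ^ n = O.valuation (MvPolynomial.aeval z P / MvPolynomial.aeval z Q) at hx
    have hP : MvPolynomial.aeval z P ≠ 0 := by
      intro h
      rw [h, zero_div, map_zero] at hx
      exact hx0 ((map_eq_zero _).1 (pow_eq_zero_iff hn.ne' |>.1 hx))
    obtain ⟨m, σ, -, hm⟩ := exists_reduce_of_rootSeq hz {P, Q}
    have hdom : ∀ R ∈ ({P, Q} : Finset (MvPolynomial ℕ F)), MvPolynomial.aeval z R ≠ 0 →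
        ∃ (a : F) (j : ℕ), a ≠ 0 ∧
          O.valuation (MvPolynomial.aeval z R) = O.valuation (algebraMap F K a * z m ^ j) := by
      intro R hR hR0
      have hσR : σ R ≠ 0 := by
        intro h; rw [hm R hR, h, map_zero] at hR0; exact hR0 rfl
      obtain ⟨j, hj, hdom⟩ := exists_dominant hF hK (hzm m) hσR
      refine ⟨(σ R).coeff j, j, mem_support_iff.1 hj, ?_⟩
      rw [hm R hR, val_aeval_eq_of_dominant hj hdom (hzne m)]
    obtain ⟨a₁, j₁, ha₁, h₁⟩ := hdom P (by simp) hP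
    obtain ⟨a₂, j₂, ha₂, h₂⟩ := hdom Q (by simp) hc
    -- The index `(m + 1) * n` exceeds `m` and makes the exponent a multiple `n * l`. So `z m` is up
    -- to a natural factor an `n`-th power, and dividing `x` by suitable powers of `w` leaves an
    -- element whose `n`-th power has a value from `F`.
    obtain ⟨c, e, hc0, hce, hdvd⟩ := exists_eq_mul_pow_of_rootSeq hz
      (show m ≤ (m + 1) * n from m.le_succ.trans (Nat.le_mul_of_pos_right _ hn))
    obtain ⟨l, rfl⟩ := (dvd_mul_left n (m + 1)).trans
      (hdvd (m.lt_succ_self.trans_le (Nat.le_mul_of_pos_right _ hn)))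
    set w := z ((m + 1) * n) with hw
    have hw0 : w ≠ 0 := hzne _
    have hc0' : (c : K) ≠ 0 := Nat.cast_ne_zero.2 hc0
    have ha₂' : algebraMap F K a₂ ≠ 0 := by simpa using ha₂
    have key : O.valuation (x * w ^ (l * j₂) / w ^ (l * j₁)) ^ n =
        O.valuation (algebraMap F K (a₁ * c ^ j₁ / (a₂ * c ^ j₂))) := by
      rw [← map_pow, div_pow, mul_pow, map_div₀, map_mul, map_pow, hx, map_div₀, h₁, h₂,
        ← map_div₀, ← map_mul, ← map_div₀, hce]
      congr 1
      simp only [map_div₀, map_mul, map_pow, map_natCast]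
      field_simp
      ring
    obtain ⟨b', hb'⟩ := hK.exists_val_eq_of_pow hF hn key
    refine ⟨MvPolynomial.C b' * MvPolynomial.X ((m + 1) * n) ^ (l * j₁),
      MvPolynomial.X ((m + 1) * n) ^ (l * j₂), ?_, ?_⟩
    · rw [hf]; simpa using fun h => absurd h (hzne _)
    · rw [hf, hf]
      simp only [map_mul, map_pow, MvPolynomial.aeval_X, MvPolynomial.aeval_C, ← hw, map_div₀] at hb' ⊢
      have hvw : O.valuation w ≠ 0 := by simpa using hw0
      rw [← hb']
      field_simp
  · have h1 := isAlgebraic_range_self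
      (MvPolynomial.aeval z : MvPolynomial ℕ F →ₐ[F] K).toRingHom
      (MvPolynomial.X 0 + MvPolynomial.C d)
    rw [hf] at h1
    simpa [hz0] using h1

theorem embedsInUltrapower_of_notMem_range (hF : IsPClosed p OF) (hK : IsPClosed p O) {b : K}
    (hb : b ∉ Set.range (algebraMap F K)) : EmbedsInUltrapower p (F := F) b := by
  by_cases h : ∀ d : F, ∃ e : F,
      O.valuation (b - algebraMap F K d) = O.valuation (algebraMap F K e)
  · exact embedsInUltrapower_of_forall_val_mem hF hK hb h
  · push Not at h
    obtain ⟨d, hd⟩ := h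
    exact embedsInUltrapower_of_val_notMem hF hK hd

end NewValue

end PAdicCells

/-! ### Model completeness -/

namespace PAdicCells

open FirstOrder

universe u

/-- **Model completeness**: embeddings between `p`-adically closed fields are elementary. -/
theorem IsPClosed.holds_map_iff {p : ℕ} [Fact p.Prime] {α : Type*} {n : ℕ}
    (φ : Ldiv.BoundedFormula α n) :
    ∀ {F K : Type u} [Field F] [CharZero F] [Field K] [CharZero K] {OF : ValuationSubring F}
      {OK : ValuationSubring K}, IsPClosed p OF → IsPClosed p OK → ∀ (ι : F →+* K) (x : α → F)
      (y : Fin n → F), Holds OK φ (ι ∘ x) (ι ∘ y) ↔ Holds OF φ x y := by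
  have helim : ∀ {F K : Type u} [Field F] [Field K] {n : ℕ} (ι : F →+* K) (x : α → F)
      (y : Fin n → F), Sum.elim (ι ∘ x) (ι ∘ y) = ι ∘ Sum.elim x y := fun ι x y =>
    (Sum.comp_elim ι x y).symm
  have hsnoc : ∀ {F K : Type u} [Field F] [Field K] {n : ℕ} (ι : F →+* K) (y : Fin n → F) (b : F),
      (Fin.snoc (ι ∘ y) (ι b) : Fin (n + 1) → K) = ι ∘ (Fin.snoc y b : Fin (n + 1) → F) :=
    fun ι y b => (Fin.comp_snoc ι y b).symm
  induction φ with
  | falsum => intros; exact Iff.rfl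
  | equal t u =>
    intro F K _ _ _ _ OF OK hF hK ι x y
    rw [holds_equal, holds_equal, helim, ← map_termVal OF OK, ← map_termVal OF OK,
      ι.injective.eq_iff]
  | rel R ts =>
    intro F K _ _ _ _ OF OK hF hK ι x y
    cases R
    rw [holds_rel, holds_rel, helim, ← map_termVal OF OK, ← map_termVal OF OK,
      val_map_le_iff (hF.map_mem_iff hK ι)]
  | imp φ ψ ih₁ ih₂ =>
    intro F K _ _ _ _ OF OK hF hK ι x y
    rw [holds_imp, holds_imp, ih₁ hF hK, ih₂ hF hK]
  | all φ ih =>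
    intro F K _ _ _ _ OF OK hF hK ι x y
    rw [holds_all]
    refine ⟨fun h b => ?_, fun h b => ?_⟩
    · have h1 := h (ι b)
      rwa [hsnoc, ih hF hK] at h1
    · let _ : Algebra F K := ι.toAlgebra
      by_cases hb : b ∈ Set.range (algebraMap F K)
      · obtain ⟨b, rfl⟩ := hb
        change Holds OK φ (ι ∘ x) (Fin.snoc (ι ∘ y) (ι b))
        rw [hsnoc, ih hF hK]
        exact h b
      -- The universal statement passes from `F` to the ultrapower by Łoś's theorem. Its instance at
      -- `ψ b` descends to `L` and then ascends to `K`, by the induction hypothesis for the two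
      -- embeddings of `L`.
      · obtain ⟨L, _, _, OL, j, k, hL, hkj, ⟨b, rfl⟩, I, U, ψ, hψ⟩ :=
          embedsInUltrapower_of_notMem_range hF hK hb
        have hkj' : ι = k.comp j := hkj.symm
        have h1 : Holds (germRing U OF) φ.all (ψ ∘ j ∘ x) (ψ ∘ j ∘ y) := by
          have h2 := (germDiag_holds_iff (U := U) (O := OF) φ.all x y).2 h
          rwa [← hψ] at h2
        have h2 := h1 (ψ b)
        change Holds (germRing U OF) φ _ _ at h2
        rw [hsnoc, ih hL (hF.germ (U := U)), ← ih hL hK k, ← hsnoc] at h2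
        rw [hkj']
        exact h2

end PAdicCells

/-! ### The additive formulation satisfies the axioms -/

namespace PAdicCells

open Polynomial FirstOrder

section ValuationRing

variable {K Γ : Type*} [Field K] [AddCommGroup Γ] [LinearOrder Γ] [IsOrderedAddMonoid Γ]
  (v : AddValuation K (WithTop Γ))

theorem mem_valuationRing_iff (x : K) : x ∈ valuationRing v ↔ 0 ≤ v x := Iff.rfl

theorem addVal_div_add {x y : K} (hy : y ≠ 0) : v (x / y) + v y = v x := by
  rw [← v.map_mul, div_mul_cancel₀ _ hy]

theorem valuationRing_val_le_iff (x y : K) :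
    (valuationRing v).valuation x ≤ (valuationRing v).valuation y ↔ v y ≤ v x := by
  rcases eq_or_ne y 0 with rfl | hy
  · rw [map_zero, le_zero_iff, map_eq_zero, v.map_zero, top_le_iff, v.top_iff]
  · have h2 : 0 < (valuationRing v).valuation y := (Valuation.pos_iff _).2 hy
    rw [← div_le_one₀ h2, ← map_div₀, ValuationSubring.valuation_le_one_iff,
      mem_valuationRing_iff, ← addVal_div_add v hy (x := x)]
    have hvy : v y ≠ ⊤ := by simpa [v.top_iff] using hy
    lift v y to Γ using hvy with γ
    rcases eq_or_ne (v (x / y)) ⊤ with h | h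
    · simp [h]
    · lift v (x / y) to Γ using h with δ
      norm_cast
      simp

theorem valuationRing_val_lt_iff (x y : K) :
    (valuationRing v).valuation x < (valuationRing v).valuation y ↔ v y < v x := by
  rw [← not_le, valuationRing_val_le_iff, not_le]

theorem valuedFieldStructure_eq : valuedFieldStructure v = divStructure (valuationRing v) := by
  have h : @Language.Structure.RelMap Ldiv K (valuedFieldStructure v) =
      @Language.Structure.RelMap Ldiv K (divStructure (valuationRing v)) := by
    funext n r x
    cases r
    exact propext (valuationRing_val_le_iff v (x 1) (x 0)).symm
  exact congrArg (@Language.Structure.mk Ldiv K (valuedFieldStructure v).funMap) h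

end ValuationRing

section PAdicallyClosed

variable {p : ℕ} [hp : Fact p.Prime] {K Γ : Type*} [Field K] [CharZero K] [AddCommGroup Γ]
  [LinearOrder Γ] [IsOrderedAddMonoid Γ] {v : AddValuation K (WithTop Γ)}

theorem IsFormallyPAdic.exists_addVal_p (h : IsFormallyPAdic p v) :
    ∃ u : Γ, 0 < u ∧ v (p : K) = (u : WithTop Γ) := by
  obtain ⟨u, hu, h1⟩ := h.extends_padic
  refine ⟨u, hu, ?_⟩
  have := h1 p (Nat.cast_ne_zero.2 hp.out.ne_zero)
  rwa [padicValRat.self hp.out.one_lt, one_smul, Rat.cast_natCast] at this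

theorem IsFormallyPAdic.val_p_lt_one (h : IsFormallyPAdic p v) :
    (valuationRing v).valuation (p : K) < 1 := by
  obtain ⟨u, hu, h1⟩ := h.exists_addVal_p
  rw [← map_one (valuationRing v).valuation, valuationRing_val_lt_iff, v.map_one, h1]
  exact_mod_cast hu

theorem IsFormallyPAdic.exists_eq_p_mul (h : IsFormallyPAdic p v) {x : K}
    (hx : (valuationRing v).valuation x < 1) : ∃ y ∈ valuationRing v, x = p * y := by
  have hp0 := natCast_p_ne_zero p K
  refine ⟨x / p, ?_, by field_simp⟩
  have h1 : (valuationRing v).valuation x ≤ (valuationRing v).valuation (p : K) := by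
    rw [valuationRing_val_le_iff]
    rw [← map_one (valuationRing v).valuation, valuationRing_val_lt_iff, v.map_one] at hx
    rcases eq_or_ne (v x) ⊤ with h' | h'
    · simp [h']
    · lift v x to Γ using h' with γ
      exact h.least_pos γ (by exact_mod_cast hx)
  rw [← ValuationSubring.valuation_le_one_iff, map_div₀]
  exact div_le_one_of_le₀ h1 zero_le

theorem IsFormallyPAdic.exists_eq_natCast_add (h : IsFormallyPAdic p v) (x : K)
    (hx : x ∈ valuationRing v) : ∃ j < p, ∃ y ∈ valuationRing v, x = (j : K) + p * y := by
  obtain ⟨e⟩ := h.residueField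
  have : NeZero p := ⟨hp.out.ne_zero⟩
  let x' : valuationRing v := ⟨x, hx⟩
  let j := (e (IsLocalRing.residue _ x')).val
  have h1 : IsLocalRing.residue _ x' = IsLocalRing.residue _ (j : valuationRing v) := by
    apply e.injective
    rw [map_natCast, map_natCast, ZMod.natCast_zmod_val]
  have h2 : x' - j ∈ IsLocalRing.maximalIdeal (valuationRing v) := by
    rw [← IsLocalRing.residue_eq_zero_iff, map_sub, h1, sub_self]
  have h3 := ((valuationRing v).valuation_lt_one_iff _).1 h2
  obtain ⟨y, hy, hxy⟩ := h.exists_eq_p_mul h3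
  refine ⟨j, ZMod.val_lt _, y, hy, ?_⟩
  rw [← hxy]
  simp [x']

/-- Modulo `p` the polynomial is `X ^ n * (X - 1)`, with simple root `1`. -/
theorem IsPAdicallyClosed.exists_hensel_root (h : IsPAdicallyClosed p v) (n : ℕ) (a : Fin n → K)
    (ha : ∀ i, a i ∈ valuationRing v) : ∃ x y : K, y ∈ valuationRing v ∧ x = 1 + p * y ∧
      x ^ (n + 1) - x ^ n + ∑ i, p * a i * x ^ (i : ℕ) = 0 := by
  let R := valuationRing v
  have := h.henselian
  let a' : Fin n → R := fun i => ⟨a i, ha i⟩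
  let S : R[X] := ∑ i, C (a' i) * X ^ (i : ℕ)
  have hS : (C (p : R) * S).degree < (n + 1 : ℕ) := by
    rw [Finset.mul_sum]
    refine lt_of_le_of_lt (degree_sum_le _ _) ?_
    refine (Finset.sup_lt_iff (WithBot.bot_lt_coe _)).2 fun i _ => ?_
    rw [← mul_assoc, ← C_mul]
    refine lt_of_le_of_lt (degree_C_mul_X_pow_le _ _) ?_
    exact_mod_cast i.2.trans n.lt_succ_self
  let f : R[X] := X ^ (n + 1) + (C (p : R) * S - X ^ n)
  have hf : f.Monic := by
    refine monic_X_pow_add ?_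
    refine lt_of_le_of_lt (degree_sub_le _ _) (max_lt hS ?_)
    rw [degree_X_pow]
    exact_mod_cast n.lt_succ_self
  have hpm : (p : R) ∈ IsLocalRing.maximalIdeal R :=
    (R.valuation_lt_one_iff _).2 (by simpa using h.val_p_lt_one)
  obtain ⟨x, hx, hx1⟩ := HenselianLocalRing.is_henselian f hf 1
    (by simpa [f] using Ideal.mul_mem_right _ _ hpm) (by
      have h1 : f.derivative.eval 1 = 1 + p * S.derivative.eval 1 := by
        simp [f, derivative_X_pow]; ring
      rw [h1]
      by_contra hcon
      have h2 := (IsLocalRing.mem_maximalIdeal _).2 hcon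
      have h3 := Ideal.sub_mem _ h2 (Ideal.mul_mem_right (S.derivative.eval 1) _ hpm)
      rw [add_sub_cancel_right] at h3
      exact (Ideal.ne_top_iff_one _).1 (IsLocalRing.maximalIdeal.isMaximal R).ne_top h3)
  obtain ⟨y, hy, hxy⟩ := h.exists_eq_p_mul ((R.valuation_lt_one_iff _).1 hx1)
  refine ⟨x, y, hy, ?_, ?_⟩
  · rw [← hxy]; simp
  · have h1 : ((f.eval x : R) : K) = 0 := by rw [hx.eq_zero]; simp
    have h2 : f.eval x = x ^ (n + 1) + (p * ∑ i, a' i * x ^ (i : ℕ) - x ^ n) := by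
      simp [f, S, eval_finsetSum]
    rw [h2] at h1
    push_cast at h1
    rw [Finset.mul_sum] at h1
    rw [← h1]
    simp only [mul_assoc]
    simp only [a']
    ring

/-- Division with remainder in the value group writes `x` as `p ^ r * y ^ n` times a unit. A natural
number `j` agrees with the unit modulo `p ^ (2 * s + 1)`, and the quotient is an `n`-th power by
Hensel's lemma. -/
theorem IsPAdicallyClosed.exists_eq_natCast_mul_pow (h : IsPAdicallyClosed p v) (n : ℕ) (hn : 0 < n) :
    ∃ Q : ℕ, ∀ x : K, x ≠ 0 → ∃ q : ℕ, 0 < q ∧ q ≤ Q ∧ ∃ y : K, x = q * y ^ n := by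
  obtain ⟨s, k', hk', rfl⟩ := Nat.exists_eq_pow_mul_and_not_dvd hn.ne' p hp.out.ne_one
  have hcop : k'.Coprime p := ((Nat.Prime.coprime_iff_not_dvd hp.out).2 hk').symm
  obtain ⟨u, hu, hvp⟩ := h.exists_addVal_p
  have hp0 := natCast_p_ne_zero p K
  have hppos := hp.out.pos
  let O := valuationRing v
  refine ⟨p ^ (p ^ s * k') * p ^ (2 * s + 1), fun x hx => ?_⟩
  have hvx : v x ≠ ⊤ := by simpa [v.top_iff] using hx
  obtain ⟨γ, hγ⟩ := WithTop.ne_top_iff_exists.1 hvx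
  obtain ⟨δ, r, hr, hδ⟩ := h.presburger u hvp (p ^ s * k') hn γ
  obtain ⟨y, hy⟩ := h.surjective (δ : WithTop Γ)
  have hy0 : y ≠ 0 := by
    rintro rfl; rw [v.map_zero] at hy; exact WithTop.top_ne_coe hy
  have hd0 : (p : K) ^ r * y ^ (p ^ s * k') ≠ 0 := mul_ne_zero (pow_ne_zero _ hp0) (pow_ne_zero _ hy0)
  have hval : O.valuation x = O.valuation ((p : K) ^ r * y ^ (p ^ s * k')) := by
    have h1 : v x = v ((p : K) ^ r * y ^ (p ^ s * k')) := by
      rw [v.map_mul, v.map_pow, v.map_pow, hvp, hy, ← hγ, hδ]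
      norm_cast
      rw [add_comm]
    exact le_antisymm ((valuationRing_val_le_iff v _ _).2 h1.ge)
      ((valuationRing_val_le_iff v _ _).2 h1.le)
  have hunit : O.valuation (x / ((p : K) ^ r * y ^ (p ^ s * k'))) = 1 := by
    rw [map_div₀, hval, div_self ((_root_.map_ne_zero O.valuation).2 hd0)]
  obtain ⟨j, hj, w, hw, hjw⟩ := exists_nat_approx_of_residue h.exists_eq_natCast_add (2 * s + 1) _
    ((O.valuation_le_one_iff _).1 hunit.le)
  have hvj : O.valuation (j : K) = 1 := by
    have h1 : (j : K) = x / ((p : K) ^ r * y ^ (p ^ s * k')) - p ^ (2 * s + 1) * w := by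
      rw [hjw]; ring
    rw [h1, Valuation.map_sub_eq_of_lt_left _ ?_, hunit]
    rw [hunit, map_mul, map_pow]
    exact mul_lt_one_of_lt_of_le (pow_lt_one₀ zero_le h.val_p_lt_one (by omega))
      ((O.valuation_le_one_iff _).2 hw)
  have hj0 : (j : K) ≠ 0 := by
    intro h0; rw [h0] at hvj; simp at hvj
  obtain ⟨z, hz⟩ := exists_root_of_hensel (O := O) h.val_p_lt_one h.exists_hensel_root s hcop
    (y := w / j) (by
      rw [← O.valuation_le_one_iff, map_div₀, hvj, div_one]; exact (O.valuation_le_one_iff _).2 hw)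
  refine ⟨p ^ r * j, Nat.mul_pos (pow_pos hppos _) (Nat.pos_of_ne_zero fun h0 => hj0 (by simp [h0])),
    Nat.mul_le_mul (Nat.pow_le_pow_right hppos hr.le) hj.le, y * z, ?_⟩
  rw [div_eq_iff hd0] at hjw
  rw [hjw, mul_pow, ← hz]
  push_cast
  field_simp

theorem IsPAdicallyClosed.isPClosed (h : IsPAdicallyClosed p v) : IsPClosed p (valuationRing v) :=
  ⟨h.val_p_lt_one, h.exists_eq_natCast_add, h.exists_hensel_root, h.exists_eq_natCast_mul_pow⟩

end PAdicallyClosed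

end PAdicCells

/-! ### Algebraicity of definable functions and points of cells -/

namespace PAdicCells

open FirstOrder

section AlgebraicOver

variable {K : Type*} [Field K] [CharZero K] {S T : Set K} {x y : K}

theorem algebraicOver_iff_mem :
    AlgebraicOver S x ↔ x ∈ algebraicClosure (IntermediateField.adjoin ℚ S) K :=
  mem_algebraicClosure_iff.symm

theorem AlgebraicOver.mono (h : AlgebraicOver S x) (hST : S ⊆ T) : AlgebraicOver T x := by
  have hle := IntermediateField.adjoin.mono ℚ S T hST
  let _ : Algebra (IntermediateField.adjoin ℚ S) (IntermediateField.adjoin ℚ T) :=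
    (IntermediateField.inclusion hle).toAlgebra
  have : IsScalarTower (IntermediateField.adjoin ℚ S) (IntermediateField.adjoin ℚ T) K :=
    IsScalarTower.of_algebraMap_eq fun _ => rfl
  exact IsAlgebraic.tower_top _ h

theorem algebraicOver_of_mem (h : x ∈ S) : AlgebraicOver S x :=
  isAlgebraic_algebraMap
    (⟨x, IntermediateField.subset_adjoin ℚ S h⟩ : IntermediateField.adjoin ℚ S)

end AlgebraicOver

section Definable

variable {K : Type*} [Field K]

/-- Replaces the last variable by an existentially quantified one. -/
noncomputable def existsLast {α : Type*} {n : ℕ} (φ : Ldiv.Formula (α ⊕ Fin (n + 1))) :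
    Ldiv.Formula (α ⊕ Fin n) :=
  (φ.relabel (Sum.elim (fun d => Sum.inl (Sum.inl d))
    (Fin.snoc (fun i => Sum.inl (Sum.inr i)) (Sum.inr ()) :
      Fin (n + 1) → (α ⊕ Fin n) ⊕ Unit))).iExs Unit

theorem holds_existsLast (O : ValuationSubring K) {α : Type*} {n : ℕ}
    (φ : Ldiv.Formula (α ⊕ Fin (n + 1))) (x : α → K) (a : Fin n → K) :
    Holds O (existsLast φ) (Sum.elim x a) default ↔
      ∃ y : K, Holds O φ (Sum.elim x (Fin.snoc a y : Fin (n + 1) → K)) default := by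
  let _ := divStructure O
  have h : ∀ i : Unit → K, Sum.elim (Sum.elim x a) i ∘ (Sum.elim (fun d => Sum.inl (Sum.inl d))
      (Fin.snoc (fun i => Sum.inl (Sum.inr i)) (Sum.inr ()) :
        Fin (n + 1) → (α ⊕ Fin n) ⊕ Unit)) =
      Sum.elim x (Fin.snoc a (i ()) : Fin (n + 1) → K) := by
    intro i
    funext c
    rcases c with c | c
    · rfl
    · refine Fin.lastCases ?_ (fun j => ?_) c <;> simp
  change (existsLast φ).Realize (Sum.elim x a) ↔
    ∃ y : K, φ.Realize (Sum.elim x (Fin.snoc a y : Fin (n + 1) → K))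
  rw [existsLast, Language.Formula.realize_iExs]
  simp only [Language.Formula.realize_relabel, h]
  exact ⟨fun ⟨i, hi⟩ => ⟨i (), hi⟩, fun ⟨y, hy⟩ => ⟨fun _ => y, hy⟩⟩

/-- The values of a definable function are algebraic over the arguments and the parameters. -/
theorem algebraicOver_of_definableOn {p : ℕ} [Fact p.Prime] [CharZero K] {Γ : Type*}
    [AddCommGroup Γ] [LinearOrder Γ] [IsOrderedAddMonoid Γ] {v : AddValuation K (WithTop Γ)}
    (hK : IsPClosed p (valuationRing v)) {D : Set K} {n : ℕ} {B : Set (Fin n → K)}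
    {f : (Fin n → K) → K} (hf : DefinableOn v D B f) {a : Fin n → K} (ha : a ∈ B) :
    AlgebraicOver (Set.range a ∪ D) (f a) := by
  let O := valuationRing v
  obtain ⟨φ, hφ⟩ : ∃ φ : Ldiv.Formula (D ⊕ Fin (n + 1)), ∀ z : Fin (n + 1) → K,
      z ∈ graphOn B f ↔ Holds O φ (Sum.elim (fun d : D => (d : K)) z) default := by
    unfold DefinableOn at hf
    rw [valuedFieldStructure_eq] at hf
    let _ := divStructure O
    obtain ⟨φ, hφ⟩ := Set.definable_iff_exists_formula_sum.1 hf
    exact ⟨φ, fun z => by rw [hφ]; rfl⟩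
  let M := IntermediateField.adjoin ℚ (Set.range a ∪ D)
  let F := algebraicClosure M K
  have hF : IsPClosed p (O.comap (algebraMap F K)) := hK.comap_of_isAlgebraic_imp fun x hx =>
    ⟨⟨x, mem_algebraicClosure_iff.2 (hx.restrictScalars M)⟩, rfl⟩
  have hmem : ∀ x ∈ Set.range a ∪ D, x ∈ F := fun x hx =>
    algebraicOver_iff_mem.1 (algebraicOver_of_mem hx)
  let a' : Fin n → F := fun i => ⟨a i, hmem _ (Or.inl ⟨i, rfl⟩)⟩
  let d' : D → F := fun d => ⟨d, hmem _ (Or.inr d.2)⟩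
  have hsum : ∀ {m : ℕ} (z : Fin m → F), algebraMap F K ∘ Sum.elim d' z =
      Sum.elim (fun d : D => (d : K)) (algebraMap F K ∘ z) := fun z => Sum.comp_elim _ _ _
  have hdef : algebraMap F K ∘ (default : Fin 0 → F) = default := Subsingleton.elim _ _
  -- The existence of a value of `f` at `a` descends to the elementary substructure `F`; the witness
  -- found there satisfies the graph formula in `K` too, so it is `f a`.
  have h1 : Holds O (existsLast φ) (Sum.elim (fun d : D => (d : K)) a) default :=
    (holds_existsLast O φ _ a).2 ⟨f a, (hφ _).1 ⟨by simpa using ha, by simp⟩⟩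
  have h2 := (hF.holds_map_iff (existsLast φ) hK (algebraMap F K) (Sum.elim d' a') default).1 (by
    rw [hsum, hdef]; exact h1)
  obtain ⟨y, hy⟩ := (holds_existsLast _ φ d' a').1 h2
  have h3 := (hF.holds_map_iff φ hK (algebraMap F K) _ default).2 hy
  rw [hsum, hdef, Fin.comp_snoc] at h3
  have h4 := ((hφ _).2 h3).2
  rw [Fin.snoc_last, Fin.init_snoc] at h4
  change (y : K) = f a at h4
  rw [← h4]
  exact algebraicOver_iff_mem.2 y.2

end Definable

section Cells

variable {p : ℕ} [hp : Fact p.Prime] {K : Type*} [Field K] [CharZero K] {O : ValuationSubring K}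

/-- Write `e / x = q * y ^ k` with `q` natural of value that of `p ^ s`. Moving the full `k`-th
powers of `p` out of `q` leaves a rational `r` with the value of `p ^ (s % k)`, less than one `k`-th
step away from `x`. -/
theorem IsPClosed.exists_rat_mul (hK : IsPClosed p O) {k : ℕ} (hk : 0 < k) {x e : K} (hx : x ≠ 0)
    (he : e ≠ 0) (hle : O.valuation e ≤ O.valuation x) : ∃ r : ℚ, r ≠ 0 ∧
      O.valuation e ≤ O.valuation (r * x) ∧ O.valuation (r * x) ≤ O.valuation x ∧
      ∃ w : K, e = r * x * w ^ k := by
  have hp0 := natCast_p_ne_zero p K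
  have hvp := hK.val_p_pos
  have hvx : 0 < O.valuation x := (Valuation.pos_iff _).2 hx
  obtain ⟨Q, hQ⟩ := hK.exists_pow k hk
  obtain ⟨q, hq, -, y, hy⟩ := hQ (e / x) (div_ne_zero he hx)
  obtain ⟨s, hs⟩ := val_natCast_eq_pow (O := O) hK.val_p hq.ne'
  have hpow : (p : K) ^ (k * (s / k)) ≠ 0 := pow_ne_zero _ hp0
  have hvr : O.valuation ((q / p ^ (k * (s / k)) : ℚ) : K) = O.valuation (p : K) ^ (s % k) := by
    push_cast
    rw [map_div₀, map_pow, hs, div_eq_iff (pow_ne_zero _ hvp.ne'), ← pow_add, Nat.mod_add_div]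
  have hew : e = ((q / p ^ (k * (s / k)) : ℚ) : K) * x * (p ^ (s / k) * y) ^ k := by
    rw [div_eq_iff hx] at hy
    push_cast
    rw [hy, mul_pow, ← pow_mul, mul_comm (s / k)]
    field_simp
  refine ⟨q / p ^ (k * (s / k)), div_ne_zero (Nat.cast_ne_zero.2 hq.ne')
    (pow_ne_zero _ (Nat.cast_ne_zero.2 hp.out.ne_zero)), ?_, ?_, p ^ (s / k) * y, hew⟩
  · set w := (p : K) ^ (s / k) * y with hw
    -- Otherwise `w ^ k` would gain at least `k` factors `p⁻¹`, more than the `s % k` factors in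
    -- `r`, and `e` would have larger value than `x`.
    have hw1 : O.valuation w ≤ 1 := by
      by_contra hcon
      have hw1 := not_le.1 hcon
      have h1 : O.valuation w⁻¹ < 1 := by rw [map_inv₀]; exact inv_lt_one_of_one_lt₀ hw1
      have h2 := hK.val_le_p h1
      have h3 : 1 ≤ O.valuation (p : K) * O.valuation w := by
        rwa [map_inv₀, inv_le_iff_one_le_mul₀ (zero_lt_one.trans hw1)] at h2
      have h4 : 1 < O.valuation (p : K) ^ (s % k) * O.valuation w ^ k := by
        refine (one_le_pow₀ h3 (n := k)).trans_lt ?_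
        rw [mul_pow]
        exact mul_lt_mul_of_pos_right (pow_lt_pow_right_of_lt_one₀ hvp hK.val_p
          (Nat.mod_lt s hk)) (pow_pos (zero_lt_one.trans hw1) k)
      refine absurd hle (not_le.2 ?_)
      rw [hew, map_mul, map_mul, hvr, map_pow, mul_right_comm]
      exact lt_mul_of_one_lt_left hvx h4
    conv_lhs => rw [hew, map_mul, map_pow]
    exact mul_le_of_le_one_right' (pow_le_one' hw1 _)
  · rw [map_mul, hvr]
    exact mul_le_of_le_one_left' (pow_le_one' hK.val_p.le _)

/-- In the class of `e` modulo `k`-th powers there is an element satisfying the same bounds as `e`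
which is algebraic over the bounds. -/
theorem exists_algebraic_mem_cell {Γ : Type*} [AddCommGroup Γ] [LinearOrder Γ]
    [IsOrderedAddMonoid Γ] {v : AddValuation K (WithTop Γ)} (hK : IsPClosed p (valuationRing v))
    {k : ℕ} (hk : 0 < k) {S : Set K} {x y e : K} (hx : AlgebraicOver S x) (hy : AlgebraicOver S y)
    (he : e ≠ 0) {box₁ box₂ : Box} (h₁ : box₁.Holds (v x) (v e)) (h₂ : box₂.Holds (v e) (v y)) :
    ∃ t : K, t ≠ 0 ∧ AlgebraicOver S t ∧ box₁.Holds (v x) (v t) ∧ box₂.Holds (v t) (v y) ∧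
      ∃ w : K, e = t * w ^ k := by
  let O := valuationRing v
  have hp0 := natCast_p_ne_zero p K
  have hle : ∀ s t : K, O.valuation s ≤ O.valuation t ↔ v t ≤ v s := valuationRing_val_le_iff v
  have hlt : ∀ s t : K, O.valuation s < O.valuation t ↔ v t < v s := valuationRing_val_lt_iff v
  have hdiv : ∀ {s t : K}, s ≠ 0 → t ≠ 0 → O.valuation s < O.valuation t →
      O.valuation s ≤ O.valuation (p * t) := by
    intro s t hs ht h
    have ht' : 0 < O.valuation t := (Valuation.pos_iff _).2 ht
    have h1 := hK.val_le_p (x := s / t) (by rwa [map_div₀, div_lt_one₀ ht'])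
    rwa [map_div₀, div_le_iff₀ ht', ← map_mul] at h1
  have hplt : ∀ {t : K}, t ≠ 0 → O.valuation (p * t) < O.valuation t := fun {t} ht => by
    rw [map_mul]
    exact mul_lt_of_lt_one_left ((Valuation.pos_iff _).2 ht) hK.val_p
  have halg : ∀ (r : ℚ) {t : K}, AlgebraicOver S t → AlgebraicOver S (r * t) := fun r t ht =>
    algebraicOver_iff_mem.2 (mul_mem (SubfieldClass.ratCast_mem _ r) (algebraicOver_iff_mem.1 ht))
  have hinv : ∀ {t : K}, AlgebraicOver S t → AlgebraicOver S t⁻¹ := fun ht =>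
    algebraicOver_iff_mem.2 (inv_mem (algebraicOver_iff_mem.1 ht))
  have hbelow : ∀ {x : K}, x ≠ 0 → AlgebraicOver S x → O.valuation e ≤ O.valuation x →
      ∃ t : K, t ≠ 0 ∧ AlgebraicOver S t ∧ O.valuation t ≤ O.valuation x ∧
        O.valuation e ≤ O.valuation t ∧ ∃ w : K, e = t * w ^ k := by
    intro x hx0 hx h
    obtain ⟨r, hr, hr₁, hr₂, w, hw⟩ := hK.exists_rat_mul hk hx0 he h
    exact ⟨r * x, mul_ne_zero (Rat.cast_ne_zero.2 hr) hx0, halg r hx, hr₂, hr₁, w, hw⟩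
  have habove : ∀ {y : K}, y ≠ 0 → AlgebraicOver S y → O.valuation y ≤ O.valuation e →
      ∃ t : K, t ≠ 0 ∧ AlgebraicOver S t ∧ O.valuation y ≤ O.valuation t ∧
        ∃ w : K, e = t * w ^ k := by
    intro y hy0 hy h
    have hvy : 0 < O.valuation y := (Valuation.pos_iff _).2 hy0
    obtain ⟨r, hr, -, hr₂, w, hw⟩ := hK.exists_rat_mul hk (inv_ne_zero hy0) (inv_ne_zero he)
      (by rw [map_inv₀, map_inv₀]; exact inv_anti₀ hvy h)
    have ht0 : (r : K) * y⁻¹ ≠ 0 := mul_ne_zero (Rat.cast_ne_zero.2 hr) (inv_ne_zero hy0)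
    refine ⟨(r * y⁻¹)⁻¹, inv_ne_zero ht0, hinv (halg r (hinv hy)), ?_, w⁻¹, ?_⟩
    · rw [map_inv₀] at hr₂ ⊢
      rwa [le_inv_comm₀ hvy ((Valuation.pos_iff _).2 ht0)]
    · rw [inv_pow, ← mul_inv, ← hw, inv_inv]
  -- A `t` obtained by moving from the first bound towards `e` without passing it inherits the
  -- second bound from `e`.
  have hmono : ∀ {t : K}, O.valuation e ≤ O.valuation t → box₂.Holds (v t) (v y) := by
    intro t ht
    rw [hle] at ht
    cases box₂
    · exact ht.trans_lt h₂
    · exact ht.trans h₂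
    · trivial
  cases box₁ with
  | lt =>
    have h₁' := (hlt _ _).2 h₁
    have hx0 : x ≠ 0 := fun h0 => by rw [h0, map_zero] at h₁'; exact not_lt_zero h₁'
    -- For a strict bound start from `p * x`, which discreteness still places on the right side of
    -- `e`.
    obtain ⟨t, ht0, ht, htx, het, hw⟩ := hbelow (mul_ne_zero hp0 hx0) (by simpa using halg p hx)
      (hdiv he hx0 h₁')
    exact ⟨t, ht0, ht, (hlt _ _).1 (htx.trans_lt (hplt hx0)), hmono het, hw⟩
  | le =>
    have h₁' := (hle _ _).2 h₁
    have hx0 : x ≠ 0 := fun h0 => by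
      rw [h0, map_zero, le_zero_iff, map_eq_zero] at h₁'; exact he h₁'
    obtain ⟨t, ht0, ht, htx, het, hw⟩ := hbelow hx0 hx h₁'
    exact ⟨t, ht0, ht, (hle _ _).1 htx, hmono het, hw⟩
  | none =>
    suffices ∃ t : K, t ≠ 0 ∧ AlgebraicOver S t ∧ box₂.Holds (v t) (v y) ∧ ∃ w : K, e = t * w ^ k by
      obtain ⟨t, ht0, ht, h, hw⟩ := this
      exact ⟨t, ht0, ht, trivial, h, hw⟩
    -- Without an effective bound, the second value being absent or `⊤`, the natural representative
    -- of the class suffices. Otherwise the search starts from `y`, or from `p⁻¹ * y` if the bound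
    -- is strict.
    by_cases hcase : box₂ = Box.none ∨ y = 0
    · obtain ⟨Q, hQ⟩ := hK.exists_pow k hk
      obtain ⟨q, hq, -, w, hw⟩ := hQ e he
      have hq0 : (q : K) ≠ 0 := Nat.cast_ne_zero.2 hq.ne'
      refine ⟨q, hq0, algebraicOver_iff_mem.2 (natCast_mem _ q), ?_, w, hw⟩
      cases box₂ with
      | none => trivial
      | lt =>
        rw [hcase.resolve_left (by simp), v.map_zero]
        exact lt_top_iff_ne_top.2 (by simpa [v.top_iff] using hq0)
      | le =>
        rw [hcase.resolve_left (by simp), v.map_zero]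
        exact le_top
    · push Not at hcase
      obtain ⟨hb, hy0⟩ := hcase
      cases box₂ with
      | none => exact absurd rfl hb
      | lt =>
        have h₂' := (hlt _ _).2 h₂
        obtain ⟨t, ht0, ht, hyt, hw⟩ := habove (y := ((p⁻¹ : ℚ) : K) * y)
          (mul_ne_zero (by simpa using hp0) hy0) (halg _ hy) (by
            have h1 := hdiv hy0 he h₂'
            rw [map_mul] at h1 ⊢
            push_cast
            rw [map_inv₀]
            exact inv_mul_le_of_le_mul₀ zero_le zero_le h1)
        refine ⟨t, ht0, ht, (hlt _ _).1 (lt_of_lt_of_le ?_ hyt), hw⟩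
        have h1 := hplt (t := ((p⁻¹ : ℚ) : K) * y) (mul_ne_zero (by simpa using hp0) hy0)
        push_cast at h1 ⊢
        rwa [mul_inv_cancel_left₀ hp0] at h1
      | le =>
        obtain ⟨t, ht0, ht, hyt, hw⟩ := habove hy0 hy ((hle _ _).2 h₂)
        exact ⟨t, ht0, ht, (hle _ _).1 hyt, hw⟩

theorem interalgebraic_of_eq {S : Set K} {c c₁ c' g t : K} {k : ℕ} (hk : 0 < k)
    (hc₁ : c₁ = c ∨ c₁ = c⁻¹) (hg : AlgebraicOver S g) (ht : AlgebraicOver S t) (ht0 : t ≠ 0)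
    (hc' : c' = g + t * (1 + p * c₁) ^ k) : Interalgebraic S c c' := by
  have hp0 := natCast_p_ne_zero p K
  have hmem : ∀ {z x : K}, AlgebraicOver S x →
      x ∈ algebraicClosure (IntermediateField.adjoin ℚ (S ∪ {z})) K := fun h =>
    algebraicOver_iff_mem.1 (h.mono Set.subset_union_left)
  have hself : ∀ z : K, z ∈ algebraicClosure (IntermediateField.adjoin ℚ (S ∪ {z})) K := fun z =>
    algebraicOver_iff_mem.1 (algebraicOver_of_mem (by simp))
  constructor
  · have h1 : c₁ ∈ algebraicClosure (IntermediateField.adjoin ℚ (S ∪ {c})) K := by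
      rcases hc₁ with rfl | rfl
      · exact hself _
      · exact inv_mem (hself c)
    rw [algebraicOver_iff_mem, hc']
    exact add_mem (hmem hg) (mul_mem (hmem ht)
      (pow_mem (add_mem (one_mem _) (mul_mem (natCast_mem _ p) h1)) k))
  · set M := algebraicClosure (IntermediateField.adjoin ℚ (S ∪ {c'})) K
    have h1 : (1 + p * c₁) ^ k ∈ M := by
      have : (1 + p * c₁) ^ k = (c' - g) / t := by rw [hc']; field_simp; ring
      rw [this]
      exact div_mem (sub_mem (hself c') (hmem hg)) (hmem ht)
    have h2 : 1 + p * c₁ ∈ M :=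
      mem_algebraicClosure_iff.2 (IsAlgebraic.of_pow hk (mem_algebraicClosure_iff.1 h1))
    have h3 : c₁ ∈ M := by
      have : c₁ = (1 + p * c₁ - 1) / p := by field_simp; ring
      rw [this]
      exact div_mem (sub_mem h2 (one_mem _)) (natCast_mem _ p)
    rw [algebraicOver_iff_mem]
    rcases hc₁ with rfl | rfl
    · exact h3
    · simpa using inv_mem h3

end Cells

end PAdicCells

/-! ### The interalgebraic point of the cell -/

open PAdicCells in
theorem mainTheorem6 {K Γ : Type*} [Field K] [CharZero K]
    [AddCommGroup Γ] [LinearOrder Γ] [IsOrderedAddMonoid Γ]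
    (p : ℕ) [Fact p.Prime] (v : AddValuation K (WithTop Γ)) (hK : IsPAdicallyClosed p v)
    -- the cell: base, bounds `f`, `h`, centre `g`, and the remaining data
    {n : ℕ} (B : Set (Fin n → K)) (hB : IsCell v B)
    (f g h : (Fin n → K) → K)
    (hfc : ContOn v B f) (hgc : ContOn v B g) (hhc : ContOn v B h)
    (lam : K) (hlam : lam ≠ 0) (k : ℕ) (box₁ box₂ : Box)
    -- `D` holds the parameters of `f` and `g`, `E` those of `h`
    (D E : Set K) (hf : DefinableOn v D B f) (hg : DefinableOn v D B g) (hh : DefinableOn v E B h)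
    (a : Fin n → K) (b c : K)
    (hab : (Fin.snoc a b : Fin (n + 1) → K) ∈ cellOver v B f g h lam k box₁ box₂)
    (hb : IndependentFrom (Set.range a ∪ {lam} ∪ D) b)
    (hc : IndependentFrom (Set.range a) c) :
    ∃ c' : K, Interalgebraic (Set.range a ∪ D ∪ E) c c' ∧
      (Fin.snoc a c' : Fin (n + 1) → K) ∈ cellOver v B f g h lam k box₁ box₂ := by
  have hKp := hK.isPClosed
  simp only [cellOver, Set.mem_ofPred_eq, Fin.init_snoc, Fin.snoc_last] at hab ⊢
  obtain ⟨haB, hbox₁, hbox₂, hne, z, hz⟩ := hab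
  have he : b - g a ≠ 0 := right_ne_zero_of_mul hne
  have hfa := algebraicOver_of_definableOn hKp hf haB
  have hga := algebraicOver_of_definableOn hKp hg haB
  have hha := algebraicOver_of_definableOn hKp hh haB
  -- For `k = 0` the power condition reads `lam * (b - g a) = 1`, which makes `b` algebraic over
  -- `a`, `lam` and `D`.
  have hk : 0 < k := by
    refine Nat.pos_of_ne_zero fun hk => hb ?_
    have hb' : b = g a + lam⁻¹ := by
      rw [hk, pow_zero] at hz
      rw [← eq_inv_of_mul_eq_one_right hz]; ring
    have hsub : Set.range a ∪ D ⊆ Set.range a ∪ {lam} ∪ D :=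
      Set.union_subset_union_left D Set.subset_union_left
    change AlgebraicOver _ b
    rw [hb', algebraicOver_iff_mem]
    exact add_mem (algebraicOver_iff_mem.1 (hga.mono hsub))
      (inv_mem (algebraicOver_iff_mem.1 (algebraicOver_of_mem (by simp))))
  obtain ⟨t, ht0, ht, ht₁, ht₂, w, hw⟩ := exists_algebraic_mem_cell hKp hk
    (S := Set.range a ∪ D ∪ E) (hfa.mono Set.subset_union_left)
    (hha.mono (Set.union_subset_union_left E Set.subset_union_left)) he hbox₁ hbox₂
  obtain ⟨c₁, hc₁O, hc₁⟩ : ∃ c₁ ∈ valuationRing v, c₁ = c ∨ c₁ = c⁻¹ := by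
    rcases (valuationRing v).mem_or_inv_mem c with h | h
    · exact ⟨c, h, Or.inl rfl⟩
    · exact ⟨c⁻¹, h, Or.inr rfl⟩
  have hunit : (valuationRing v).valuation (1 + p * c₁) = 1 := by
    have hlt : (valuationRing v).valuation (p * c₁) < (valuationRing v).valuation 1 := by
      rw [map_mul, map_one]
      exact mul_lt_one_of_lt_of_le hKp.val_p ((ValuationSubring.valuation_le_one_iff _ _).2 hc₁O)
    rw [Valuation.map_add_eq_of_lt_left _ hlt, map_one]
  have hval : v (t * (1 + p * c₁) ^ k) = v t := by
    have h1 : (valuationRing v).valuation (t * (1 + p * c₁) ^ k) =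
        (valuationRing v).valuation t := by
      rw [map_mul, map_pow, hunit, one_pow, mul_one]
    exact le_antisymm ((valuationRing_val_le_iff v _ _).1 h1.ge)
      ((valuationRing_val_le_iff v _ _).1 h1.le)
  have hunit0 : 1 + p * c₁ ≠ 0 := by
    intro h0; rw [h0, map_zero] at hunit; exact zero_ne_one hunit
  have hw0 : w ≠ 0 := by
    rintro rfl; rw [zero_pow hk.ne', mul_zero] at hw; exact he hw
  refine ⟨g a + t * (1 + p * c₁) ^ k, interalgebraic_of_eq hk hc₁
    (hga.mono Set.subset_union_left) ht ht0 rfl, haB, ?_⟩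
  rw [add_sub_cancel_left, hval]
  -- Since `e = t * w ^ k` and `lam * e = z ^ k`, replacing `e` by `t * (1 + p * c₁) ^ k` multiplies
  -- the root `z` by `(1 + p * c₁) / w`.
  refine ⟨ht₁, ht₂, mul_ne_zero hlam (mul_ne_zero ht0 (pow_ne_zero _ hunit0)),
    z * (1 + p * c₁) / w, ?_⟩
  rw [div_pow, mul_pow, ← hz, hw]
  field_simp
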